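/- Let $G=\mu_2\times\mu_2<\mathrm{SL}_3(\mathbb C)$ be the group of all diagonal matrices of determinant $1$ that square to the identity, and let $\rho_0=\mathrm{triv},\rho_1,\rho_2,\rho_3$ be its irreducible characters (in any order with $\rho_0$ trivial). A plane partition is a finite subset $\alpha\subset\mathbb N^3$ stable under moving in the negative coordinate directions. A box $(i,j,k)\in\alpha$ has colour $c$ if $G$ acts on the monomial $x^iy^jz^k$ through $\rho_c$; let $w_c(\alpha)$ be the number of boxes of $\alpha$ of colour $c$, and put \[Z^{\mu_2\times\mu_2}(t_0,t_1,t_2,t_3)=\sum_{\alpha} t_0^{w_0(\alpha)}t_1^{w_1(\alpha)}t_2^{w_2(\alpha)}t_3^{w_3(\alpha)},\] the sum being over all plane partitions. For a power series with integer coefficients and zero constant term, written $\sum_{\mathbf n\ne 0}\sigma_{\mathbf n}a_{\mathbf n}\mathbf x^{\mathbf n}$ with $a_{\mathbf n}\in\mathbb N$ and $\sigma_{\mathbf n}\in\{\pm1\}$, define the twisted plethystic exponential \[\mathrm{PExp}^\sigma\Big(\sum_{\mathbf n\neq 0}\sigma_{\mathbf n}a_{\mathbf n}\mathbf x^{\mathbf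 n}\Big)=\prod_{\mathbf n\neq 0}(1-\sigma_{\mathbf n}\mathbf x^{\mathbf n})^{-\sigma_{\mathbf n}a_{\mathbf n}}.\] Put $t=t_0t_1t_2t_3$, choose square roots $t_1^{1/2},t_2^{1/2},t_3^{1/2}$ of the variables in a field containing $\mathbb Z[[t_0,t_1,t_2,t_3]]$, and put $(t_1t_2t_3)^{1/2}=t_1^{1/2}t_2^{1/2}t_3^{1/2}$. Then the expression \[\frac{t}{(1-t)^2}\Big(2+(t_1^{1/2}-t_1^{-1/2})(t_2^{1/2}-t_2^{-1/2})(t_3^{1/2}-t_3^{-1/2})\big((t_1t_2t_3)^{-1/2}-(t_1t_2t_3)^{1/2}\big)\Big)\] is (the expansion around $0$ of) a power series in $\mathbb Z[[t_0,t_1,t_2,t_3]]$ with zero constant term, and \[Z^{\mu_2\times\mu_2}=\mathrm{PExp}^\sigma\left(\frac{t}{(1-t)^2}\Big(2+(t_1^{1/2}-t_1^{-1/2})(t_2^{1/2}-t_2^{-1/2})(t_3^{1/2}-t_3^{-1/2})\big((t_1t_2t_3)^{-1/2}-(t_1t_2t_3)^{1/2}\big)\Big)\right).\] Equivalently, with a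 further variable $t_4$ such that $t_1t_2t_3t_4=1$ and $t_4^{1/2}=(t_1t_2t_3)^{-1/2}$, the argument of $\mathrm{PExp}^\sigma$ is $\frac{t}{(1-t)^2}\big(2+\prod_{j=1}^4(t_j^{1/2}-t_j^{-1/2})\big)$. The $\mathfrak{sl}_2^3$-symmetry is seen in the product $\prod_{j=1}^3(t_j^{1/2}-t_j^{-1/2})$: it is the signed character of the fundamental representation $\mathbb C^2\otimes\mathbb C^2\otimes\mathbb C^2$ of $\mathfrak{sl}_2^3$, that is, the supertrace of $\bigotimes_{j=1}^3\mathrm{diag}(t_j^{1/2},t_j^{-1/2})$, where in each factor $\mathbb C^2$ the highest weight line is even and the lowest weight line is odd. -/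

import Mathlib

open scoped Kronecker

noncomputable section

/-! ### The twisted plethystic exponential -/

/-- The factor `(1 - σₙ xⁿ) ^ (-σₙ aₙ)`, where the coefficient of `xⁿ` in `F` is `σₙ aₙ` with
`aₙ ≥ 0` and `σₙ = ± 1`: it is `((1 - xⁿ)⁻¹) ^ aₙ` if the coefficient is nonnegative and
`(1 + xⁿ) ^ aₙ` if it is nonpositive. -/
def twistedFactor {ι : Type*} (F : MvPowerSeries ι ℤ) (n : ι →₀ ℕ) : MvPowerSeries ι ℤ :=
  if 0 ≤ MvPowerSeries.coeff n F then
    (MvPowerSeries.invOfUnit (1 - MvPowerSeries.monomial n 1) 1) ^ (MvPowerSeries.coeff n F).toNat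
  else
    (1 + MvPowerSeries.monomial n 1) ^ (-MvPowerSeries.coeff n F).toNat

open scoped MvPowerSeries.WithPiTopology in
/-- The twisted plethystic exponential of a power series `F` with integer coefficients and zero
constant term: the product of the factors over all nonzero exponents, in the topology of
coefficientwise stabilisation (the product topology, with `ℤ` discrete). -/
def twistedPExp {ι : Type*} (F : MvPowerSeries ι ℤ) : MvPowerSeries ι ℤ :=
  ∏' n : {n : ι →₀ ℕ // n ≠ 0}, twistedFactor F n

theorem monomial_dvd_twistedFactor_sub_one {ι : Type*} (F : MvPowerSeries ι ℤ) (n : ι →₀ ℕ)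
    (hn : n ≠ 0) : MvPowerSeries.monomial n 1 ∣ twistedFactor F n - 1 := by
  classical
  unfold twistedFactor
  split_ifs with h
  · refine dvd_trans ?_ (sub_one_dvd_pow_sub_one _ _)
    refine ⟨MvPowerSeries.invOfUnit (1 - MvPowerSeries.monomial n 1) 1, ?_⟩
    have := MvPowerSeries.mul_invOfUnit (1 - MvPowerSeries.monomial n (1 : ℤ)) 1 (by
      rw [map_sub, ← MvPowerSeries.coeff_zero_eq_constantCoeff_apply (MvPowerSeries.monomial n 1),
        MvPowerSeries.coeff_monomial]
      simp [hn.symm])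
    linear_combination this
  · refine dvd_trans ?_ (sub_one_dvd_pow_sub_one _ _)
    simp

open scoped MvPowerSeries.WithPiTopology in
/-- The product defining `twistedPExp` always converges. -/
theorem multipliable_twistedFactor {ι : Type*} (F : MvPowerSeries ι ℤ) :
    Multipliable fun n : {n : ι →₀ ℕ // n ≠ 0} => twistedFactor F n := by
  classical
  have key : Multipliable fun n : {n : ι →₀ ℕ // n ≠ 0} => 1 + (twistedFactor F n - 1) := by
    apply multipliable_one_add_of_summable_prod
    refine MvPowerSeries.WithPiTopology.summable_iff_summable_coeff.mpr fun d ↦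
      summable_of_hasFiniteSupport ?_
    have hfin : {n : {n : ι →₀ ℕ // n ≠ 0} | n.1 ≤ d}.Finite :=
      Set.Finite.preimage Subtype.val_injective.injOn (Set.finite_Iic d)
    apply hfin.toFinset.powerset.finite_toSet.subset
    intro s hs
    simp only [Finset.coe_powerset, Set.mem_preimage, Set.mem_powerset_iff]
    intro n hns
    simp only [Set.Finite.coe_toFinset, Set.mem_ofPred_eq]
    by_contra hnd
    apply hs
    obtain ⟨g, hg⟩ := (monomial_dvd_twistedFactor_sub_one F n.1 n.2).trans
      (Finset.dvd_prod_of_mem (fun n : {n : ι →₀ ℕ // n ≠ 0} => twistedFactor F n - 1) hns)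
    change MvPowerSeries.coeff d (∏ i ∈ s, (twistedFactor F i - 1)) = 0
    rw [hg, MvPowerSeries.coeff_monomial_mul, if_neg hnd]
  simpa using key

/-! ### The group `μ₂ × μ₂` in `SL₃(ℂ)` and coloured plane partitions -/

/-- The group `μ₂ × μ₂`: all diagonal matrices in `SL₃(ℂ)` that square to the identity. -/
def mu2mu2 : Subgroup (Matrix.SpecialLinearGroup (Fin 3) ℂ) where
  carrier := {g | g.1.IsDiag ∧ g ^ 2 = 1}
  one_mem' := ⟨by simp, by simp⟩
  mul_mem' := by
    rintro a b ⟨ha, ha2⟩ ⟨hb, hb2⟩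
    have hc : a * b = b * a := by
      apply Subtype.ext
      change a.1 * b.1 = b.1 * a.1
      rw [← ha.diagonal_diag, ← hb.diagonal_diag, Matrix.diagonal_mul_diagonal,
        Matrix.diagonal_mul_diagonal]
      simp_rw [mul_comm]
    refine ⟨?_, ?_⟩
    · change (a.1 * b.1).IsDiag
      rw [← ha.diagonal_diag, ← hb.diagonal_diag, Matrix.diagonal_mul_diagonal]
      exact Matrix.isDiag_diagonal _
    · rw [(show Commute a b from hc).mul_pow, ha2, hb2, one_mul]
  inv_mem' := by
    rintro a ⟨ha, ha2⟩
    have : a⁻¹ = a := inv_eq_of_mul_eq_one_left (by rw [← sq, ha2])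
    rw [this]
    exact ⟨ha, ha2⟩

/-- The character by which `μ₂ × μ₂` acts on the `l`-th coordinate: `g ↦ g_{ll}`. -/
def coordCharacter (l : Fin 3) : mu2mu2 →* ℂˣ :=
  MonoidHom.toHomUnits
    { toFun := fun g => g.1.1 l l
      map_one' := by simp
      map_mul' := by
        intro a b
        change (a.1.1 * b.1.1) l l = _
        rw [← a.2.1.diagonal_diag, ← b.2.1.diagonal_diag, Matrix.diagonal_mul_diagonal]
        simp }

/-- The character of the one-dimensional eigenspace spanned by the monomial `x^i y^j z^k`
attached to the box `(i, j, k)`. -/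
def boxCharacter (b : Fin 3 → ℕ) : mu2mu2 →* ℂˣ := ∏ l, coordCharacter l ^ b l

/-- Plane partitions: finite subsets of `ℕ³` stable under moving in the negative coordinate
directions. -/
def PlanePartition : Type := {α : Finset (Fin 3 → ℕ) // IsLowerSet (α : Set (Fin 3 → ℕ))}

open Classical in
/-- The weight vector `(w₀(α), …, w₃(α))`, where `w_c(α)` is the number of boxes of colour `c`,
for a labelling `ρ₀, …, ρ₃` of the irreducible characters. -/
def colourWeight (ρ : Fin 4 ≃ (mu2mu2 →* ℂˣ)) (α : PlanePartition) : Fin 4 →₀ ℕ :=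
  Finsupp.equivFunOnFinite.symm fun c => (α.1.filter fun b => boxCharacter b = ρ c).card

/-- The generating function `∑_α x^{w(α)}` of coloured plane partitions. -/
def colouredPartitionFunction (ρ : Fin 4 ≃ (mu2mu2 →* ℂˣ)) : MvPowerSeries (Fin 4) ℤ :=
  fun n => (Set.ncard {α : PlanePartition | colourWeight ρ α = n} : ℤ)

/-- There are finitely many plane partitions of each weight, so that the cardinality in
`colouredPartitionFunction` is that of a finite set. -/
theorem finite_colourWeight_eq (ρ : Fin 4 ≃ (mu2mu2 →* ℂˣ)) (n : Fin 4 →₀ ℕ) :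
    {α : PlanePartition | colourWeight ρ α = n}.Finite := by
  classical
  set N := ∑ c, n c with hN
  have hfin : (Set.Iic (fun _ : Fin 3 => N)).Finite := Set.finite_Iic _
  refine Set.Finite.of_finite_image (f := fun α : PlanePartition => α.1) ?_
    (fun a _ b _ h => Subtype.ext h)
  apply hfin.toFinset.powerset.finite_toSet.subset
  rintro _ ⟨α, hα, rfl⟩
  simp only [Set.mem_ofPred_eq] at hα
  simp only [Finset.coe_powerset, Set.mem_preimage, Set.mem_powerset_iff, Set.Finite.coe_toFinset]
  have hcard : α.1.card = N := by
    rw [hN, ← hα, Finset.card_eq_sum_card_fiberwise (f := fun b => ρ.symm (boxCharacter b))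
      (t := Finset.univ) (by simp)]
    refine Finset.sum_congr rfl fun c _ => ?_
    simp [colourWeight, Equiv.symm_apply_eq]
  intro b hb l
  have hsub : (Finset.range (b l + 1)).image (fun m => Function.update b l m) ⊆ α.1 := by
    intro x hx
    obtain ⟨m, hm, rfl⟩ := Finset.mem_image.mp hx
    refine α.2 (?_ : Function.update b l m ≤ b) hb
    exact update_le_iff.mpr
      ⟨Nat.lt_succ_iff.mp (Finset.mem_range.mp hm), fun _ _ => le_rfl⟩
  have := Finset.card_le_card hsub
  rw [Finset.card_image_of_injective _ (Function.update_injective b l), Finset.card_range,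
    hcard] at this
  change b l ≤ N
  omega

/-! ### The representation `ℂ² ⊗ ℂ² ⊗ ℂ²` of `sl₂³` -/

/-- The element `diag (u, u⁻¹)` of the maximal torus of `SL₂`, acting on the standard
representation. -/
def sl2Torus {K : Type*} [Field K] (u : K) : Matrix (Fin 2) (Fin 2) K :=
  Matrix.diagonal ![u, u⁻¹]

/-- The parity operator of the standard representation of `SL₂`: `1` on the highest weight line
and `-1` on the lowest weight line. -/
def sl2Parity (K : Type*) [Field K] : Matrix (Fin 2) (Fin 2) K :=
  Matrix.diagonal ![1, -1]

/-- The signed character (supertrace), at the torus element given by `u₁, u₂, u₃`, of the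
fundamental representation of `sl₂³`, the tensor product of the three standard representations. -/
def fundamentalSignedCharacter {K : Type*} [Field K] (u : Fin 3 → K) : K :=
  Matrix.trace ((sl2Parity K ⊗ₖ sl2Parity K ⊗ₖ sl2Parity K) *
    (sl2Torus (u 0) ⊗ₖ sl2Torus (u 1) ⊗ₖ sl2Torus (u 2)))

end

open scoped Kronecker
open scoped ENNReal NNReal

noncomputable section

section

/-! ### Sums of products over finite families of naturals -/

/-! A plane partition is a height function on the quarter plane. Since the product of the three
coordinate characters is trivial, the colour of `(i, j, k)` depends only on the parities of `i + k`
and `j + k`. The engine is a local move, `heightSum_flip`: fix the heights off a set `M` of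
positions of one parity and sum over the heights on `M`, which are then independent. Each local sum
runs over an interval between the maximum and the minimum of neighbouring heights, and
`sum_Icc_prod_range` rewrites it as a sum with new weights times one function of the lower end and
one of the upper end. The lower end at a position and the upper end one diagonal step further are
the max and min of the same two heights, so these factors pass to the neighbours as a change of
weights. The corners of lowest level have no upper bound; they split off explicit factors and leave
the region.

For the coloured weights, two successive flips multiply the weights of one parity class by `t` and
those of the other by `t⁻¹`, and split off certain factors of the plethystic exponential. After `K`
double flips the generating function is an explicit product times a remainder whose monomials are
shifted by `t` to the power `K` times the imbalance of the two classes
(`exists_heightSeries_eq_mul`). Hence monomials of positive imbalance in the remainder have degree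
at least `4 K`. The factors split off are the only ones of positive imbalance, so in the limit the
quotient `Y` of the generating function by the plethystic exponential has no monomial of positive
imbalance (`noPositive_quotient`).

Starting with either parity class makes the imbalance of every monomial of `Y` zero. Letting each of
the three axes play the vertical role gives three such equations, and they force all four exponents
to agree: `Y` is a series in `t` alone (`eq_of_coeff_quotient_ne_zero`). Such a series is detected
by setting all variables equal to `q`. There the plethystic exponential becomes MacMahon's product,
and so does the generating function, by the same flips with weights constant along diagonals
(`exists_boxSeries_eq_mul`). So `Y = 1`.

The sums are computed in `ℝ≥0∞` at small positive points, and `exists_countSeries_eq_mul` turns the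
identities of values into identities of power series. The closed form of the argument comes from
taking second differences of its coefficients (`sq_mul_plethysticArgument`). -/

theorem ENNReal.tsum_pi_prod {ι α : Type*} [Fintype ι] (F : ι → α → ℝ≥0∞) :
    ∑' g : ι → α, ∏ i, F i (g i) = ∏ i, ∑' m, F i m := by
  classical
  have fin : ∀ (n : ℕ) (F : Fin n → α → ℝ≥0∞),
      ∑' g : Fin n → α, ∏ i, F i (g i) = ∏ i, ∑' m, F i m := by
    intro n
    induction n with
    | zero => intro F; simp
    | succ n ih =>
      intro F
      rw [← (Fin.consEquiv fun _ : Fin (n + 1) => α).tsum_eq, Fin.prod_univ_succ, ← ih]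
      simp only [Fin.consEquiv_apply, Fin.prod_univ_succ, Fin.cons_zero, Fin.cons_succ]
      rw [ENNReal.tsum_prod (f := fun a (g : Fin n → α) => F 0 a * ∏ i, F i.succ (g i))]
      simp_rw [ENNReal.tsum_mul_left, ENNReal.tsum_mul_right]
  let e := Fintype.equivFin ι
  rw [← (Equiv.arrowCongr e.symm (Equiv.refl α)).tsum_eq, ← e.symm.prod_comp, ← fin]
  refine tsum_congr fun g => ?_
  rw [← e.symm.prod_comp]
  simp

/-! ### Weighted sums over an interval with alternating weights -/

section Interval

variable {a : ℕ → ℝ≥0}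

/-- Period two makes every product `a n * a (n + 1)` equal to `a 0 * a 1`, so multiplying by `a 0 *
a 1` shifts the summands by two places and only two terms at each end survive. -/
theorem sum_prod_range_telescope (hper : ∀ k, a (k + 2) = a k) {lo n : ℕ} (h : lo ≤ n) :
    ∑ m ∈ Finset.Ico lo n, ∏ k ∈ Finset.range m, a k
        + (∏ k ∈ Finset.range n, a k) * (1 + a n) =
      a 0 * a 1 * ∑ m ∈ Finset.Ico lo n, ∏ k ∈ Finset.range m, a k
        + (∏ k ∈ Finset.range lo, a k) * (1 + a lo) := by
  have hP : ∀ n, a n * a (n + 1) = a 0 * a 1 := by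
    intro n
    induction n with
    | zero => rfl
    | succ n ih => rw [hper, mul_comm, ih]
  induction n, h using Nat.le_induction with
  | base => simp
  | succ n hn ih =>
    rw [Finset.sum_Ico_succ_top hn, Finset.prod_range_succ]
    set A := ∏ k ∈ Finset.range n, a k
    set S := ∑ m ∈ Finset.Ico lo n, ∏ k ∈ Finset.range m, a k
    calc S + A + A * a n * (1 + a (n + 1)) = (S + A * (1 + a n)) + A * (a n * a (n + 1)) := by ring
      _ = _ := by rw [ih, hP n]; ring

/-- By periodicity each factor is `a k * (1 + a (k + 1)) / (1 + a k)`, so the fractions telescope.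
-/
theorem prod_range_alternating (hpos : ∀ k, 0 < a k) (hper : ∀ k, a (k + 2) = a k) (m : ℕ) :
    (∏ k ∈ Finset.range m, a (k + 2) * (1 + a (k + 1)) / (1 + a (k + 2))) * (1 + a 0) =
      (∏ k ∈ Finset.range m, a k) * (1 + a m) := by
  induction m with
  | zero => simp
  | succ m ih =>
    rw [Finset.prod_range_succ, Finset.prod_range_succ, mul_right_comm, ih, hper]
    have := (add_pos one_pos (hpos m)).ne'
    field_simp

/-- For constant `a` this is the reflection `m ↦ lo + hi - m`; the quotients of `1 + a k` correct it
for period two. What matters later is that the correction is a function of `hi` times a function of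
`lo`. -/
theorem sum_Icc_prod_range (hpos : ∀ k, 0 < a k) (hper : ∀ k, a (k + 2) = a k) (lo hi : ℕ) :
    ∑ m ∈ Finset.Icc lo hi, ∏ k ∈ Finset.range m, a k =
      (∏ k ∈ Finset.range hi, a (k + 1) * (1 + a k) / (1 + a (k + 1))) *
        (∏ k ∈ Finset.range lo, a (k + 2) * (1 + a (k + 1)) / (1 + a (k + 2))) *
        ∑ m ∈ Finset.Icc lo hi, ∏ k ∈ Finset.range m, (a (k + 1))⁻¹ := by
  have hP : ∀ n, a n * a (n + 1) = a 0 * a 1 := by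
    intro n
    induction n with
    | zero => rfl
    | succ n ih => rw [hper, mul_comm, ih]
  have h1 : ∀ k, 1 + a k ≠ 0 := fun k => (add_pos one_pos (hpos k)).ne'
  rcases lt_or_ge hi lo with hlt | hle
  · simp [Finset.Icc_eq_empty_of_lt hlt]
  have hββ : ∀ m, (∏ k ∈ Finset.range m, a (k + 1) * (1 + a k) / (1 + a (k + 1))) *
      (∏ k ∈ Finset.range m, a (k + 2) * (1 + a (k + 1)) / (1 + a (k + 2))) = (a 0 * a 1) ^ m := by
    intro m
    rw [← Finset.prod_mul_distrib, ← Finset.card_range m, ← Finset.prod_const, Finset.card_range]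
    refine Finset.prod_congr rfl fun k _ => ?_
    rw [hper, ← hP k]
    have := h1 k; have := h1 (k + 1)
    field_simp
  have hA' : ∀ m, (∏ k ∈ Finset.range m, (a (k + 1))⁻¹) * (a 0 * a 1) ^ m =
      ∏ k ∈ Finset.range m, a k := by
    intro m
    rw [← Finset.card_range m, ← Finset.prod_const, Finset.card_range, ← Finset.prod_mul_distrib]
    refine Finset.prod_congr rfl fun k _ => ?_
    rw [← hP k]
    have := (hpos (k + 1)).ne'
    field_simp
  set β := fun m => ∏ k ∈ Finset.range m, a (k + 1) * (1 + a k) / (1 + a (k + 1)) with hβ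
  set γ := fun m => ∏ k ∈ Finset.range m, a (k + 2) * (1 + a (k + 1)) / (1 + a (k + 2)) with hγ
  have hγpos : ∀ m, γ m ≠ 0 := fun m => (Finset.prod_pos fun k _ =>
    div_pos (mul_pos (hpos _) (add_pos one_pos (hpos _))) (add_pos one_pos (hpos _))).ne'
  have hγA : ∀ m, γ m * (1 + a 0) = (∏ k ∈ Finset.range m, a k) * (1 + a m) :=
    prod_range_alternating hpos hper
  -- Since `β m * γ m = (a 0 * a 1) ^ m`, multiplying by `γ hi` removes `β` and makes the identity
  -- accessible to induction on `hi`.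
  suffices h : γ hi * ∑ m ∈ Finset.Icc lo hi, ∏ k ∈ Finset.range m, a k =
      (a 0 * a 1) ^ hi * γ lo * ∑ m ∈ Finset.Icc lo hi, ∏ k ∈ Finset.range m, (a (k + 1))⁻¹ by
    apply mul_left_cancel₀ (hγpos hi)
    rw [h, ← hββ]
    change β hi * γ hi * γ lo * _ = γ hi * (β hi * γ lo * _)
    ring
  induction hi, hle using Nat.le_induction with
  | base =>
    simp only [Finset.Icc_self, Finset.sum_singleton]
    rw [← hA']; ring
  | succ n hn ih =>
    rw [← Finset.Ico_add_one_right_eq_Icc] at ih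
    have tele := sum_prod_range_telescope hper (show lo ≤ n + 1 by omega)
    have hsum : ∀ f : ℕ → ℝ≥0, ∑ m ∈ Finset.Icc lo (n + 1), f m =
        ∑ m ∈ Finset.Ico lo (n + 1), f m + f (n + 1) := fun f => by
      rw [← Finset.Ico_add_one_right_eq_Icc, Finset.sum_Ico_succ_top (by omega)]
    rw [hsum, hsum]
    set S := ∑ m ∈ Finset.Ico lo (n + 1), ∏ k ∈ Finset.range m, a k
    set S' := ∑ m ∈ Finset.Ico lo (n + 1), ∏ k ∈ Finset.range m, (a (k + 1))⁻¹
    apply mul_right_cancel₀ (h1 0)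
    calc γ (n + 1) * (S + ∏ k ∈ Finset.range (n + 1), a k) * (1 + a 0)
        = (γ (n + 1) * (1 + a 0)) * (S + ∏ k ∈ Finset.range (n + 1), a k) := by ring
      _ = (∏ k ∈ Finset.range (n + 1), a k) * (S + (∏ k ∈ Finset.range (n + 1), a k) *
            (1 + a (n + 1))) + (∏ k ∈ Finset.range (n + 1), a k) * a (n + 1) * S := by
          rw [hγA]; ring
      _ = (a 0 * a 1) * ((∏ k ∈ Finset.range n, a k) * (1 + a n)) * S +
            (∏ k ∈ Finset.range (n + 1), a k) * ((∏ k ∈ Finset.range lo, a k) * (1 + a lo)) := by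
          rw [tele, Finset.prod_range_succ _ n, ← hP n]; ring
      _ = (a 0 * a 1) * (γ n * S) * (1 + a 0) +
            (∏ k ∈ Finset.range (n + 1), a k) * (γ lo * (1 + a 0)) := by
          rw [← hγA, ← hγA]; ring
      _ = _ := by
          rw [ih, ← hA' (n + 1)]; ring

/-- Pairs of consecutive terms form a geometric series of ratio `a 0 * a 1`. This is the case
without upper bound, and the dependence on `lo` is the same as in `sum_Icc_prod_range`. No
convergence is required in `ℝ≥0∞`. -/
theorem tsum_prod_range_of_le (hpos : ∀ k, 0 < a k) (hper : ∀ k, a (k + 2) = a k) (lo : ℕ) :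
    (∑' m : ℕ, if lo ≤ m then ((∏ k ∈ Finset.range m, a k : ℝ≥0) : ℝ≥0∞) else 0) =
      (1 + (a 0 : ℝ≥0∞)) * (1 - ((a 0 * a 1 : ℝ≥0) : ℝ≥0∞))⁻¹ *
        (∏ k ∈ Finset.range lo, a (k + 2) * (1 + a (k + 1)) / (1 + a (k + 2)) : ℝ≥0) := by
  have hP : ∀ n, a n * a (n + 1) = a 0 * a 1 := by
    intro n
    induction n with
    | zero => rfl
    | succ n ih => rw [hper, mul_comm, ih]
  have hA : ∀ j, ∏ k ∈ Finset.range (lo + 2 * j), a k =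
      (∏ k ∈ Finset.range lo, a k) * (a 0 * a 1) ^ j := by
    intro j
    induction j with
    | zero => simp
    | succ j ih =>
      rw [show lo + 2 * (j + 1) = lo + 2 * j + 1 + 1 by ring, Finset.prod_range_succ,
        Finset.prod_range_succ, ih, mul_assoc _ (a _) (a _), hP (lo + 2 * j), pow_succ]
      ring
  have hper' : ∀ j, a (lo + 2 * j) = a lo := by
    intro j
    induction j with
    | zero => simp
    | succ j ih => rw [show lo + 2 * (j + 1) = lo + 2 * j + 2 by ring, hper, ih]
  have inj : Function.Injective fun k : ℕ => lo + k := fun _ _ h => by simpa using h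
  rw [← inj.tsum_eq (f := fun m => if lo ≤ m then ((∏ k ∈ Finset.range m, a k : ℝ≥0) : ℝ≥0∞) else 0)
    (by
      intro m hm
      by_cases h : lo ≤ m
      · exact ⟨m - lo, by simp [h]⟩
      · simp [h] at hm)]
  rw [← tsum_even_add_odd ENNReal.summable ENNReal.summable, ← ENNReal.tsum_add]
  have : ∀ j, ((if lo ≤ lo + 2 * j then
        ((∏ k ∈ Finset.range (lo + 2 * j), a k : ℝ≥0) : ℝ≥0∞) else 0) +
      if lo ≤ lo + (2 * j + 1) then
        ((∏ k ∈ Finset.range (lo + (2 * j + 1)), a k : ℝ≥0) : ℝ≥0∞) else 0) =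
      ((1 + a 0 : ℝ≥0) : ℝ≥0∞) *
        (∏ k ∈ Finset.range lo, a (k + 2) * (1 + a (k + 1)) / (1 + a (k + 2)) : ℝ≥0) *
        ((a 0 * a 1 : ℝ≥0) : ℝ≥0∞) ^ j := by
    intro j
    rw [if_pos (by omega), if_pos (by omega), ← ENNReal.coe_add, ← ENNReal.coe_mul,
      ← ENNReal.coe_pow, ← ENNReal.coe_mul, mul_comm (1 + a 0), prod_range_alternating hpos hper,
      ← add_assoc, Finset.prod_range_succ, hA, hper']
    congr 1; ring
  simp_rw [this]
  rw [ENNReal.tsum_mul_left, ENNReal.tsum_geometric]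
  push_cast
  ring

end Interval

/-! ### Height functions -/

/-- The level of a position of the quarter plane. -/
def level (p : ℕ × ℕ) : ℕ := p.1 + p.2 + 1

/-- Height functions on the region of positions of level at least `n`: they decrease in both
directions within that region. -/
structure IsHeight (n : ℕ) (h : ℕ × ℕ →₀ ℕ) : Prop where
  zero : ∀ p, level p < n → h p = 0
  right : ∀ i j, n ≤ i + j + 1 → h (i + 1, j) ≤ h (i, j)
  up : ∀ i j, n ≤ i + j + 1 → h (i, j + 1) ≤ h (i, j)

/-- The weight of a column of height `m` over the position `p`: the box at height `k` has weight
`ω` at the projection along the main diagonal. -/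
def columnWeight (ω : ℕ → ℕ → ℝ≥0) (p : ℕ × ℕ) (m : ℕ) : ℝ≥0 :=
  ∏ k ∈ Finset.range m, ω (p.1 + k) (p.2 + k)

@[simp] theorem columnWeight_zero (ω : ℕ → ℕ → ℝ≥0) (p : ℕ × ℕ) : columnWeight ω p 0 = 1 := by
  simp [columnWeight]

open Classical in
/-- The weighted sum over all height functions. -/
def heightSum (n : ℕ) (ω : ℕ → ℕ → ℝ≥0) : ℝ≥0∞ :=
  ∑' h : ℕ × ℕ →₀ ℕ, if IsHeight n h then ((h.prod (columnWeight ω) : ℝ≥0) : ℝ≥0∞) else 0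

/-- The lower bound for the height at a position given by its neighbours. -/
def lowerBound (u : ℕ × ℕ → ℕ) (v : ℕ × ℕ) : ℕ := max (u (v.1 + 1, v.2)) (u (v.1, v.2 + 1))

/-- The upper bound for the height at a position given by its neighbours. -/
def upperBound (u : ℕ × ℕ → ℕ) : ℕ × ℕ → ℕ
  | (0, 0) => 0
  | (i + 1, 0) => u (i, 0)
  | (0, j + 1) => u (0, j)
  | (i + 1, j + 1) => min (u (i, j + 1)) (u (i + 1, j))

/-- The range of the height at a position, given its neighbours. -/
def LocalRange (n : ℕ) (u : ℕ × ℕ → ℕ) (v : ℕ × ℕ) (m : ℕ) : Prop :=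
  if level v < n then m = 0 else lowerBound u v ≤ m ∧ (n < level v → m ≤ upperBound u v)

/-- The conditions on the heights outside of the set `M`. -/
structure OutsideHeight (M : ℕ × ℕ → Prop) (n : ℕ) (u : ℕ × ℕ → ℕ) : Prop where
  zero : ∀ p, ¬ M p → level p < n → u p = 0
  right : ∀ i j, n ≤ i + j + 1 → ¬ M (i, j) → ¬ M (i + 1, j) → u (i + 1, j) ≤ u (i, j)
  up : ∀ i j, n ≤ i + j + 1 → ¬ M (i, j) → ¬ M (i, j + 1) → u (i, j + 1) ≤ u (i, j)

/-- Positions of `M` have levels of one parity, so no two are adjacent and each monotonicity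
condition involves at most one of them. The hypothesis `h0` keeps the origin out of `M` when `n =
0`: there the default value `0` of `upperBound` would be a false constraint. -/
theorem isHeight_iff {M : ℕ × ℕ → Prop} {n : ℕ} (s : ℕ)
    (hpar : ∀ p, M p → level p % 2 = s % 2) (h0 : n = 0 → s % 2 = 0) (h : ℕ × ℕ →₀ ℕ) :
    IsHeight n h ↔ OutsideHeight M n h ∧ ∀ v, M v → LocalRange n h v (h v) := by
  constructor
  · intro hh
    refine ⟨⟨fun p _ => hh.zero p, fun i j hij _ _ => hh.right i j hij,
      fun i j hij _ _ => hh.up i j hij⟩, ?_⟩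
    rintro ⟨i, j⟩ hv
    unfold LocalRange
    split_ifs with hl
    · exact hh.zero _ hl
    · have hl' : n ≤ i + j + 1 := by simpa [level] using hl
      refine ⟨max_le (hh.right i j hl') (hh.up i j hl'), fun hlt => ?_⟩
      simp only [level] at hlt
      rcases i with _ | i <;> rcases j with _ | j
      · have := hpar _ hv
        simp [level] at this
        have := h0 (by omega)
        omega
      · exact hh.up 0 j (by omega)
      · exact hh.right i 0 (by omega)
      · exact le_min (hh.right i (j + 1) (by omega)) (hh.up (i + 1) j (by omega))
  · rintro ⟨hC, hI⟩
    have par : ∀ i j, M (i, j) → (i + j + 1) % 2 = s % 2 := fun i j h => hpar _ h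
    refine ⟨fun p hp => ?_, fun i j hij => ?_, fun i j hij => ?_⟩
    · by_cases hM : M p
      · have := hI p hM
        rwa [LocalRange, if_pos hp] at this
      · exact hC.zero p hM hp
    · by_cases h1 : M (i, j)
      · have := hI _ h1
        rw [LocalRange, if_neg (by simp [level]; omega)] at this
        exact (le_max_left _ _).trans this.1
      · by_cases h2 : M (i + 1, j)
        · have := hI _ h2
          rw [LocalRange, if_neg (by simp [level]; omega)] at this
          have := this.2 (by simp [level]; omega)
          rcases j with _ | j
          · exact this
          · exact this.trans (min_le_left _ _)
        · exact hC.right i j hij h1 h2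
    · by_cases h1 : M (i, j)
      · have := hI _ h1
        rw [LocalRange, if_neg (by simp [level]; omega)] at this
        exact (le_max_right _ _).trans this.1
      · by_cases h2 : M (i, j + 1)
        · have := hI _ h2
          rw [LocalRange, if_neg (by simp [level]; omega)] at this
          have := this.2 (by simp [level]; omega)
          rcases i with _ | i
          · exact this
          · exact this.trans (min_le_right _ _)
        · exact hC.up i j hij h1 h2

end

/-! ### Conditioning on the heights outside of `M` -/

section

section Fiber

variable {M : ℕ × ℕ → Prop} {s : ℕ} (hpar : ∀ p, M p → level p % 2 = s % 2)
include hpar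

/-- The bounds at a position of `M` read only adjacent positions, whose levels have the other
parity. -/
theorem localRange_congr {n : ℕ} {h u : ℕ × ℕ → ℕ} (hu : ∀ p, ¬ M p → h p = u p) {v : ℕ × ℕ}
    (hv : M v) (m : ℕ) : LocalRange n h v m ↔ LocalRange n u v m := by
  have key : ∀ p, (level p + level v) % 2 = 1 → h p = u p := fun p hp => hu p fun hM => by
    have := hpar p hM; have := hpar v hv; omega
  obtain ⟨i, j⟩ := v
  have h1 : h (i + 1, j) = u (i + 1, j) := key _ (by simp [level]; omega)
  have h2 : h (i, j + 1) = u (i, j + 1) := key _ (by simp [level]; omega)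
  have hl : lowerBound h (i, j) = lowerBound u (i, j) := by simp [lowerBound, h1, h2]
  have hup : upperBound h (i, j) = upperBound u (i, j) := by
    rcases i with _ | i <;> rcases j with _ | j
    · rfl
    · exact key (0, j) (by simp [level]; omega)
    · exact key (i, 0) (by simp [level]; omega)
    · simp only [upperBound]
      rw [key (i, j + 1) (by simp [level]; omega), key (i + 1, j) (by simp [level]; omega)]
  simp only [LocalRange, hl, hup]

omit hpar in
theorem outsideHeight_congr {n : ℕ} {h u : ℕ × ℕ → ℕ} (hu : ∀ p, ¬ M p → h p = u p) :
    OutsideHeight M n h ↔ OutsideHeight M n u := by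
  have key : ∀ {h u : ℕ × ℕ → ℕ}, (∀ p, ¬ M p → h p = u p) →
      OutsideHeight M n h → OutsideHeight M n u := by
    intro h u hu H
    refine ⟨fun p hp hl => ?_, fun i j hij h1 h2 => ?_, fun i j hij h1 h2 => ?_⟩
    · rw [← hu p hp, H.zero p hp hl]
    · rw [← hu _ h1, ← hu _ h2]; exact H.right i j hij h1 h2
    · rw [← hu _ h1, ← hu _ h2]; exact H.up i j hij h1 h2
  exact ⟨key hu, key fun p hp => (hu p hp).symm⟩

open Classical in
-- Given the heights `u` off `M`, those on `M` range independently over their local ranges.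
-- Positions of `M` outside the square of side `N + 1` have level above `n`, thanks to `hn`, and
-- upper bound zero, so only finitely many local sums are nontrivial.
theorem tsum_filter_eq (n : ℕ) (h0 : n = 0 → s % 2 = 0) (ω : ℕ → ℕ → ℝ≥0) (u : ℕ × ℕ →₀ ℕ)
    (hu : ∀ p, M p → u p = 0) (N : ℕ) (hN : ∀ p : ℕ × ℕ, N ≤ p.1 ∨ N ≤ p.2 → u p = 0)
    (hn : n ≤ N + 1) :
    (∑' h : ℕ × ℕ →₀ ℕ, if h.filter (fun p => ¬ M p) = u then
      (if IsHeight n h then ((h.prod (columnWeight ω) : ℝ≥0) : ℝ≥0∞) else 0) else 0) =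
    if OutsideHeight M n u then
      ((u.prod (columnWeight ω) : ℝ≥0) : ℝ≥0∞) *
        ∏ v ∈ (Finset.range (N + 1) ×ˢ Finset.range (N + 1)).filter M,
          ∑' m : ℕ, if LocalRange n u v m then ((columnWeight ω v m : ℝ≥0) : ℝ≥0∞) else 0
    else 0 := by
  set B := Finset.range (N + 1) ×ˢ Finset.range (N + 1) with hB
  set V := B.filter M with hV
  have hsupp : ∀ g : V → ℕ, ∀ p, (if hp : p ∈ V then g ⟨p, hp⟩ else u p) ≠ 0 → p ∈ B := by
    intro g p hp
    by_contra hpB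
    rw [dif_neg fun hpV => hpB (Finset.mem_filter.mp hpV).1] at hp
    apply hp
    apply hN
    simp only [hB, Finset.mem_product, Finset.mem_range, not_and_or] at hpB
    omega
  -- The fibre over `u` is parametrised by the heights on the finite set `V`, extended by `u`.
  let Φ : (V → ℕ) → (ℕ × ℕ →₀ ℕ) := fun g =>
    Finsupp.onFinset B (fun p => if hp : p ∈ V then g ⟨p, hp⟩ else u p) (hsupp g)
  have hΦV : ∀ g (v : V), Φ g v = g v := by
    intro g v
    simp only [Φ, Finsupp.onFinset_apply, Subtype.coe_eta, dif_pos v.2]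
  have hΦu : ∀ g p, ¬ M p → Φ g p = u p := by
    intro g p hp
    simp only [Φ, Finsupp.onFinset_apply]
    rw [dif_neg fun h => hp (Finset.mem_filter.mp h).2]
  have hΦ0 : ∀ g p, M p → p ∉ V → Φ g p = 0 := by
    intro g p hp hpV
    simp only [Φ, Finsupp.onFinset_apply]
    rw [dif_neg hpV, hu p hp]
  have hΦinj : Function.Injective Φ := by
    intro g g' h
    ext v
    rw [← hΦV g v, h, hΦV g' v]
  have hΦfilter : ∀ g, (Φ g).filter (fun p => ¬ M p) = u := by
    intro g
    ext p
    by_cases hp : M p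
    · rw [Finsupp.filter_apply, if_neg (not_not.mpr hp), hu p hp]
    · rw [Finsupp.filter_apply, if_pos hp, hΦu g p hp]
  rw [← hΦinj.tsum_eq]
  · have hvalid : ∀ g, IsHeight n (Φ g) ↔
        OutsideHeight M n u ∧ ∀ v : V, LocalRange n u v (g v) := by
      intro g
      rw [isHeight_iff s hpar h0, outsideHeight_congr (hΦu g)]
      refine and_congr_right fun _ => ⟨fun H v => ?_, fun H v hv => ?_⟩
      · rw [← localRange_congr hpar (hΦu g) (Finset.mem_filter.mp v.2).2, ← hΦV g v]
        exact H v (Finset.mem_filter.mp v.2).2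
      · rw [localRange_congr hpar (hΦu g) hv]
        by_cases hvV : v ∈ V
        · have := H ⟨v, hvV⟩
          rwa [← hΦV g ⟨v, hvV⟩] at this
        · rw [hΦ0 g v hv hvV]
          have hvB : v ∉ B := fun h => hvV (Finset.mem_filter.mpr ⟨h, hv⟩)
          simp only [hB, Finset.mem_product, Finset.mem_range, not_and_or, not_lt] at hvB
          unfold LocalRange lowerBound
          rw [hN (v.1 + 1, v.2) (by simp; omega), hN (v.1, v.2 + 1) (by simp; omega)]
          simp
    have hprod : ∀ g, (Φ g).prod (columnWeight ω) =
        u.prod (columnWeight ω) * ∏ v : V, columnWeight ω v (g v) := by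
      intro g
      have h1 : u.support ⊆ B := fun p hp => by
        by_contra hpB
        simp only [hB, Finset.mem_product, Finset.mem_range, not_and_or, not_lt] at hpB
        exact Finsupp.mem_support_iff.mp hp (hN p (by omega))
      rw [Finsupp.prod_of_support_subset _ Finsupp.support_onFinset_subset _ (by simp),
        Finsupp.prod_of_support_subset _ h1 _ (by simp),
        ← Finset.prod_filter_mul_prod_filter_not B M,
        ← Finset.prod_filter_mul_prod_filter_not B M (fun x => columnWeight ω x (u x)),
        Finset.prod_eq_one (s := B.filter M) (f := fun x => columnWeight ω x (u x)), one_mul,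
        mul_comm]
      · congr 1
        · refine Finset.prod_congr rfl fun p hp => ?_
          rw [← hΦu g p (Finset.mem_filter.mp hp).2]
        · rw [← Finset.prod_coe_sort]
          refine Finset.prod_congr rfl fun v _ => ?_
          rw [← hΦV g v]
      · intro p hp
        rw [hu p (Finset.mem_filter.mp hp).2, columnWeight_zero]
    simp_rw [hΦfilter, if_true, hvalid, hprod]
    by_cases hC : OutsideHeight M n u
    · simp only [hC, true_and, if_true]
      rw [← Finset.prod_coe_sort V, ← ENNReal.tsum_pi_prod, ← ENNReal.tsum_mul_left]
      refine tsum_congr fun g => ?_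
      by_cases hg : ∀ v : V, LocalRange n u v (g v)
      · rw [if_pos hg, Finset.prod_congr rfl fun v _ => if_pos (hg v)]
        push_cast
        rfl
      · rw [if_neg hg]
        push Not at hg
        obtain ⟨v, hv⟩ := hg
        rw [Finset.prod_eq_zero (Finset.mem_univ v) (if_neg hv), mul_zero]
    · simp [hC]
  · intro h hh
    simp only [Function.mem_support, ne_eq, ite_eq_right_iff, Classical.not_imp] at hh
    obtain ⟨hf, hv, -⟩ := hh
    have hhu : ∀ p, ¬ M p → h p = u p := fun p hp => by
      rw [← hf, Finsupp.filter_apply, if_pos hp]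
    let g₀ : V → ℕ := fun v => h v
    refine ⟨g₀, ?_⟩
    ext p
    by_cases hp : M p
    · by_cases hpV : p ∈ V
      · exact hΦV g₀ ⟨p, hpV⟩
      · rw [hΦ0 g₀ _ hp hpV]
        have hpB : p ∉ B := fun h => hpV (Finset.mem_filter.mpr ⟨h, hp⟩)
        simp only [hB, Finset.mem_product, Finset.mem_range, not_and_or, not_lt] at hpB
        have hI := ((isHeight_iff s hpar h0 h).mp hv).2 p hp
        have h1 : lowerBound h p = 0 → upperBound h p = 0 → h p = 0 := by
          intro _ h2
          unfold LocalRange at hI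
          split_ifs at hI with hl
          · exact hI
          · have := hI.2 (by simp only [level]; omega)
            omega
        rw [localRange_congr hpar hhu hp] at hI
        obtain ⟨i, j⟩ := p
        have hl : ¬ level (i, j) < n := by simp only [level]; simp only at hpB; omega
        have hl' : n < level (i, j) := by simp only [level]; simp only at hpB; omega
        rw [LocalRange, if_neg hl] at hI
        have := hI.2 hl'
        -- A position outside the square has a coordinate at least `N + 1`, so a neighbour bounding
        -- it from above still has a coordinate at least `N`, where `u` vanishes.
        have hz : upperBound u (i, j) = 0 := by
          rcases i with _ | i <;> rcases j with _ | j
          · rfl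
          · exact hN (0, j) (by simp only at hpB ⊢; omega)
          · exact hN (i, 0) (by simp only at hpB ⊢; omega)
          · simp only at hpB
            rcases hpB with hpB | hpB
            · simp [upperBound, hN (i, j + 1) (by simp only; omega)]
            · simp [upperBound, hN (i + 1, j) (by simp only; omega)]
        omega
    · rw [hΦu g₀ _ hp, hhu p hp]

end Fiber

end

/-! ### The flip: summing out a set of positions of one parity -/

section

/-- The factor by which the weights of the neighbours of a position change when the heights at that
position are summed out. -/
def flipWeight (ω : ℕ → ℕ → ℝ≥0) (i j : ℕ) : ℝ≥0 :=
  ω (i + 1) (j + 1) * (1 + ω i j) / (1 + ω (i + 1) (j + 1))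

open Classical in
/-- The weights after a flip at all positions in `M`. -/
def flipWeights (M : ℕ × ℕ → Prop) (ω : ℕ → ℕ → ℝ≥0) (i j : ℕ) : ℝ≥0 :=
  if M (i, j) then (ω (i + 1) (j + 1))⁻¹ else
    ω i j * (if M (i + 1, j) then flipWeight ω (i + 1) j else 1) *
      (if M (i, j + 1) then flipWeight ω i (j + 1) else 1)

/-- The contribution of a corner position whose height is unbounded. -/
def cornerFactor (ω : ℕ → ℕ → ℝ≥0) (i j : ℕ) : ℝ≥0∞ :=
  (1 + (ω i j : ℝ≥0∞)) * (1 - ((ω i j * ω (i + 1) (j + 1) : ℝ≥0) : ℝ≥0∞))⁻¹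

/-- Pair `f` at each position with `g` one diagonal step further. The unpaired values of `g` lie on
the two axes and at the origin. Here `f` will carry the factors from lower bounds, `g` those from
upper bounds, and `e₁`, `e₂` the shares of the two neighbours. -/
theorem prod_range_prod_range_eq {R : Type*} [CommMonoid R] (f g e₁ e₂ : ℕ × ℕ → R) (N : ℕ)
    (h : ∀ i j, f (i, j) * g (i + 1, j + 1) = e₁ (i, j + 1) * e₂ (i + 1, j))
    (h₁ : ∀ i, g (i + 1, 0) = e₁ (i, 0)) (h₂ : ∀ j, g (0, j + 1) = e₂ (0, j)) (h₀ : g (0, 0) = 1)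
    (hf : ∀ i j, N ≤ i ∨ N ≤ j → f (i, j) = 1) (he₁ : ∀ i j, N ≤ i ∨ N ≤ j → e₁ (i, j) = 1)
    (he₂ : ∀ i j, N ≤ i ∨ N ≤ j → e₂ (i, j) = 1) :
    ∏ p ∈ Finset.range (N + 1) ×ˢ Finset.range (N + 1), f p * g p =
      ∏ p ∈ Finset.range (N + 1) ×ˢ Finset.range (N + 1), e₁ p * e₂ p := by
  have hF : ∏ p ∈ Finset.range (N + 1) ×ˢ Finset.range (N + 1), f p =
      ∏ i ∈ Finset.range N, ∏ j ∈ Finset.range N, f (i, j) := by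
    rw [Finset.prod_product, Finset.prod_range_succ,
      Finset.prod_eq_one (fun j _ => hf N j (Or.inl le_rfl)), mul_one]
    refine Finset.prod_congr rfl fun i _ => ?_
    rw [Finset.prod_range_succ, hf i N (Or.inr le_rfl), mul_one]
  have hG : ∏ p ∈ Finset.range (N + 1) ×ˢ Finset.range (N + 1), g p =
      (∏ i ∈ Finset.range N, ∏ j ∈ Finset.range N, g (i + 1, j + 1)) *
        (∏ i ∈ Finset.range N, e₁ (i, 0)) * ∏ j ∈ Finset.range N, e₂ (0, j) := by
    have hrow : ∀ i, ∏ j ∈ Finset.range (N + 1), g (i + 1, j) =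
        (∏ j ∈ Finset.range N, g (i + 1, j + 1)) * e₁ (i, 0) := fun i => by
      rw [Finset.prod_range_succ', h₁]
    rw [Finset.prod_product, Finset.prod_range_succ', Finset.prod_congr rfl fun i _ => hrow i,
      Finset.prod_range_succ', h₀, mul_one, Finset.prod_mul_distrib,
      Finset.prod_congr rfl fun j _ => h₂ j]
  have hE₁ : ∏ p ∈ Finset.range (N + 1) ×ˢ Finset.range (N + 1), e₁ p =
      (∏ i ∈ Finset.range N, ∏ j ∈ Finset.range N, e₁ (i, j + 1)) *
        ∏ i ∈ Finset.range N, e₁ (i, 0) := by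
    rw [Finset.prod_product, Finset.prod_range_succ,
      Finset.prod_eq_one (fun j _ => he₁ N j (Or.inl le_rfl)), mul_one, ← Finset.prod_mul_distrib]
    refine Finset.prod_congr rfl fun i _ => ?_
    rw [Finset.prod_range_succ']
  have hE₂ : ∏ p ∈ Finset.range (N + 1) ×ˢ Finset.range (N + 1), e₂ p =
      (∏ i ∈ Finset.range N, ∏ j ∈ Finset.range N, e₂ (i + 1, j)) *
        ∏ j ∈ Finset.range N, e₂ (0, j) := by
    have : ∀ i, ∏ j ∈ Finset.range (N + 1), e₂ (i, j) = ∏ j ∈ Finset.range N, e₂ (i, j) := by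
      intro i
      rw [Finset.prod_range_succ, he₂ i N (Or.inr le_rfl), mul_one]
    rw [Finset.prod_product]
    simp_rw [this]
    rw [Finset.prod_range_succ']
  have hmid : (∏ i ∈ Finset.range N, ∏ j ∈ Finset.range N, f (i, j)) *
      (∏ i ∈ Finset.range N, ∏ j ∈ Finset.range N, g (i + 1, j + 1)) =
      (∏ i ∈ Finset.range N, ∏ j ∈ Finset.range N, e₁ (i, j + 1)) *
      ∏ i ∈ Finset.range N, ∏ j ∈ Finset.range N, e₂ (i + 1, j) := by
    simp_rw [← Finset.prod_mul_distrib, h]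
  rw [Finset.prod_mul_distrib, Finset.prod_mul_distrib, hF, hG, hE₁, hE₂, ← mul_assoc, ← mul_assoc,
    hmid]
  simp only [mul_assoc, mul_left_comm]

section Step

variable {M : ℕ × ℕ → Prop} {ω : ℕ → ℕ → ℝ≥0} {n : ℕ}

variable (hpos : ∀ i j, 0 < ω i j) (hper : ∀ i j, ω (i + 2) (j + 2) = ω i j)
  (hdiag : ∀ i j, M (i + 1, j + 1) ↔ M (i, j)) (hpar : ∀ p, M p → level p % 2 = n % 2)

include hdiag in
theorem mem_add_iff (i j k : ℕ) : M (i + k, j + k) ↔ M (i, j) := by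
  induction k with
  | zero => rfl
  | succ k ih => rw [← ih]; exact hdiag _ _

include hdiag in
open Classical in
theorem columnWeight_flip_of_not_mem {i j : ℕ} (h : ¬ M (i, j)) (m : ℕ) :
    columnWeight (flipWeights M ω) (i, j) m = columnWeight ω (i, j) m *
      (if M (i + 1, j) then columnWeight (flipWeight ω) (i + 1, j) m else 1) *
      (if M (i, j + 1) then columnWeight (flipWeight ω) (i, j + 1) m else 1) := by
  have h1 : ∀ k, M (i + k + 1, j + k) ↔ M (i + 1, j) := fun k => by
    rw [add_right_comm]; exact mem_add_iff hdiag _ _ _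
  have h2 : ∀ k, M (i + k, j + k + 1) ↔ M (i, j + 1) := fun k => by
    rw [add_right_comm j]; exact mem_add_iff hdiag _ _ _
  simp only [columnWeight, flipWeights, mem_add_iff hdiag i j, if_neg h, h1, h2,
    Finset.prod_mul_distrib]
  congr 1
  · congr 1
    split_ifs
    · exact Finset.prod_congr rfl fun k _ => by rw [add_right_comm]
    · simp
  · split_ifs
    · exact Finset.prod_congr rfl fun k _ => by rw [add_right_comm j]
    · simp

include hdiag in
theorem columnWeight_flip_of_mem {v : ℕ × ℕ} (h : M v) (m : ℕ) :
    columnWeight (flipWeights M ω) v m =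
      ∏ k ∈ Finset.range m, (ω (v.1 + (k + 1)) (v.2 + (k + 1)))⁻¹ := by
  refine Finset.prod_congr rfl fun k _ => ?_
  rw [flipWeights, if_pos ((mem_add_iff hdiag v.1 v.2 k).mpr h)]
  rfl

theorem columnWeight_flipWeight (v : ℕ × ℕ) (m : ℕ) :
    columnWeight (flipWeight ω) (v.1 + 1, v.2 + 1) m =
      ∏ k ∈ Finset.range m, ω (v.1 + (k + 2)) (v.2 + (k + 2)) *
        (1 + ω (v.1 + (k + 1)) (v.2 + (k + 1))) / (1 + ω (v.1 + (k + 2)) (v.2 + (k + 2))) := by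
  refine Finset.prod_congr rfl fun k _ => ?_
  simp only [flipWeight]
  rw [show v.1 + 1 + k = v.1 + (k + 1) by ring, show v.2 + 1 + k = v.2 + (k + 1) by ring]
  rfl

include hpos hper hdiag hpar in
open Classical in
-- Below level `n` the height is forced to be zero on both sides. At level `n` the height is
-- unbounded before the flip and forced to zero after it, which leaves the corner factor. Above
-- level `n` this is `sum_Icc_prod_range` along the diagonal through `v`.
theorem tsum_localRange (u : ℕ × ℕ → ℕ) {v : ℕ × ℕ} (hv : M v) :
    (∑' m : ℕ, if LocalRange n u v m then ((columnWeight ω v m : ℝ≥0) : ℝ≥0∞) else 0) =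
      (if level v = n then cornerFactor ω v.1 v.2 else 1) *
      ((if level v < n then 1 else columnWeight (flipWeight ω) (v.1 + 1, v.2 + 1) (lowerBound u v)) *
      (if n < level v then columnWeight (flipWeight ω) v (upperBound u v) else 1) : ℝ≥0) *
      ∑' m : ℕ, if LocalRange (n + 1) u v m then
        ((columnWeight (flipWeights M ω) v m : ℝ≥0) : ℝ≥0∞) else 0 := by
  have hp := hpar v hv
  rcases lt_trichotomy (level v) n with h | h | h
  · simp [LocalRange, h, h.ne, h.not_gt, h.trans (Nat.lt_succ_self n)]
  · simp only [LocalRange, h, lt_irrefl, if_false, Nat.lt_succ_self, if_true, IsEmpty.forall_iff,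
      and_true]
    rw [tsum_ite_eq]
    have := tsum_prod_range_of_le (a := fun k => ω (v.1 + k) (v.2 + k)) (fun _ => hpos _ _)
      (fun _ => hper _ _) (lowerBound u v)
    simp only [columnWeight_flipWeight]
    simp only [columnWeight, cornerFactor] at this ⊢
    rw [this]
    simp
  · have h2 : ¬ level v < n + 1 := by omega
    -- The parity of the levels in `M` excludes `n + 1`, so an upper bound is still in force after
    -- the flip.
    have h3 : n + 1 < level v := by omega
    simp only [LocalRange, h.not_gt, if_false, h.ne', h2, h, h3, forall_true_left, if_true, one_mul]
    have e : ∀ f : ℕ → ℝ≥0, (∑' m : ℕ, if lowerBound u v ≤ m ∧ m ≤ upperBound u v then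
        (f m : ℝ≥0∞) else 0) =
        ((∑ m ∈ Finset.Icc (lowerBound u v) (upperBound u v), f m : ℝ≥0) : ℝ≥0∞) := by
      intro f
      rw [tsum_eq_sum (s := Finset.Icc (lowerBound u v) (upperBound u v))
        (fun m hm => if_neg (by simpa using hm)), ENNReal.ofNNReal_finsetSum]
      exact Finset.sum_congr rfl fun m hm => if_pos (by simpa using hm)
    rw [e, e, ← ENNReal.coe_mul, columnWeight_flipWeight]
    simp only [columnWeight_flip_of_mem hdiag hv]
    have := sum_Icc_prod_range (a := fun k => ω (v.1 + k) (v.2 + k)) (fun _ => hpos _ _)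
      (fun _ => hper _ _) (lowerBound u v) (upperBound u v)
    rw [mul_comm (∏ k ∈ Finset.range (lowerBound u v), _)]
    exact congrArg _ this

include hdiag hpar in
open Classical in
-- The lower bound at `(i, j)` and the upper bound at `(i + 1, j + 1)` are the max and min of the
-- same two heights `x`, `y`, and both enter the same function `F`; hence `F (max x y) * F (min x y)
-- = F x * F y`, one factor for each neighbour. At the lower edge of the region a bound is absent,
-- but there the neighbouring heights vanish and the factors are `1`.
theorem prod_columnWeight_flip (u : ℕ × ℕ →₀ ℕ) (hu : ∀ p, M p → u p = 0)
    (hout : OutsideHeight M n u) (N : ℕ) (hN : ∀ p : ℕ × ℕ, N ≤ p.1 ∨ N ≤ p.2 → u p = 0) :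
    u.prod (columnWeight ω) * ∏ v ∈ (Finset.range (N + 1) ×ˢ Finset.range (N + 1)).filter M,
      ((if level v < n then 1 else columnWeight (flipWeight ω) (v.1 + 1, v.2 + 1) (lowerBound u v)) *
      (if n < level v then columnWeight (flipWeight ω) v (upperBound u v) else 1)) =
    u.prod (columnWeight (flipWeights M ω)) := by
  set B := Finset.range (N + 1) ×ˢ Finset.range (N + 1) with hB
  have hsupp : u.support ⊆ B := fun p hp => by
    by_contra hpB
    simp only [hB, Finset.mem_product, Finset.mem_range, not_and_or, not_lt] at hpB
    exact Finsupp.mem_support_iff.mp hp (hN p (by omega))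
  rw [Finsupp.prod_of_support_subset _ hsupp _ (by simp),
    Finsupp.prod_of_support_subset _ hsupp _ (by simp)]
  set e₁ : ℕ × ℕ → ℝ≥0 := fun p =>
    if M (p.1 + 1, p.2) then columnWeight (flipWeight ω) (p.1 + 1, p.2) (u p) else 1 with he₁
  set e₂ : ℕ × ℕ → ℝ≥0 := fun p =>
    if M (p.1, p.2 + 1) then columnWeight (flipWeight ω) (p.1, p.2 + 1) (u p) else 1 with he₂
  have hcw : ∀ p ∈ B, columnWeight (flipWeights M ω) p (u p) = columnWeight ω p (u p) * (e₁ p * e₂ p) := by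
    rintro ⟨i, j⟩ -
    by_cases hp : M (i, j)
    · simp [he₁, he₂, hu _ hp]
    · rw [columnWeight_flip_of_not_mem hdiag hp, mul_assoc]
  rw [Finset.prod_congr rfl hcw, Finset.prod_mul_distrib (s := B)
    (f := fun p => columnWeight ω p (u p)) (g := fun p => e₁ p * e₂ p)]
  congr 1
  set f : ℕ × ℕ → ℝ≥0 := fun v => if M v then if level v < n then 1 else
    columnWeight (flipWeight ω) (v.1 + 1, v.2 + 1) (lowerBound u v) else 1 with hf
  set g : ℕ × ℕ → ℝ≥0 := fun v => if M v then if n < level v then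
    columnWeight (flipWeight ω) v (upperBound u v) else 1 else 1 with hg
  have hadj : ∀ p q : ℕ × ℕ, M q → level p < n → level q = level p + 1 → u p = 0 := by
    intro p q hq hl hpq
    refine hout.zero p (fun hM => ?_) hl
    have := hpar p hM; have := hpar q hq; omega
  rw [← prod_range_prod_range_eq f g e₁ e₂ N, Finset.prod_filter]
  · refine Finset.prod_congr rfl fun v _ => ?_
    by_cases hM : M v <;> simp [hf, hg, hM]
  · intro i j
    simp only [hf, hg, he₁, he₂, hdiag i j]
    by_cases hM : M (i, j)
    · have hM' := (hdiag i j).mpr hM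
      have hp := hpar _ hM
      simp only [hM, if_true]
      by_cases hl : level (i, j) < n
      · have hl' : ¬ n < level (i + 1, j + 1) := by simp only [level] at hl hp ⊢; omega
        rw [if_pos hl, if_neg hl',
          hadj (i, j + 1) _ hM' (by simp only [level] at hl hp ⊢; omega) (by simp only [level]; omega),
          hadj (i + 1, j) _ hM' (by simp only [level] at hl hp ⊢; omega) (by simp only [level]; omega)]
        simp
      · have hl' : n < level (i + 1, j + 1) := by simp only [level] at hl ⊢; omega
        rw [if_neg hl, if_pos hl']
        simp only [lowerBound, upperBound]
        rcases le_total (u (i + 1, j)) (u (i, j + 1)) with hle | hle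
        · rw [max_eq_right hle, min_eq_right hle]
        · rw [max_eq_left hle, min_eq_left hle, mul_comm]
    · simp [hM]
  · intro i
    simp only [hg, he₁]
    by_cases hM : M (i + 1, 0)
    · rw [if_pos hM, if_pos hM]
      split_ifs with hl
      · rfl
      · rw [hadj (i, 0) _ hM (by simp only [level] at hl ⊢; omega) (by simp only [level])]
        simp
    · simp [hM]
  · intro j
    simp only [hg, he₂]
    by_cases hM : M (0, j + 1)
    · rw [if_pos hM, if_pos hM]
      split_ifs with hl
      · rfl
      · rw [hadj (0, j) _ hM (by simp only [level] at hl ⊢; omega) (by simp only [level]; omega)]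
        simp
    · simp [hM]
  · simp [hg, upperBound]
  · intro i j hij
    have : lowerBound u (i, j) = 0 := by
      simp only [lowerBound]
      rw [hN _ (by simp only; omega), hN _ (by simp only; omega)]
      rfl
    simp [hf, this]
  · intro i j hij
    simp [he₁, hN (i, j) hij]
  · intro i j hij
    simp [he₂, hN (i, j) hij]

include hpos hper hdiag hpar in
/-- Summing out the heights at the positions in `M`. -/
theorem heightSum_flip (hM : ∀ p, level p = n → M p) :
    heightSum n ω = (∏ i ∈ Finset.range n, cornerFactor ω i (n - 1 - i)) *
      heightSum (n + 1) (flipWeights M ω) := by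
  classical
  -- Both sides are compared fibrewise over the restriction of `h` to the complement of `M`.
  have hfib : ∀ f : (ℕ × ℕ →₀ ℕ) → ℝ≥0∞, ∑' h, f h =
      ∑' u, ∑' h : ℕ × ℕ →₀ ℕ, if h.filter (fun p => ¬ M p) = u then f h else 0 := by
    intro f
    rw [ENNReal.tsum_comm]
    refine tsum_congr fun h => ?_
    rw [tsum_eq_single (h.filter fun p => ¬ M p) (fun u hu => if_neg hu.symm), if_pos rfl]
  rw [heightSum, heightSum,
    hfib fun h => if IsHeight n h then ((h.prod (columnWeight ω) : ℝ≥0) : ℝ≥0∞) else 0,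
    hfib fun h => if IsHeight (n + 1) h then
      ((h.prod (columnWeight (flipWeights M ω)) : ℝ≥0) : ℝ≥0∞) else 0, ← ENNReal.tsum_mul_left]
  refine tsum_congr fun u => ?_
  by_cases hu : ∀ p, M p → u p = 0
  swap
  · have : ∀ h : ℕ × ℕ →₀ ℕ, h.filter (fun p => ¬ M p) ≠ u := by
      rintro h rfl
      exact hu fun p hp => by rw [Finsupp.filter_apply, if_neg (not_not.mpr hp)]
    simp [this]
  obtain ⟨N, hnN, hN⟩ : ∃ N, n ≤ N ∧ ∀ p : ℕ × ℕ, N ≤ p.1 ∨ N ≤ p.2 → u p = 0 := by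
    refine ⟨n + ∑ p ∈ u.support, (p.1 + p.2 + 1), Nat.le_add_right _ _, fun p hp => ?_⟩
    by_contra h
    have := Finset.single_le_sum (f := fun p : ℕ × ℕ => p.1 + p.2 + 1) (fun _ _ => Nat.zero_le _)
      (Finsupp.mem_support_iff.mpr h)
    omega
  rw [tsum_filter_eq hpar n (fun h => by simp [h]) ω u hu N hN (by omega),
    tsum_filter_eq hpar (n + 1) (fun h => by omega) _ u hu N hN (by omega)]
  -- All positions of level `n` lie in `M`, so raising the threshold imposes nothing new off `M`.
  have hout : OutsideHeight M (n + 1) u ↔ OutsideHeight M n u := by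
    have hlt : ∀ i j, ¬ M (i, j) → n ≤ i + j + 1 → n + 1 ≤ i + j + 1 := fun i j h1 h2 => by
      have : level (i, j) ≠ n := fun h => h1 (hM _ h)
      simp only [level] at this
      omega
    refine ⟨fun H => ⟨fun p hp hl => H.zero p hp (by omega), fun i j hij h1 h2 =>
      H.right i j (hlt i j h1 hij) h1 h2, fun i j hij h1 h2 => H.up i j (hlt i j h1 hij) h1 h2⟩,
      fun H => ⟨fun p hp hl => H.zero p hp ?_, fun i j hij h1 h2 => H.right i j (by omega) h1 h2,
        fun i j hij h1 h2 => H.up i j (by omega) h1 h2⟩⟩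
    have : level p ≠ n := fun h => hp (hM _ h)
    omega
  rw [hout]
  by_cases hC : OutsideHeight M n u
  swap
  · simp [hC]
  rw [if_pos hC, if_pos hC, ← prod_columnWeight_flip hdiag hpar u hu hC N hN]
  set B := Finset.range (N + 1) ×ˢ Finset.range (N + 1) with hB
  have hcorner : ∏ i ∈ Finset.range n, cornerFactor ω i (n - 1 - i) =
      ∏ v ∈ B.filter M, if level v = n then cornerFactor ω v.1 v.2 else 1 := by
    rw [← Finset.prod_filter]
    refine Finset.prod_nbij' (fun i => (i, n - 1 - i)) Prod.fst ?_ ?_ ?_ ?_ ?_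
    · intro i hi
      have hi := Finset.mem_range.mp hi
      have hl : level (i, n - 1 - i) = n := by simp only [level]; omega
      simp only [hB, Finset.mem_filter, Finset.mem_product, Finset.mem_range]
      exact ⟨⟨⟨by omega, by omega⟩, hM _ hl⟩, hl⟩
    · intro v hv
      have := (Finset.mem_filter.mp hv).2
      simp only [level] at this
      exact Finset.mem_range.mpr (by omega)
    · intro i _; rfl
    · intro v hv
      have := (Finset.mem_filter.mp hv).2
      simp only [level] at this
      exact Prod.ext rfl (by simp only; omega)
    · intro i _; rfl
  rw [hcorner, Finset.prod_congr rfl fun v hv =>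
    tsum_localRange hpos hper hdiag hpar u (Finset.mem_filter.mp hv).2,
    Finset.prod_mul_distrib, Finset.prod_mul_distrib, ENNReal.coe_mul, ENNReal.ofNNReal_finsetProd]
  ring

end Step

end

/-! ### Finiteness of the sum over height functions for small weights -/

theorem Finset.eq_range_card_of_isLowerSet {s : Finset ℕ} (hs : IsLowerSet (s : Set ℕ)) :
    s = Finset.range s.card := by
  refine Finset.eq_of_subset_of_card_le (fun i hi => ?_) (by simp)
  have : Finset.range (i + 1) ⊆ s := fun j hj =>
    hs (Nat.lt_succ_iff.mp (Finset.mem_range.mp hj)) hi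
  have := Finset.card_le_card this
  rw [Finset.card_range] at this
  exact Finset.mem_range.mpr this

theorem ENNReal.tsum_eq_add_tsum_ne_zero {α : Type*} [Zero α] (f : α → ℝ≥0∞) :
    ∑' a, f a = f 0 + ∑' a : {a : α // a ≠ 0}, f a := by
  classical
  rw [ENNReal.tsum_eq_add_tsum_ite 0]
  congr 1
  rw [← tsum_subtype_eq_of_support_subset (s := {a : α | a ≠ 0})]
  · exact tsum_congr fun a => if_neg a.2
  · intro a ha h
    simp [h] at ha

open Classical in
-- A finitely supported sequence whose support is an initial segment is a finite list of nonzero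
-- entries, and the sum over lists is a geometric series.
theorem tsum_finsupp_prod_le {α : Type*} [Zero α] (f : α → ℝ≥0∞) :
    (∑' s : ℕ →₀ α, if IsLowerSet (s.support : Set ℕ) then s.prod fun _ => f else 0) ≤
      (1 - ∑' a : {a : α // a ≠ 0}, f a)⁻¹ := by
  have h1 : ∑' x : Σ r : ℕ, Fin r → {a : α // a ≠ 0}, ∏ i, f (x.2 i) =
      (1 - ∑' a : {a : α // a ≠ 0}, f a)⁻¹ := by
    rw [ENNReal.tsum_sigma', ← ENNReal.tsum_geometric]
    refine tsum_congr fun r => ?_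
    rw [ENNReal.tsum_pi_prod (F := fun (_ : Fin r) (a : {a : α // a ≠ 0}) => f a),
      Finset.prod_const, Finset.card_univ, Fintype.card_fin]
  rw [← h1]
  have h2 : ∀ s : {s : ℕ →₀ α // IsLowerSet (s.support : Set ℕ)},
      ∀ i : Fin s.1.support.card, s.1 i ≠ 0 := fun s i => by
    rw [← Finsupp.mem_support_iff]
    exact (Finset.ext_iff.mp (Finset.eq_range_card_of_isLowerSet s.2) i).mpr
      (Finset.mem_range.mpr i.2)
  let ι : {s : ℕ →₀ α // IsLowerSet (s.support : Set ℕ)} → Σ r : ℕ, Fin r → {a : α // a ≠ 0} :=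
    fun s => ⟨s.1.support.card, fun i => ⟨s.1 i, h2 s i⟩⟩
  have hι : Function.Injective ι := by
    intro s t h
    have hcard : s.1.support.card = t.1.support.card := congrArg Sigma.fst h
    have hs : s.1.support = t.1.support := by
      rw [Finset.eq_range_card_of_isLowerSet s.2, Finset.eq_range_card_of_isLowerSet t.2, hcard]
    ext i
    by_cases hi : i ∈ s.1.support
    · have hi1 : i < s.1.support.card := by
        rw [Finset.eq_range_card_of_isLowerSet s.2] at hi
        exact Finset.mem_range.mp hi
      have key : ∀ (x y : Σ r : ℕ, Fin r → {a : α // a ≠ 0}), x = y → ∀ (h1 : i < x.1)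
          (h2 : i < y.1), (x.2 ⟨i, h1⟩).1 = (y.2 ⟨i, h2⟩).1 := by
        rintro x _ rfl _ _; rfl
      exact key _ _ h hi1 (hi1.trans_eq hcard)
    · rw [Finsupp.notMem_support_iff.mp hi, Finsupp.notMem_support_iff.mp (hs ▸ hi)]
  refine le_trans (le_of_eq ?_) (ENNReal.tsum_comp_le_tsum_of_injective hι _)
  rw [← tsum_subtype_eq_of_support_subset (s := {s : ℕ →₀ α | IsLowerSet (s.support : Set ℕ)})]
  · refine tsum_congr fun s => ?_
    rw [if_pos (show IsLowerSet (s.1.support : Set ℕ) from s.2)]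
    change ∏ i ∈ s.1.support, f (s.1 i) = ∏ i : Fin s.1.support.card, f (s.1 i)
    rw [Fin.prod_univ_eq_prod_range (fun i => f (s.1 i)),
      ← Finset.eq_range_card_of_isLowerSet s.2]
  · intro s hs
    simp only [Function.mem_support, ne_eq, ite_eq_right_iff, Classical.not_imp] at hs
    exact hs.1

theorem IsHeight.antitone {n : ℕ} {h : ℕ × ℕ →₀ ℕ} (hh : IsHeight n h) (hn : n ≤ 1) :
    Antitone h := by
  have h1 : ∀ i j k, h (i + k, j) ≤ h (i, j) := by
    intro i j k
    induction k with
    | zero => rfl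
    | succ k ih => exact (hh.right (i + k) j (by omega)).trans ih
  have h2 : ∀ i j k, h (i, j + k) ≤ h (i, j) := by
    intro i j k
    induction k with
    | zero => rfl
    | succ k ih => exact (hh.up i (j + k) (by omega)).trans ih
  rintro ⟨i, j⟩ ⟨i', j'⟩ ⟨hi, hj⟩
  obtain ⟨a, rfl⟩ := Nat.exists_eq_add_of_le hi
  obtain ⟨b, rfl⟩ := Nat.exists_eq_add_of_le hj
  exact (h1 i (j + b) a).trans (h2 i j b)

theorem heightSum_mono (n : ℕ) {ω ω' : ℕ → ℕ → ℝ≥0} (h : ∀ i j, ω i j ≤ ω' i j) :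
    heightSum n ω ≤ heightSum n ω' := by
  classical
  refine ENNReal.tsum_le_tsum fun u => ?_
  split_ifs
  · refine ENNReal.coe_le_coe.mpr (Finset.prod_le_prod' fun p _ => Finset.prod_le_prod' fun k _ => h _ _)
  · exact le_rfl

/-- Only the nesting of supports is used, not the monotonicity of heights. At weight `1 / 4` the
nonzero heights sum to `1 / 3`, so the nonzero rows sum to at most `(1 - 1 / 3)⁻¹ - 1 = 1 / 2`, and
sequences of rows to at most `2`. -/
theorem heightSum_ne_top {ω : ℕ → ℕ → ℝ≥0} (h : ∀ i j, ω i j ≤ 1 / 4) : heightSum 0 ω ≠ ⊤ := by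
  classical
  refine ne_top_of_le_ne_top ?_ (heightSum_mono 0 h)
  set q : ℝ≥0∞ := ((1 / 4 : ℝ≥0) : ℝ≥0∞) with hq
  have hq' : q = (4 : ℝ≥0∞)⁻¹ := by
    rw [hq, one_div, ENNReal.coe_inv (by norm_num)]; rfl
  set f₁ : ℕ → ℝ≥0∞ := fun m => q ^ m
  set f₂ : (ℕ →₀ ℕ) → ℝ≥0∞ := fun s =>
    if IsLowerSet (s.support : Set ℕ) then s.prod fun _ => f₁ else 0
  have hb : (∑' m : {m : ℕ // m ≠ 0}, f₁ m) = 3⁻¹ := by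
    have h1 := ENNReal.tsum_eq_add_tsum_ne_zero f₁
    rw [ENNReal.tsum_geometric] at h1
    have h2 : (1 - q)⁻¹ = 1 + 3⁻¹ := by
      rw [hq', ← ENNReal.toReal_eq_toReal_iff' (by
        rw [ENNReal.inv_ne_top]
        exact (tsub_pos_of_lt (by rw [ENNReal.inv_lt_one]; norm_num)).ne') (by simp),
        ENNReal.toReal_inv, ENNReal.toReal_sub_of_le
          (by rw [ENNReal.inv_le_one]; norm_num) (by simp), ENNReal.toReal_add (by simp) (by simp)]
      norm_num
    rw [h2, show f₁ 0 = 1 from pow_zero _] at h1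
    exact ((ENNReal.add_right_inj (by simp)).mp h1).symm
  have ha : (∑' s : {s : ℕ →₀ ℕ // s ≠ 0}, f₂ s) ≤ 2⁻¹ := by
    have h1 := ENNReal.tsum_eq_add_tsum_ne_zero f₂
    have h2 := tsum_finsupp_prod_le f₁
    rw [hb] at h2
    change ∑' s, f₂ s ≤ _ at h2
    have h3 : (1 - 3⁻¹ : ℝ≥0∞)⁻¹ = 1 + 2⁻¹ := by
      rw [← ENNReal.toReal_eq_toReal_iff' (by
        rw [ENNReal.inv_ne_top]
        exact (tsub_pos_of_lt (by rw [ENNReal.inv_lt_one]; norm_num)).ne') (by simp),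
        ENNReal.toReal_inv, ENNReal.toReal_sub_of_le
          (by rw [ENNReal.inv_le_one]; norm_num) (by simp), ENNReal.toReal_add (by simp) (by simp)]
      norm_num
    rw [h1, h3, show f₂ 0 = 1 by simp [f₂, isLowerSet_empty]] at h2
    exact (ENNReal.add_le_add_iff_left (by simp)).mp h2
  have hfin : (∑' s : ℕ →₀ (ℕ →₀ ℕ), if IsLowerSet (s.support : Set ℕ) then s.prod fun _ => f₂
      else 0) ≠ ⊤ := by
    refine ne_top_of_le_ne_top ?_ (tsum_finsupp_prod_le f₂)
    rw [ENNReal.inv_ne_top]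
    refine (tsub_pos_of_lt (ha.trans_lt ?_)).ne'
    rw [ENNReal.inv_lt_one]; norm_num
  refine ne_top_of_le_ne_top hfin ?_
  rw [← (Finsupp.curryEquiv (α := ℕ) (β := ℕ) (M := ℕ)).tsum_eq]
  refine ENNReal.tsum_le_tsum fun h => ?_
  by_cases hh : IsHeight 0 h
  swap
  · simp [hh]
  have anti := hh.antitone zero_le_one
  have hlow2 : ∀ i, IsLowerSet ((h.curry i).support : Set ℕ) := by
    intro i j j' hj hne
    simp only [Finset.mem_coe, Finsupp.mem_support_iff, Finsupp.curry_apply] at hne ⊢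
    have := anti (show (i, j') ≤ (i, j) from ⟨le_rfl, hj⟩)
    omega
  have hlow1 : IsLowerSet (h.curry.support : Set ℕ) := by
    intro i i' hi hne
    simp only [Finset.mem_coe, Finsupp.mem_support_iff] at hne ⊢
    obtain ⟨j, hj⟩ := Finsupp.ne_iff.mp hne
    refine Finsupp.ne_iff.mpr ⟨j, ?_⟩
    simp only [Finsupp.curry_apply, Finsupp.coe_zero, Pi.zero_apply] at hj ⊢
    have := anti (show (i', j) ≤ (i, j) from ⟨hi, le_rfl⟩)
    omega
  have e1 : Finsupp.curryEquiv h = h.curry := rfl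
  rw [if_pos hh, e1, if_pos hlow1]
  have : (h.curry.prod fun _ => f₂) = h.curry.prod fun _ s => s.prod fun _ => f₁ :=
    Finset.prod_congr rfl fun i _ => if_pos (hlow2 i)
  rw [this]
  have hA : h.support ⊆ h.support.image Prod.fst ×ˢ h.support.image Prod.snd := fun p hp =>
    Finset.mem_product.mpr ⟨Finset.mem_image_of_mem _ hp, Finset.mem_image_of_mem _ hp⟩
  have hA1 : h.curry.support ⊆ h.support.image Prod.fst := by
    intro i hi
    obtain ⟨j, hj⟩ := Finsupp.ne_iff.mp (Finsupp.mem_support_iff.mp hi)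
    exact Finset.mem_image.mpr ⟨(i, j), Finsupp.mem_support_iff.mpr hj, rfl⟩
  have hA2 : ∀ i, (h.curry i).support ⊆ h.support.image Prod.snd := by
    intro i j hj
    have h1 : h.curry i j ≠ 0 := Finsupp.mem_support_iff.mp hj
    have h2 : h (i, j) ≠ 0 := h1
    exact Finset.mem_image.mpr ⟨(i, j), Finsupp.mem_support_iff.mpr h2, rfl⟩
  rw [Finsupp.prod_of_support_subset _ hA1 _ (by simp),
    Finset.prod_congr rfl fun i _ => Finsupp.prod_of_support_subset _ (hA2 i) _ (by simp [f₁]),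
    Finsupp.prod_of_support_subset _ hA _ (by simp), Finset.prod_product]
  simp only [columnWeight, Finset.prod_const, Finset.card_range, ENNReal.ofNNReal_finsetProd,
    ENNReal.coe_pow]
  exact le_rfl

section

/-! ### Evaluation of power series with natural coefficients -/

/-- Cancel the common lower terms, divide by `s ^ d` and let `s` tend to zero; the finite tail of
`b` controls the error. -/
theorem ENNReal.tsum_pow_coeff_le {a b : ℕ → ℝ≥0∞} (hb : ∑' d, b d ≠ ⊤)
    (h : ∀ s : ℝ≥0, 0 < s → s ≤ 1 → ∑' d, a d * (s : ℝ≥0∞) ^ d = ∑' d, b d * (s : ℝ≥0∞) ^ d)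
    (d : ℕ) (hd : ∀ k < d, a k = b k) : a d ≤ b d := by
  have split : ∀ (c : ℕ → ℝ≥0∞) (s : ℝ≥0), ∑' k, c k * (s : ℝ≥0∞) ^ k =
      ∑ k ∈ Finset.range d, c k * (s : ℝ≥0∞) ^ k +
        (s : ℝ≥0∞) ^ d * ∑' k, c (k + d) * (s : ℝ≥0∞) ^ k := by
    intro c s
    rw [← ENNReal.summable.sum_add_tsum_nat_add' (k := d), ← ENNReal.tsum_mul_left]
    congr 1
    exact tsum_congr fun k => by ring
  have hB : ∑' k, b (k + d + 1) ≠ ⊤ :=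
    ne_top_of_le_ne_top hb (ENNReal.tsum_comp_le_tsum_of_injective
      (f := fun k => k + d + 1) (fun x y h => by simpa using h) b)
  have key : ∀ s : ℝ≥0, 0 < s → s ≤ 1 → a d ≤ b d + s * ∑' k, b (k + d + 1) := by
    intro s hs hs1
    have h1 := h s hs hs1
    rw [split a, split b, Finset.sum_congr rfl fun k hk => by rw [hd k (Finset.mem_range.mp hk)]]
      at h1
    have hfin : ∑ k ∈ Finset.range d, b k * (s : ℝ≥0∞) ^ k ≠ ⊤ :=
      ENNReal.sum_ne_top.mpr fun k _ => ENNReal.mul_ne_top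
        (ne_top_of_le_ne_top hb (ENNReal.le_tsum k)) (by simp)
    have h2 := (ENNReal.add_right_inj hfin).mp h1
    have h3 := (ENNReal.mul_right_inj (by simpa using fun h => absurd h hs.ne')
      (by simp)).mp h2
    calc a d ≤ ∑' k, a (k + d) * (s : ℝ≥0∞) ^ k := by
          simpa using ENNReal.le_tsum (f := fun k => a (k + d) * (s : ℝ≥0∞) ^ k) 0
      _ = b d + ∑' k, b (k + 1 + d) * (s : ℝ≥0∞) ^ (k + 1) := by
          rw [h3, tsum_eq_zero_add' ENNReal.summable]; simp
      _ ≤ _ := by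
          rw [← ENNReal.tsum_mul_left]
          refine add_le_add le_rfl (ENNReal.tsum_le_tsum fun k => ?_)
          rw [pow_succ, mul_comm (s : ℝ≥0∞), add_right_comm k 1 d, ← mul_assoc]
          refine mul_le_mul_left (mul_le_of_le_one_right' (pow_le_one₀ zero_le (by simpa using hs1))) _
  refine ENNReal.le_of_forall_pos_le_add fun ε hε _ => ?_
  lift ∑' k, b (k + d + 1) to ℝ≥0 using hB with B
  refine (key (min 1 (ε / (B + 1))) (by positivity) (min_le_left _ _)).trans ?_
  refine add_le_add le_rfl ?_
  rw [← ENNReal.coe_mul]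
  refine ENNReal.coe_le_coe.mpr ?_
  calc min 1 (ε / (B + 1)) * B ≤ ε / (B + 1) * (B + 1) := by
        gcongr
        · exact min_le_right _ _
        · exact le_self_add
    _ = ε := div_mul_cancel₀ _ (by positivity)

theorem ENNReal.tsum_pow_coeff_ext {a b : ℕ → ℝ≥0∞} (ha : ∑' d, a d ≠ ⊤) (hb : ∑' d, b d ≠ ⊤)
    (h : ∀ s : ℝ≥0, 0 < s → s ≤ 1 → ∑' d, a d * (s : ℝ≥0∞) ^ d = ∑' d, b d * (s : ℝ≥0∞) ^ d)
    (d : ℕ) : a d = b d := by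
  induction d using Nat.strong_induction_on with
  | _ d ih =>
    exact le_antisymm (ENNReal.tsum_pow_coeff_le hb h d ih)
      (ENNReal.tsum_pow_coeff_le ha (fun s h0 h1 => (h s h0 h1).symm) d fun k hk => (ih k hk).symm)

variable {ι : Type*}

section Fintype

variable [Fintype ι]

/-- The value of the monomial with exponent `e`. -/
def monomialValue (r : ι → ℝ≥0) (e : ι →₀ ℕ) : ℝ≥0 := ∏ i, r i ^ e i

theorem monomialValue_zero (r : ι → ℝ≥0) : monomialValue r 0 = 1 := by simp [monomialValue]

theorem monomialValue_add (r : ι → ℝ≥0) (e f : ι →₀ ℕ) :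
    monomialValue r (e + f) = monomialValue r e * monomialValue r f := by
  simp [monomialValue, pow_add, Finset.prod_mul_distrib]

theorem monomialValue_nsmul (r : ι → ℝ≥0) (k : ℕ) (e : ι →₀ ℕ) :
    monomialValue r (k • e) = monomialValue r e ^ k := by
  simp only [monomialValue, Finsupp.smul_apply, smul_eq_mul, ← Finset.prod_pow]
  exact Finset.prod_congr rfl fun i _ => by rw [mul_comm, pow_mul]

theorem monomialValue_pos {r : ι → ℝ≥0} (hr : ∀ i, 0 < r i) (e : ι →₀ ℕ) :
    0 < monomialValue r e := Finset.prod_pos fun i _ => pow_pos (hr i) _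

open scoped Classical in
/-- The value of a power series with natural coefficients at a nonnegative point. -/
def evalENNReal (r : ι → ℝ≥0) : MvPowerSeries ι ℕ →+* ℝ≥0∞ where
  toFun f := ∑' e, ((MvPowerSeries.coeff e f : ℕ) : ℝ≥0∞) * (monomialValue r e : ℝ≥0∞)
  map_zero' := by simp
  map_one' := by
    rw [tsum_eq_single 0]
    · simp [monomialValue_zero]
    · intro e he
      simp [MvPowerSeries.coeff_one, he]
  map_add' f g := by
    rw [← ENNReal.tsum_add]
    exact tsum_congr fun e => by simp [add_mul]
  map_mul' f g := by
    rw [← ENNReal.tsum_mul_right]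
    simp_rw [← ENNReal.tsum_mul_left]
    rw [← ENNReal.tsum_prod, ← Finset.HasAntidiagonal.sigmaAntidiagonalEquivProd.tsum_eq,
      ENNReal.tsum_sigma']
    refine tsum_congr fun e => ?_
    rw [MvPowerSeries.coeff_mul, tsum_fintype, Nat.cast_sum, Finset.sum_mul,
      ← Finset.sum_coe_sort]
    refine Finset.sum_congr rfl fun p _ => ?_
    simp only [Finset.HasAntidiagonal.sigmaAntidiagonalEquivProd_apply]
    have hp : monomialValue r e = monomialValue r p.1.1 * monomialValue r p.1.2 := by
      rw [← monomialValue_add, Finset.HasAntidiagonal.mem_antidiagonal.mp p.2]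
    rw [hp]
    push_cast
    ring

theorem evalENNReal_apply (r : ι → ℝ≥0) (f : MvPowerSeries ι ℕ) : evalENNReal r f =
    ∑' e, ((MvPowerSeries.coeff e f : ℕ) : ℝ≥0∞) * (monomialValue r e : ℝ≥0∞) := rfl

theorem evalENNReal_monomial (r : ι → ℝ≥0) (e : ι →₀ ℕ) :
    evalENNReal r (MvPowerSeries.monomial e 1) = monomialValue r e := by
  classical
  rw [evalENNReal_apply, tsum_eq_single e]
  · simp
  · intro d hd
    simp [MvPowerSeries.coeff_monomial, hd]

theorem constantCoeff_le_evalENNReal (r : ι → ℝ≥0) (f : MvPowerSeries ι ℕ) :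
    ((MvPowerSeries.constantCoeff f : ℕ) : ℝ≥0∞) ≤ evalENNReal r f := by
  refine le_trans ?_ (ENNReal.le_tsum (0 : ι →₀ ℕ))
  simp [monomialValue_zero]

/-- Rescaling the point separates the homogeneous parts, by uniqueness of one-variable expansions.
Each part is a polynomial, and a polynomial is determined by its values on a product of infinite
sets. -/
theorem evalENNReal_injective {f g : MvPowerSeries ι ℕ} {ε : ℝ≥0} (hε : 0 < ε)
    (hf : ∀ r : ι → ℝ≥0, (∀ i, 0 < r i) → (∀ i, r i ≤ ε) → evalENNReal r f ≠ ⊤)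
    (h : ∀ r : ι → ℝ≥0, (∀ i, 0 < r i) → (∀ i, r i ≤ ε) → evalENNReal r f = evalENNReal r g) :
    f = g := by
  classical
  set S : ℕ → Set (ι →₀ ℕ) := fun d => Finsupp.degree ⁻¹' {d} with hS
  have hSfin : ∀ d, (S d).Finite := fun d =>
    (Finsupp.finite_of_degree_le d).subset fun e (he : _ = d) => he.le
  set hom : MvPowerSeries ι ℕ → (ι → ℝ≥0) → ℕ → ℝ≥0∞ := fun f r d =>
    ∑' e : S d, ((MvPowerSeries.coeff e.1 f : ℕ) : ℝ≥0∞) * (monomialValue r e.1 : ℝ≥0∞) with hhom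
  have hev : ∀ f r, evalENNReal r f = ∑' d, hom f r d := fun f r =>
    (ENNReal.tsum_fiberwise (fun e => ((MvPowerSeries.coeff e f : ℕ) : ℝ≥0∞) *
      (monomialValue r e : ℝ≥0∞)) Finsupp.degree).symm
  have hscale : ∀ f r (s : ℝ≥0) d, hom f (fun i => s * r i) d = hom f r d * (s : ℝ≥0∞) ^ d := by
    intro f r s d
    rw [hhom, ← ENNReal.tsum_mul_right]
    refine tsum_congr fun e => ?_
    have : monomialValue (fun i => s * r i) e.1 = monomialValue r e.1 * s ^ d := by
      have he : Finsupp.degree e.1 = d := e.2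
      simp only [monomialValue, mul_pow, Finset.prod_mul_distrib]
      rw [mul_comm, Finset.prod_pow_eq_pow_sum, ← Finsupp.degree_eq_sum, he]
    rw [this]
    push_cast
    ring
  have hhomeq : ∀ r : ι → ℝ≥0, (∀ i, 0 < r i) → (∀ i, r i ≤ ε) → ∀ d, hom f r d = hom g r d := by
    intro r h0 h1
    refine ENNReal.tsum_pow_coeff_ext ?_ ?_ fun s hs hs1 => ?_
    · rw [← hev]; exact hf r h0 h1
    · rw [← hev, ← h r h0 h1]; exact hf r h0 h1
    · simp_rw [← hscale, ← hev]
      exact h _ (fun i => mul_pos hs (h0 i)) fun i => (mul_le_of_le_one_left' hs1).trans (h1 i)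
  ext e
  set d := Finsupp.degree e
  set T : Finset (ι →₀ ℕ) := (hSfin d).toFinset
  set poly : MvPowerSeries ι ℕ → MvPolynomial ι ℝ := fun f =>
    ∑ e ∈ T, MvPolynomial.monomial e ((MvPowerSeries.coeff e f : ℕ) : ℝ) with hpoly
  have hpe : ∀ f (r : ι → ℝ≥0), ENNReal.ofReal (MvPolynomial.eval (fun i => (r i : ℝ)) (poly f)) =
      hom f r d := by
    intro f r
    have h1 : MvPolynomial.eval (fun i => (r i : ℝ)) (poly f) =
        ((∑ e ∈ T, ((MvPowerSeries.coeff e f : ℕ) : ℝ≥0) * monomialValue r e : ℝ≥0) : ℝ) := by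
      rw [hpoly, map_sum]
      push_cast
      refine Finset.sum_congr rfl fun e _ => ?_
      rw [MvPolynomial.eval_monomial, Finsupp.prod_fintype _ _ (by simp), monomialValue]
      push_cast
      rfl
    rw [h1, ENNReal.ofReal_coe_nnreal, ENNReal.ofNNReal_finsetSum]
    have h2 := Finset.tsum_subtype T fun e => ((MvPowerSeries.coeff e f : ℕ) : ℝ≥0∞) *
      (monomialValue r e : ℝ≥0∞)
    push_cast
    rw [← h2]
    have h3 : (T : Set (ι →₀ ℕ)) = S d := by simp [T]
    have h4 : ∀ S₁ S₂ : Set (ι →₀ ℕ), S₁ = S₂ →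
      ∑' e : S₁, ((MvPowerSeries.coeff e.1 f : ℕ) : ℝ≥0∞) * (monomialValue r e.1 : ℝ≥0∞) =
      ∑' e : S₂, ((MvPowerSeries.coeff e.1 f : ℕ) : ℝ≥0∞) * (monomialValue r e.1 : ℝ≥0∞) := by
      rintro _ _ rfl; rfl
    exact h4 _ _ h3
  have hnn : ∀ f (r : ι → ℝ≥0), 0 ≤ MvPolynomial.eval (fun i => (r i : ℝ)) (poly f) := by
    intro f r
    rw [hpoly, map_sum]
    refine Finset.sum_nonneg fun e _ => ?_
    rw [MvPolynomial.eval_monomial, Finsupp.prod_fintype _ _ (by simp)]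
    positivity
  have heq : poly f = poly g := by
    refine MvPolynomial.funext_set (fun _ => Set.Ioc 0 (ε : ℝ))
      (fun _ => Set.Ioc_infinite (by exact_mod_cast hε)) fun x hx => ?_
    have hx : ∀ i, 0 < x i ∧ x i ≤ ε := fun i => hx i (Set.mem_univ i)
    lift x to ι → ℝ≥0 using fun i => (hx i).1.le
    have := hhomeq x (fun i => by exact_mod_cast (hx i).1) (fun i => by exact_mod_cast (hx i).2) d
    rw [← hpe, ← hpe, ENNReal.ofReal_eq_ofReal_iff (hnn _ _) (hnn _ _)] at this
    exact this
  have hcoeff : ∀ f, MvPolynomial.coeff e (poly f) = ((MvPowerSeries.coeff e f : ℕ) : ℝ) := by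
    intro f
    have : e ∈ T := by simp [T, hS, d]
    rw [hpoly, MvPolynomial.coeff_sum]
    simp [MvPolynomial.coeff_monomial, this]
  have := congrArg (MvPolynomial.coeff e) heq
  rw [hcoeff, hcoeff] at this
  exact_mod_cast this

/-! ### Counting series -/

/-- The power series whose coefficients count the elements of a family with given exponent. -/
def countSeries {C ι : Type*} (e : C → ι →₀ ℕ) : MvPowerSeries ι ℕ :=
  fun n => Nat.card {c // e c = n}

theorem coeff_countSeries {C ι : Type*} (e : C → ι →₀ ℕ) (n : ι →₀ ℕ) :
    MvPowerSeries.coeff n (countSeries e) = Nat.card {c // e c = n} := rfl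

/-- An infinite fibre would contribute `⊤`. Finiteness of the fibres has to be extracted, because
`Nat.card` gives infinite fibres the value `0`. -/
theorem evalENNReal_countSeries {C : Type*} (e : C → ι →₀ ℕ) {r : ι → ℝ≥0} (hr : ∀ i, 0 < r i)
    (h : ∑' c, (monomialValue r (e c) : ℝ≥0∞) ≠ ⊤) :
    evalENNReal r (countSeries e) = ∑' c, (monomialValue r (e c) : ℝ≥0∞) ∧
      ∀ n, Finite {c // e c = n} := by
  have h1 : ∀ n : ι →₀ ℕ, ∑' b : e ⁻¹' {n}, (monomialValue r (e b) : ℝ≥0∞) =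
      ENat.card {c // e c = n} * (monomialValue r n : ℝ≥0∞) := by
    intro n
    rw [← ENNReal.tsum_const]
    exact tsum_congr fun b => by rw [show e b = n from b.2]
  have hfib := ENNReal.tsum_fiberwise (fun c => (monomialValue r (e c) : ℝ≥0∞)) e
  simp_rw [h1] at hfib
  have hfin : ∀ n, Finite {c // e c = n} := by
    intro n
    by_contra hn
    rw [not_finite_iff_infinite] at hn
    apply h
    rw [← hfib]
    refine ENNReal.tsum_eq_top_of_eq_top ⟨n, ?_⟩
    rw [ENat.card_eq_top_of_infinite, ENat.toENNReal_top, ENNReal.top_mul]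
    exact_mod_cast (monomialValue_pos hr n).ne'
  refine ⟨?_, hfin⟩
  rw [← hfib, evalENNReal_apply]
  refine tsum_congr fun n => ?_
  have := hfin n
  rw [coeff_countSeries, ENat.card_eq_coe_natCard, ENat.toENNReal_coe]

/-- The bridge from values to formal series. The weights after flips involve negative powers, so
`e₂` is a priori integral; but the sum over `C₂` is dominated by a sum that stays bounded near zero,
so no negative exponent occurs. The second factor is then itself a counting series. -/
theorem exists_countSeries_eq_mul {C₁ C₂ : Type*} (e₁ : C₁ → ι →₀ ℕ) (e₂ : C₂ → ι → ℤ)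
    {X : MvPowerSeries ι ℕ} (hX : MvPowerSeries.constantCoeff X = 1) {ε : ℝ≥0} (hε : 0 < ε)
    (hfin : ∀ r : ι → ℝ≥0, (∀ i, 0 < r i) → (∀ i, r i ≤ ε) →
      ∑' c, (monomialValue r (e₁ c) : ℝ≥0∞) ≠ ⊤)
    (h : ∀ r : ι → ℝ≥0, (∀ i, 0 < r i) → (∀ i, r i ≤ ε) →
      ∑' c, (monomialValue r (e₁ c) : ℝ≥0∞) =
        evalENNReal r X * ∑' c, ((∏ i, r i ^ e₂ c i : ℝ≥0) : ℝ≥0∞)) :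
    ∃ H, countSeries e₁ = X * H ∧
      ∀ n, MvPowerSeries.coeff n H ≠ 0 → ∃ c, ∀ i, e₂ c i = n i := by
  classical
  have hle : ∀ (r : ι → ℝ≥0), (∀ i, 0 < r i) → (∀ i, r i ≤ ε) →
      ∑' c, ((∏ i, r i ^ e₂ c i : ℝ≥0) : ℝ≥0∞) ≤ ∑' c, (monomialValue r (e₁ c) : ℝ≥0∞) := by
    intro r h0 h1
    rw [h r h0 h1]
    refine le_mul_of_one_le_left' ?_
    simpa [hX] using constantCoeff_le_evalENNReal r X
  have hnn : ∀ c i, 0 ≤ e₂ c i := by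
    intro c i
    by_contra hneg
    push Not at hneg
    set B := ∑' c, (monomialValue (fun _ => ε) (e₁ c) : ℝ≥0∞) with hB
    have hBtop : B ≠ ⊤ := hfin _ (fun _ => hε) fun _ => le_rfl
    lift B to ℝ≥0 using hBtop with b
    set A := ∏ j ∈ Finset.univ.erase i, ε ^ e₂ c j with hA
    have hApos : 0 < A := Finset.prod_pos fun j _ => zpow_pos hε _
    have key : ∀ s : ℝ≥0, 0 < s → s ≤ ε → s ≤ 1 → A ≤ b * s := by
      intro s hs hsε hs1
      -- Only the coordinate with the supposed negative exponent shrinks; that term grows at least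
      -- like `s⁻¹` while the total stays below `b`.
      set r : ι → ℝ≥0 := Function.update (fun _ => ε) i s with hr
      have hr0 : ∀ j, 0 < r j := fun j => by
        rw [hr, Function.update_apply]; split_ifs <;> assumption
      have hr1 : ∀ j, r j ≤ ε := fun j => by
        rw [hr, Function.update_apply]; split_ifs; exacts [hsε, le_rfl]
      have h1 : ((∏ j, r j ^ e₂ c j : ℝ≥0) : ℝ≥0∞) ≤ b := by
        refine (ENNReal.le_tsum c).trans ((hle r hr0 hr1).trans ?_)
        rw [hB]
        refine ENNReal.tsum_le_tsum fun c => ENNReal.coe_le_coe.mpr ?_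
        exact Finset.prod_le_prod' fun j _ => pow_le_pow_left' (hr1 j) _
      have h1 := ENNReal.coe_le_coe.mp h1
      rw [← Finset.mul_prod_erase _ _ (Finset.mem_univ i), hr, Function.update_self,
        Finset.prod_congr rfl (fun j hj => by rw [Function.update_of_ne (Finset.ne_of_mem_erase hj)])]
        at h1
      have h2 : s⁻¹ ≤ s ^ e₂ c i := by
        rw [← zpow_neg_one]
        exact zpow_le_zpow_right_of_le_one₀ hs hs1 (by omega)
      have h3 : s⁻¹ * A ≤ b := (mul_le_mul_left h2 A).trans h1
      calc A = s⁻¹ * A * s := by field_simp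
        _ ≤ b * s := mul_le_mul_left h3 s
    have hpos : (0 : ℝ≥0) < min (min ε 1) (A / (b + 1)) := by positivity
    have h1 := key _ hpos ((min_le_left _ _).trans (min_le_left _ _))
      ((min_le_left _ _).trans (min_le_right _ _))
    have h2 : b * min (min ε 1) (A / (b + 1)) < A := by
      calc b * min (min ε 1) (A / (b + 1)) < (b + 1) * min (min ε 1) (A / (b + 1)) := by
            gcongr; exact lt_add_one b
        _ ≤ (b + 1) * (A / (b + 1)) := by gcongr; exact min_le_right _ _
        _ = A := mul_div_cancel₀ _ (by positivity)
    exact absurd h1 (not_le.mpr h2)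
  set e₃ : C₂ → ι →₀ ℕ := fun c => Finsupp.equivFunOnFinite.symm fun i => (e₂ c i).toNat with he₃
  have he : ∀ c i, e₂ c i = e₃ c i := fun c i => by simp [he₃, hnn c i]
  have hval : ∀ (r : ι → ℝ≥0) c, ∏ i, r i ^ e₂ c i = monomialValue r (e₃ c) := by
    intro r c
    exact Finset.prod_congr rfl fun i _ => by rw [he, zpow_natCast]
  simp_rw [hval] at h hle
  have hc1 := fun r h0 h1 => evalENNReal_countSeries e₁ h0 (hfin r h0 h1)
  have hc2 := fun r h0 h1 => evalENNReal_countSeries e₃ h0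
    (ne_top_of_le_ne_top (hfin r h0 h1) (hle r h0 h1))
  refine ⟨countSeries e₃, evalENNReal_injective hε (fun r h0 h1 => ?_) (fun r h0 h1 => ?_), ?_⟩
  · rw [(hc1 r h0 h1).1]; exact hfin r h0 h1
  · rw [map_mul, (hc1 r h0 h1).1, (hc2 r h0 h1).1, h r h0 h1]
  · intro n hn
    rw [coeff_countSeries] at hn
    obtain ⟨⟨c, hc⟩⟩ := (Nat.card_ne_zero.mp hn).1
    exact ⟨c, fun i => by rw [he, hc]⟩

/-! ### Geometric series -/

end Fintype

open scoped Classical in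
/-- The geometric series `∑ₖ x ^ (k e)`. -/
def geometricSeries (e : ι →₀ ℕ) : MvPowerSeries ι ℕ :=
  fun n => if ∃ k : ℕ, n = k • e then 1 else 0

theorem geometricSeries_eq {e : ι →₀ ℕ} (he : e ≠ 0) :
    geometricSeries e = 1 + MvPowerSeries.monomial e 1 * geometricSeries e := by
  classical
  ext n
  rw [map_add, MvPowerSeries.coeff_monomial_mul, MvPowerSeries.coeff_one]
  change (if _ then _ else _) = _ + if _ then 1 * (if _ then _ else _) else _
  by_cases h : ∃ k : ℕ, n = k • e
  · rw [if_pos h]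
    obtain ⟨k, rfl⟩ := h
    rcases k with _ | k
    · simp [he]
    · have h1 : e ≤ (k + 1) • e := by
        rw [add_smul, one_smul]; exact le_add_self
      have h2 : (k + 1) • e ≠ 0 := by
        intro h0; rw [h0] at h1; exact he (le_zero_iff.mp h1)
      rw [if_neg h2, if_pos h1, if_pos ⟨k, by rw [add_smul, one_smul, add_tsub_cancel_right]⟩]
  · rw [if_neg h, if_neg (fun h0 => h ⟨0, by simpa using h0⟩)]
    split_ifs with h1 h2
    · obtain ⟨k, hk⟩ := h2
      exact absurd ⟨k + 1, by rw [add_smul, one_smul, ← hk, tsub_add_cancel_of_le h1]⟩ h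
    · rfl
    · rfl

theorem constantCoeff_geometricSeries (e : ι →₀ ℕ) :
    MvPowerSeries.constantCoeff (geometricSeries e) = 1 := by
  classical
  rw [← MvPowerSeries.coeff_zero_eq_constantCoeff_apply]
  exact if_pos ⟨0, by simp⟩

theorem evalENNReal_geometricSeries [Fintype ι] (r : ι → ℝ≥0) {e : ι →₀ ℕ} (he : e ≠ 0) :
    evalENNReal r (geometricSeries e) = (1 - (monomialValue r e : ℝ≥0∞))⁻¹ := by
  classical
  rw [evalENNReal_apply, ← ENNReal.tsum_geometric]
  have hinj : Function.Injective fun k : ℕ => k • e := by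
    intro k l h
    obtain ⟨i, hi⟩ := Finsupp.ne_iff.mp he
    have := DFunLike.congr_fun h i
    exact Nat.eq_of_mul_eq_mul_right (Nat.pos_of_ne_zero hi) this
  rw [← hinj.tsum_eq]
  · refine tsum_congr fun k => ?_
    have : MvPowerSeries.coeff (k • e) (geometricSeries e) = 1 := if_pos ⟨k, rfl⟩
    rw [this, monomialValue_nsmul]
    simp
  · intro n hn
    by_contra h
    have : MvPowerSeries.coeff n (geometricSeries e) = 0 :=
      if_neg fun ⟨k, hk⟩ => h ⟨k, hk.symm⟩
    simp [this] at hn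

end

/-! ### Weights that depend only on parities -/

/-- The parity type of a position of the quarter plane. -/
def cell (i j : ℕ) : Fin 4 := ⟨i % 2 + 2 * (j % 2), by omega⟩

theorem cell_add_one_add_one (i j : ℕ) : cell (i + 1) (j + 1) = (cell i j).rev := by
  rw [Fin.ext_iff, Fin.val_rev]
  simp only [cell]
  omega

theorem cell_add_two (i j : ℕ) : cell (i + 2) (j + 2) = cell i j := by
  simp [cell]

/-- The parity of the level of the positions of a given parity type. -/
def cellParity (c : Fin 4) : ℕ := if c = 1 ∨ c = 2 then 0 else 1

theorem cellParity_rev (c : Fin 4) : cellParity c.rev = cellParity c := by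
  revert c; decide

theorem level_mod_two (i j : ℕ) : level (i, j) % 2 = cellParity (cell i j) := by
  simp only [level, cellParity, Fin.ext_iff, cell]
  split_ifs with h <;> simp at h <;> omega

/-- The weighted sum over height functions for weights that depend only on parities. -/
def cellSum (n : ℕ) (W : Fin 4 → ℝ≥0) : ℝ≥0∞ := heightSum n fun i j => W (cell i j)

/-- The new weights after a flip at the positions whose level has the parity of `n`. -/
def flipCell (n : ℕ) (W : Fin 4 → ℝ≥0) (c : Fin 4) : ℝ≥0 :=
  if cellParity c = n % 2 then (W c.rev)⁻¹ else
    W c * (if n % 2 = 0 then W 1 * W 2 else W 0 * W 3)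

/-- The contribution of a corner of parity type `c`. -/
def cellFactor (W : Fin 4 → ℝ≥0) (c : Fin 4) : ℝ≥0∞ :=
  (1 + (W c : ℝ≥0∞)) * (1 - ((W c * W c.rev : ℝ≥0) : ℝ≥0∞))⁻¹

/-- The flip is applied at a whole parity class. The two flipped neighbours that act on a remaining
position have types exchanged by `Fin.rev`, so the quotients of `1 + W c` cancel and the product of
the pair of weights remains. -/
theorem cellSum_flip {W : Fin 4 → ℝ≥0} (hW : ∀ c, 0 < W c) (n : ℕ) :
    cellSum n W = (∏ i ∈ Finset.range n, cellFactor W (cell i (n - 1 - i))) *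
      cellSum (n + 1) (flipCell n W) := by
  rw [cellSum, heightSum_flip (M := fun p => level p % 2 = n % 2) (fun i j => hW _)
    (fun i j => by rw [cell_add_two]) (fun i j => by simp only [level]; omega) (fun p h => h)
    (fun p h => by rw [h])]
  congr 1
  · simp only [cornerFactor, cellFactor, cell_add_one_add_one]
  · unfold cellSum
    congr 1
    funext i j
    have h1 : ∀ i j, (level (i, j) % 2 = n % 2) = (cellParity (cell i j) = n % 2) := fun i j => by
      rw [level_mod_two]
    have h2 : cell (i + 1) j = (cell i (j + 1)).rev := by
      rw [← cell_add_one_add_one]; simp only [cell, Fin.ext_iff]; omega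
    have h3 : cell (i + 1) (j + 1 + 1) = (cell i (j + 1)).rev := cell_add_one_add_one i (j + 1)
    have h4 : cell (i + 1 + 1) (j + 1) = cell i (j + 1) := by
      simp only [cell, Fin.ext_iff]; omega
    simp only [flipWeights, flipCell, flipWeight, h1, h2, h3, h4, cell_add_one_add_one]
    have hpar := cellParity_rev (cell i (j + 1))
    have hpar' : cellParity (cell i j) = 1 - cellParity (cell i (j + 1)) := by
      simp only [cellParity, Fin.ext_iff, cell]
      split_ifs <;> simp at * <;> omega
    have hpair : cellParity (cell i (j + 1)) = n % 2 → (if n % 2 = 0 then W 1 * W 2 else W 0 * W 3) =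
        W (cell i (j + 1)).rev * W (cell i (j + 1)) := by
      intro h
      rw [← h]
      generalize cell i (j + 1) = c
      fin_cases c <;> simp [cellParity, mul_comm]
    by_cases h : cellParity (cell i j) = n % 2
    · rw [if_pos h, if_pos h]
    · have h5 : cellParity (cell i (j + 1)) = n % 2 := by
        have : cellParity (cell i (j + 1)) ≤ 1 := by unfold cellParity; split_ifs <;> omega
        omega
      rw [if_neg h, if_neg h, if_pos h5, if_pos (hpar.trans h5), hpair h5, mul_assoc]
      congr 1
      have ha := (add_pos one_pos (hW (cell i (j + 1)))).ne'
      have hb := (add_pos one_pos (hW (cell i (j + 1)).rev)).ne'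
      field_simp

/-- Types alternate along an antidiagonal, and one of even length has equally many of each. -/
theorem prod_cell_even {R : Type*} [CommMonoid R] (φ : Fin 4 → R) (k : ℕ) :
    ∏ i ∈ Finset.range (2 * k), φ (cell i (2 * k - 1 - i)) = (φ 1 * φ 2) ^ k := by
  have h : ∀ i ∈ Finset.range (2 * k), φ (cell i (2 * k - 1 - i)) =
      if i % 2 = 0 then φ 2 else φ 1 := by
    intro i hi
    have := Finset.mem_range.mp hi
    split_ifs with h
    · congr 1; simp only [cell, Fin.ext_iff]; change _ = 2; omega
    · congr 1; simp only [cell, Fin.ext_iff]; change _ = 1; omega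
  rw [Finset.prod_congr rfl h]
  clear h
  induction k with
  | zero => simp
  | succ k ih =>
    rw [show 2 * (k + 1) = 2 * k + 1 + 1 by ring, Finset.prod_range_succ, Finset.prod_range_succ, ih,
      if_pos (by omega), if_neg (by omega), pow_succ, mul_assoc, mul_comm (φ 2)]

/-- An antidiagonal of odd length begins and ends with type `0`, so this type occurs once more than
type `3`. This asymmetry is the origin of the multiplicity `e 0` in the plethystic argument. -/
theorem prod_cell_odd {R : Type*} [CommMonoid R] (φ : Fin 4 → R) (k : ℕ) :
    ∏ i ∈ Finset.range (2 * k + 1), φ (cell i (2 * k + 1 - 1 - i)) = φ 0 ^ (k + 1) * φ 3 ^ k := by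
  have h : ∀ i ∈ Finset.range (2 * k + 1), φ (cell i (2 * k + 1 - 1 - i)) =
      if i % 2 = 0 then φ 0 else φ 3 := by
    intro i hi
    have := Finset.mem_range.mp hi
    split_ifs with h
    · congr 1; simp only [cell, Fin.ext_iff]; change _ = 0; omega
    · congr 1; simp only [cell, Fin.ext_iff]; change _ = 3; omega
  rw [Finset.prod_congr rfl h]
  clear h
  induction k with
  | zero => simp
  | succ k ih =>
    rw [show 2 * (k + 1) + 1 = 2 * k + 1 + 1 + 1 by ring, Finset.prod_range_succ,
      Finset.prod_range_succ, ih, if_neg (by omega), if_pos (by omega), pow_succ _ (k + 1),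
      pow_succ (φ 3)]
    ac_rfl

/-- The weights after `k` double flips, starting with the positions whose level has the parity
of `s`. -/
def iteratedWeight (s k : ℕ) (r : Fin 4 → ℝ≥0) (c : Fin 4) : ℝ≥0 :=
  if cellParity c = s % 2 then r c * (∏ i, r i) ^ k else r c * ((∏ i, r i) ^ k)⁻¹

theorem iteratedWeight_pos {r : Fin 4 → ℝ≥0} (hr : ∀ c, 0 < r c) (s k : ℕ) (c : Fin 4) :
    0 < iteratedWeight s k r c := by
  have ht : 0 < ∏ i, r i := Finset.prod_pos fun i _ => hr i
  have := hr c
  unfold iteratedWeight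
  split_ifs <;> positivity

theorem flipCell_pos {W : Fin 4 → ℝ≥0} (hW : ∀ c, 0 < W c) (n : ℕ) (c : Fin 4) :
    0 < flipCell n W c := by
  have := hW c; have := hW c.rev; have := hW 1; have := hW 2; have := hW 0; have := hW 3
  unfold flipCell
  split_ifs <;> positivity

theorem flipCell_mod_two (n : ℕ) (W : Fin 4 → ℝ≥0) : flipCell n W = flipCell (n % 2) W := by
  funext c
  simp [flipCell]

/-- The inverses taken in the two flips undo each other up to the pair products, whose product is
`t`. The class flipped first gains a factor `t` and the other loses one. -/
theorem flipCell_flipCell_iteratedWeight {r : Fin 4 → ℝ≥0} (hr : ∀ c, 0 < r c) {s : ℕ}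
    (hs : s < 2) (k : ℕ) : flipCell (s + 1) (flipCell s (iteratedWeight s k r)) =
      iteratedWeight s (k + 1) r := by
  funext c
  have h0 := (hr 0).ne'; have h1 := (hr 1).ne'; have h2 := (hr 2).ne'; have h3 := (hr 3).ne'
  interval_cases s <;> fin_cases c <;>
    simp [flipCell, iteratedWeight, cellParity, Fin.prod_univ_four] <;> field_simp <;> ring

/-- The product of the weights of the parity types whose level has the parity of `s`. -/
def classProd (s : ℕ) (r : Fin 4 → ℝ≥0) : ℝ≥0 := if s = 0 then r 1 * r 2 else r 0 * r 3

theorem cellFactor_iteratedWeight (r : Fin 4 → ℝ≥0) {s : ℕ} (hs : s < 2) (k : ℕ) {c : Fin 4}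
    (hc : cellParity c = s) : cellFactor (iteratedWeight s k r) c =
      (1 + (((∏ i, r i) ^ k * r c : ℝ≥0) : ℝ≥0∞)) *
        (1 - (((∏ i, r i) ^ (2 * k) * classProd s r : ℝ≥0) : ℝ≥0∞))⁻¹ := by
  have h1 : cellParity c.rev = s := by rw [cellParity_rev, hc]
  have h2 : classProd s r = r c * r c.rev := by
    subst hc
    fin_cases c <;> simp [classProd, cellParity, mul_comm]
  have h3 : s % 2 = s := Nat.mod_eq_of_lt hs
  rw [cellFactor, iteratedWeight, iteratedWeight, if_pos (hc.trans h3.symm),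
    if_pos (h1.trans h3.symm), h2,
    mul_comm (r c), mul_comm (r c.rev), mul_mul_mul_comm, ← pow_add, two_mul]

theorem cellFactor_flipCell_iteratedWeight {r : Fin 4 → ℝ≥0} (hr : ∀ c, 0 < r c) {s : ℕ}
    (hs : s < 2) (k : ℕ) {c : Fin 4} (hc : cellParity c ≠ s) :
    cellFactor (flipCell s (iteratedWeight s k r)) c =
      (1 + (((∏ i, r i) ^ k * (r c * classProd s r) : ℝ≥0) : ℝ≥0∞)) *
        (1 - (((∏ i, r i) ^ (2 * k + 1) * classProd s r : ℝ≥0) : ℝ≥0∞))⁻¹ := by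
  have key : ∀ c, cellParity c ≠ s → flipCell s (iteratedWeight s k r) c =
      (∏ i, r i) ^ k * (r c * classProd s r) := by
    intro c hc
    have h0 := (hr 0).ne'; have h1 := (hr 1).ne'; have h2 := (hr 2).ne'; have h3 := (hr 3).ne'
    interval_cases s <;> fin_cases c <;> first
      | exact absurd rfl hc
      | (simp [flipCell, iteratedWeight, cellParity, classProd, Fin.prod_univ_four]; field_simp)
  have h1 : cellParity c.rev ≠ s := by
    rwa [cellParity_rev]
  have h2 : ∏ i, r i = r c * r c.rev * classProd s r := by
    rw [Fin.prod_univ_four]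
    interval_cases s <;> fin_cases c <;> first
      | exact absurd rfl hc
      | (simp [classProd]; ring)
  rw [cellFactor, key c hc, key _ h1]
  congr 4
  rw [pow_succ]
  nth_rw 4 [h2]
  ring

/-- The contribution of the corners in the `k`-th double flip. -/
def doubleValue (s k : ℕ) (r : Fin 4 → ℝ≥0) : ℝ≥0∞ :=
  if s = 0 then
    (cellFactor (iteratedWeight 0 k r) 1 * cellFactor (iteratedWeight 0 k r) 2) ^ k *
      (cellFactor (flipCell 0 (iteratedWeight 0 k r)) 0 ^ (k + 1) *
        cellFactor (flipCell 0 (iteratedWeight 0 k r)) 3 ^ k)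
  else
    (cellFactor (iteratedWeight 1 k r) 0 ^ (k + 1) * cellFactor (iteratedWeight 1 k r) 3 ^ k) *
      (cellFactor (flipCell 1 (iteratedWeight 1 k r)) 1 *
        cellFactor (flipCell 1 (iteratedWeight 1 k r)) 2) ^ (k + 1)

theorem cellSum_double {r : Fin 4 → ℝ≥0} (hr : ∀ c, 0 < r c) {s : ℕ} (hs : s < 2) (k : ℕ) :
    cellSum (2 * k + s) (iteratedWeight s k r) =
      doubleValue s k r * cellSum (2 * (k + 1) + s) (iteratedWeight s (k + 1) r) := by
  have hpos := iteratedWeight_pos hr s k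
  rw [cellSum_flip hpos, flipCell_mod_two, show (2 * k + s) % 2 = s by omega,
    cellSum_flip (flipCell_pos hpos s), flipCell_mod_two (2 * k + s + 1),
    show (2 * k + s + 1) % 2 = (s + 1) % 2 by omega, ← flipCell_mod_two (s + 1),
    flipCell_flipCell_iteratedWeight hr hs, ← mul_assoc]
  congr 1
  · interval_cases s
    · rw [add_zero, prod_cell_even, prod_cell_odd]; rfl
    · rw [prod_cell_odd, show 2 * k + 1 + 1 = 2 * (k + 1) by ring, prod_cell_even]; rfl
  · congr 1; ring

/-! ### The formal factors -/

/-- The exponent `(m, …, m)` plus the indicator of `T`. -/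
def nearConstant {ι : Type*} [Finite ι] (m : ℕ) (T : Finset ι) : ι →₀ ℕ :=
  open Classical in Finsupp.equivFunOnFinite.symm fun c => m + if c ∈ T then 1 else 0

theorem nearConstant_apply {ι : Type*} [Finite ι] [DecidableEq ι] (m : ℕ) (T : Finset ι) (c : ι) :
    nearConstant m T c = m + if c ∈ T then 1 else 0 := by
  simp only [nearConstant, Finsupp.equivFunOnFinite_symm_apply_apply]
  congr

theorem monomialValue_nearConstant {ι : Type*} [Fintype ι] (r : ι → ℝ≥0) (m : ℕ)
    (T : Finset ι) : monomialValue r (nearConstant m T) = (∏ i, r i) ^ m * ∏ i ∈ T, r i := by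
  classical
  simp only [monomialValue, nearConstant_apply, pow_add, Finset.prod_mul_distrib, Finset.prod_pow]
  congr 1
  simp [pow_ite, Finset.prod_ite_mem]

/-- The factor of the plethystic exponential with exponent `(m, …, m) + 1_T`. -/
def formalFactor (m : ℕ) (T : Finset (Fin 4)) : MvPowerSeries (Fin 4) ℕ :=
  (if Even T.card then geometricSeries (nearConstant m T)
    else 1 + MvPowerSeries.monomial (nearConstant m T) 1) ^ nearConstant m T 0

theorem constantCoeff_formalFactor (m : ℕ) {T : Finset (Fin 4)} (hT : T.Nonempty) :
    MvPowerSeries.constantCoeff (formalFactor m T) = 1 := by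
  unfold formalFactor
  rw [map_pow]
  split_ifs
  · rw [constantCoeff_geometricSeries, one_pow]
  · obtain ⟨c, hc⟩ := hT
    have : (0 : Fin 4 →₀ ℕ) ≠ nearConstant m T := fun h => by
      have := DFunLike.congr_fun h c
      simp [nearConstant_apply, hc] at this
    rw [map_add, map_one, ← MvPowerSeries.coeff_zero_eq_constantCoeff_apply,
      MvPowerSeries.coeff_monomial, if_neg this]
    simp

theorem evalENNReal_formalFactor (r : Fin 4 → ℝ≥0) (m : ℕ) {T : Finset (Fin 4)} (hT : T.Nonempty) :
    evalENNReal r (formalFactor m T) =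
      (if Even T.card then (1 - (((∏ i, r i) ^ m * ∏ i ∈ T, r i : ℝ≥0) : ℝ≥0∞))⁻¹
        else 1 + (((∏ i, r i) ^ m * ∏ i ∈ T, r i : ℝ≥0) : ℝ≥0∞)) ^ nearConstant m T 0 := by
  have : nearConstant m T ≠ 0 := fun h => by
    obtain ⟨c, hc⟩ := hT
    have := DFunLike.congr_fun h c
    simp [nearConstant_apply, hc] at this
  rw [formalFactor, map_pow, ← monomialValue_nearConstant]
  split_ifs
  · rw [evalENNReal_geometricSeries r this]
  · rw [map_add, map_one, evalENNReal_monomial]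

theorem evalENNReal_formalFactor_of_odd (r : Fin 4 → ℝ≥0) (m : ℕ) {T : Finset (Fin 4)}
    (hT : T.Nonempty) (h : ¬ Even T.card) {P : ℝ≥0} (hP : ∏ i ∈ T, r i = P) {n : ℕ}
    (hn : (if 0 ∈ T then 1 else 0) = n) :
    evalENNReal r (formalFactor m T) = (1 + (((∏ i, r i) ^ m * P : ℝ≥0) : ℝ≥0∞)) ^ (m + n) := by
  rw [evalENNReal_formalFactor r m hT, if_neg h, hP, nearConstant_apply, hn]

theorem evalENNReal_formalFactor_of_even (r : Fin 4 → ℝ≥0) (m : ℕ) {T : Finset (Fin 4)}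
    (hT : T.Nonempty) (h : Even T.card) {P : ℝ≥0} (hP : ∏ i ∈ T, r i = P) {n : ℕ}
    (hn : (if 0 ∈ T then 1 else 0) = n) : evalENNReal r (formalFactor m T) =
      (1 - (((∏ i, r i) ^ m * P : ℝ≥0) : ℝ≥0∞))⁻¹ ^ (m + n) := by
  rw [evalENNReal_formalFactor r m hT, if_pos h, hP, nearConstant_apply, hn]

theorem evalENNReal_formalFactor_map (r : Fin 4 → ℝ≥0) {π : Equiv.Perm (Fin 4)} (hπ : π 0 = 0)
    (m : ℕ) {T : Finset (Fin 4)} (hT : T.Nonempty) :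
    evalENNReal r (formalFactor m (T.map π.toEmbedding)) =
      evalENNReal (r ∘ π) (formalFactor m T) := by
  have h : (0 : Fin 4) ∈ T.map π.toEmbedding ↔ 0 ∈ T := by
    simp [Finset.mem_map_equiv, (Equiv.symm_apply_eq π).mpr hπ.symm]
  rw [evalENNReal_formalFactor r m ((Finset.map_nonempty).mpr hT), evalENNReal_formalFactor _ m hT]
  simp only [nearConstant_apply, Finset.card_map, Finset.prod_map, h, Equiv.toEmbedding_apply,
    Function.comp_apply]
  rw [Equiv.prod_comp π r]

/-- The factor contributed by the `k`-th double flip. -/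
def doubleFactor (π : Equiv.Perm (Fin 4)) (s k : ℕ) : MvPowerSeries (Fin 4) ℕ :=
  if s = 0 then
    formalFactor k (({1} : Finset (Fin 4)).map π.toEmbedding) *
      formalFactor k (({2} : Finset (Fin 4)).map π.toEmbedding) *
      formalFactor k (({0, 1, 2} : Finset (Fin 4)).map π.toEmbedding) *
      formalFactor k (({3, 1, 2} : Finset (Fin 4)).map π.toEmbedding) *
      (formalFactor (2 * k) (({1, 2} : Finset (Fin 4)).map π.toEmbedding) *
        formalFactor (2 * k + 1) (({1, 2} : Finset (Fin 4)).map π.toEmbedding))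
  else
    formalFactor k (({0} : Finset (Fin 4)).map π.toEmbedding) *
      formalFactor k (({3} : Finset (Fin 4)).map π.toEmbedding) *
      formalFactor k (({1, 0, 3} : Finset (Fin 4)).map π.toEmbedding) *
      formalFactor k (({2, 0, 3} : Finset (Fin 4)).map π.toEmbedding) *
      (formalFactor (2 * k) (({0, 3} : Finset (Fin 4)).map π.toEmbedding) *
        formalFactor (2 * k + 1) (({0, 3} : Finset (Fin 4)).map π.toEmbedding))

theorem constantCoeff_doubleFactor (π : Equiv.Perm (Fin 4)) (s k : ℕ) :
    MvPowerSeries.constantCoeff (doubleFactor π s k) = 1 := by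
  unfold doubleFactor
  split_ifs <;> simp only [map_mul] <;>
    simp only [constantCoeff_formalFactor, Finset.map_nonempty, Finset.insert_nonempty,
      Finset.singleton_nonempty, mul_one]

/-- The numerators of the corner factors give the subsets of odd size, the denominators the pair at
the multiples `2 k` and `2 k + 1` of the constant vector. The numbers of corners of each type agree
with the entries at `0` of the exponents. -/
theorem evalENNReal_doubleFactor {π : Equiv.Perm (Fin 4)} (hπ : π 0 = 0) {r : Fin 4 → ℝ≥0}
    (hr : ∀ i, 0 < r i) {s : ℕ} (hs : s < 2) (k : ℕ) :
    evalENNReal r (doubleFactor π s k) = doubleValue s k (r ∘ π) := by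
  have hr' : ∀ i, 0 < (r ∘ π) i := fun i => hr _
  have hmap := fun m T hT => evalENNReal_formalFactor_map r hπ m (T := T) hT
  generalize r ∘ π = r' at *
  interval_cases s
  · have hc : classProd 0 r' = r' 1 * r' 2 := rfl
    rw [doubleFactor, if_pos rfl, doubleValue, if_pos rfl,
      cellFactor_iteratedWeight r' hs _ (by rfl), cellFactor_iteratedWeight r' hs _ (by rfl),
      cellFactor_flipCell_iteratedWeight hr' hs _ (by decide),
      cellFactor_flipCell_iteratedWeight hr' hs _ (by decide)]
    simp only [map_mul]
    rw [hmap _ _ (by simp), hmap _ _ (by simp), hmap _ _ (by simp), hmap _ _ (by simp),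
      hmap _ _ (by simp), hmap _ _ (by simp),
      evalENNReal_formalFactor_of_odd r' k (T := {1}) (by simp) (by decide)
        (P := r' 1) (by simp) (n := 0) (by decide),
      evalENNReal_formalFactor_of_odd r' k (T := {2}) (by simp) (by decide)
        (P := r' 2) (by simp) (n := 0) (by decide),
      evalENNReal_formalFactor_of_odd r' k (T := {0, 1, 2}) (by simp) (by decide)
        (P := r' 0 * classProd 0 r') (by rw [Finset.prod_insert (by decide), Finset.prod_pair (by decide), hc]) (n := 1) (by decide),
      evalENNReal_formalFactor_of_odd r' k (T := {3, 1, 2}) (by simp) (by decide)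
        (P := r' 3 * classProd 0 r') (by rw [Finset.prod_insert (by decide), Finset.prod_pair (by decide), hc]) (n := 0) (by decide),
      evalENNReal_formalFactor_of_even r' (2 * k) (T := {1, 2}) (by simp) (by decide)
        (P := classProd 0 r') (by rw [Finset.prod_pair (by decide), hc]) (n := 0) (by decide),
      evalENNReal_formalFactor_of_even r' (2 * k + 1) (T := {1, 2}) (by simp) (by decide)
        (P := classProd 0 r') (by rw [Finset.prod_pair (by decide), hc]) (n := 0) (by decide)]
    generalize (1 + (((∏ i, r' i) ^ k * r' 1 : ℝ≥0) : ℝ≥0∞)) = x₁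
    generalize (1 + (((∏ i, r' i) ^ k * r' 2 : ℝ≥0) : ℝ≥0∞)) = x₂
    generalize (1 + (((∏ i, r' i) ^ k * (r' 0 * classProd 0 r') : ℝ≥0) : ℝ≥0∞)) = x₃
    generalize (1 + (((∏ i, r' i) ^ k * (r' 3 * classProd 0 r') : ℝ≥0) : ℝ≥0∞)) = x₄
    generalize (1 - (((∏ i, r' i) ^ (2 * k) * classProd 0 r' : ℝ≥0) : ℝ≥0∞))⁻¹ = x₅
    generalize (1 - (((∏ i, r' i) ^ (2 * k + 1) * classProd 0 r' : ℝ≥0) : ℝ≥0∞))⁻¹ = x₆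
    ring
  · have hc : classProd 1 r' = r' 0 * r' 3 := rfl
    rw [doubleFactor, if_neg one_ne_zero, doubleValue, if_neg one_ne_zero,
      cellFactor_iteratedWeight r' hs _ (by rfl), cellFactor_iteratedWeight r' hs _ (by rfl),
      cellFactor_flipCell_iteratedWeight hr' hs _ (by decide),
      cellFactor_flipCell_iteratedWeight hr' hs _ (by decide)]
    simp only [map_mul]
    rw [hmap _ _ (by simp), hmap _ _ (by simp), hmap _ _ (by simp), hmap _ _ (by simp),
      hmap _ _ (by simp), hmap _ _ (by simp),
      evalENNReal_formalFactor_of_odd r' k (T := {0}) (by simp) (by decide)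
        (P := r' 0) (by simp) (n := 1) (by decide),
      evalENNReal_formalFactor_of_odd r' k (T := {3}) (by simp) (by decide)
        (P := r' 3) (by simp) (n := 0) (by decide),
      evalENNReal_formalFactor_of_odd r' k (T := {1, 0, 3}) (by simp) (by decide)
        (P := r' 1 * classProd 1 r') (by rw [Finset.prod_insert (by decide), Finset.prod_pair (by decide), hc]) (n := 1) (by decide),
      evalENNReal_formalFactor_of_odd r' k (T := {2, 0, 3}) (by simp) (by decide)
        (P := r' 2 * classProd 1 r') (by rw [Finset.prod_insert (by decide), Finset.prod_pair (by decide), hc]) (n := 1) (by decide),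
      evalENNReal_formalFactor_of_even r' (2 * k) (T := {0, 3}) (by simp) (by decide)
        (P := classProd 1 r') (by rw [Finset.prod_pair (by decide), hc]) (n := 1) (by decide),
      evalENNReal_formalFactor_of_even r' (2 * k + 1) (T := {0, 3}) (by simp) (by decide)
        (P := classProd 1 r') (by rw [Finset.prod_pair (by decide), hc]) (n := 1) (by decide)]
    generalize (1 + (((∏ i, r' i) ^ k * r' 0 : ℝ≥0) : ℝ≥0∞)) = x₁
    generalize (1 + (((∏ i, r' i) ^ k * r' 3 : ℝ≥0) : ℝ≥0∞)) = x₂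
    generalize (1 + (((∏ i, r' i) ^ k * (r' 1 * classProd 1 r') : ℝ≥0) : ℝ≥0∞)) = x₃
    generalize (1 + (((∏ i, r' i) ^ k * (r' 2 * classProd 1 r') : ℝ≥0) : ℝ≥0∞)) = x₄
    generalize (1 - (((∏ i, r' i) ^ (2 * k) * classProd 1 r' : ℝ≥0) : ℝ≥0∞))⁻¹ = x₅
    generalize (1 - (((∏ i, r' i) ^ (2 * k + 1) * classProd 1 r' : ℝ≥0) : ℝ≥0∞))⁻¹ = x₆
    ring

/-! ### Counting boxes by parity type -/

/-- The number of boxes of parity type `c` under a height function. -/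
def cellCount (h : ℕ × ℕ →₀ ℕ) (c : Fin 4) : ℕ :=
  ∑ p ∈ h.support, ((Finset.range (h p)).filter fun k => cell (p.1 + k) (p.2 + k) = c).card

theorem prod_columnWeight_cell (W : Fin 4 → ℝ≥0) (h : ℕ × ℕ →₀ ℕ) :
    h.prod (columnWeight fun i j => W (cell i j)) = ∏ c, W c ^ cellCount h c := by
  simp only [cellCount, ← Finset.prod_pow_eq_pow_sum]
  rw [Finset.prod_comm]
  refine Finset.prod_congr rfl fun p _ => ?_
  simp only [columnWeight, ← Finset.prod_const, Finset.prod_filter]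
  rw [Finset.prod_comm]
  exact Finset.prod_congr rfl fun k _ => by simp

open Classical in
theorem cellSum_eq_tsum (n : ℕ) (W : Fin 4 → ℝ≥0) : cellSum n W =
    ∑' h : {h : ℕ × ℕ →₀ ℕ // IsHeight n h}, ((∏ c, W c ^ cellCount h.1 c : ℝ≥0) : ℝ≥0∞) := by
  rw [cellSum, heightSum, ← tsum_subtype_eq_of_support_subset (s := {h | IsHeight n h})]
  · refine tsum_congr fun h => ?_
    rw [if_pos (show IsHeight n h.1 from h.2), prod_columnWeight_cell]
  · intro h hh
    simp only [Function.mem_support, ne_eq, ite_eq_right_iff, Classical.not_imp] at hh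
    exact hh.1

theorem isHeight_one {h : ℕ × ℕ →₀ ℕ} : IsHeight 1 h ↔ IsHeight 0 h := by
  constructor
  · intro hh
    exact ⟨fun p hp => absurd hp (Nat.not_lt_zero _), fun i j _ => hh.right i j (by omega),
      fun i j _ => hh.up i j (by omega)⟩
  · intro hh
    refine ⟨fun p hp => ?_, fun i j _ => hh.right i j (by omega),
      fun i j _ => hh.up i j (by omega)⟩
    simp only [level] at hp
    omega

theorem cellSum_zero_eq {r : Fin 4 → ℝ≥0} (hr : ∀ c, 0 < r c) {s : ℕ} (hs : s < 2) (K : ℕ) :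
    cellSum 0 r = (∏ k ∈ Finset.range K, doubleValue s k r) *
      cellSum (2 * K + s) (iteratedWeight s K r) := by
  induction K with
  | zero =>
    have h1 : iteratedWeight s 0 r = r := by funext c; simp [iteratedWeight]
    rw [Finset.prod_range_zero, one_mul, h1]
    interval_cases s
    · rfl
    -- For `s = 1` the flips begin at level `1`, which is harmless: every position has level at
    -- least `1`.
    · unfold cellSum heightSum
      exact tsum_congr fun h => by rw [isHeight_one]
  | succ K ih => rw [ih, cellSum_double hr hs, Finset.prod_range_succ, ← mul_assoc]

/-- The exponent of the monomial of a height function. -/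
def cellExponent (π : Equiv.Perm (Fin 4)) (h : ℕ × ℕ →₀ ℕ) : Fin 4 →₀ ℕ :=
  Finsupp.equivFunOnFinite.symm fun i => cellCount h (π.symm i)

/-- The generating function of height functions, with the colours permuted by `π`. -/
def heightSeries (π : Equiv.Perm (Fin 4)) : MvPowerSeries (Fin 4) ℕ :=
  countSeries fun h : {h : ℕ × ℕ →₀ ℕ // IsHeight 0 h} => cellExponent π h.1

/-- The number of boxes whose level has the parity of `s`, minus the number of the other boxes. -/
def imbalance (π : Equiv.Perm (Fin 4)) (s : ℕ) (e : Fin 4 → ℤ) : ℤ :=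
  ∑ c, if cellParity c = s then e (π c) else -e (π c)

/-- After `K` double flips the weights are the original ones times `t ^ K` on one class and `t ^
(-K)` on the other. A configuration of imbalance `b` thus has its monomial multiplied by `t ^ (K *
b)`, which pushes positive imbalance to high degree. -/
theorem exists_heightSeries_eq_mul {π : Equiv.Perm (Fin 4)} (hπ : π 0 = 0) {s : ℕ} (hs : s < 2)
    (K : ℕ) : ∃ H, heightSeries π = (∏ k ∈ Finset.range K, doubleFactor π s k) * H ∧
      ∀ e, MvPowerSeries.coeff e H ≠ 0 → 0 < imbalance π s (fun i => e i) → 4 * K ≤ e.degree := by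
  have hval1 : ∀ (r : Fin 4 → ℝ≥0) (h : ℕ × ℕ →₀ ℕ),
      ∏ c, (r ∘ π) c ^ cellCount h c = monomialValue r (cellExponent π h) := by
    intro r h
    rw [monomialValue, ← Equiv.prod_comp π fun i => r i ^ _]
    simp [cellExponent]
  have hsum1 : ∀ r : Fin 4 → ℝ≥0, cellSum 0 (r ∘ π) =
      ∑' h : {h : ℕ × ℕ →₀ ℕ // IsHeight 0 h}, (monomialValue r (cellExponent π h.1) : ℝ≥0∞) :=
    fun r => by simp_rw [cellSum_eq_tsum, hval1]
  set e₂ : {h : ℕ × ℕ →₀ ℕ // IsHeight (2 * K + s) h} → Fin 4 → ℤ := fun h i =>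
    cellCount h.1 (π.symm i) + K * imbalance π s fun i => cellCount h.1 (π.symm i) with he₂
  have hval2 : ∀ r : Fin 4 → ℝ≥0, (∀ i, 0 < r i) → ∀ h,
      ∏ c, iteratedWeight s K (r ∘ π) c ^ cellCount h.1 c = ∏ i, r i ^ e₂ h i := by
    intro r hr h
    have ht : ∏ i, (r ∘ π) i = ∏ i, r i := Equiv.prod_comp π r
    have ht0 : ∏ i, r i ≠ 0 := (Finset.prod_pos fun i _ => hr i).ne'
    have h1 : ∀ c, iteratedWeight s K (r ∘ π) c ^ cellCount h.1 c = r (π c) ^ cellCount h.1 c *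
        (∏ i, r i) ^ ((K : ℤ) * if cellParity c = s then (cellCount h.1 c : ℤ)
          else -cellCount h.1 c) := by
      intro c
      rw [iteratedWeight, ht, Nat.mod_eq_of_lt hs]
      split_ifs
      · rw [zpow_mul, zpow_natCast, zpow_natCast, mul_pow]; rfl
      · rw [zpow_mul, zpow_natCast, zpow_neg, zpow_natCast, mul_pow, inv_pow]; rfl
    have h2 : ∀ (f : Fin 4 → ℤ), ∏ c, (∏ i, r i) ^ f c = (∏ i, r i) ^ ∑ c, f c := fun f => by
      generalize ∏ i, r i = t at ht0
      simp only [Fin.prod_univ_four, Fin.sum_univ_four]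
      rw [zpow_add₀ ht0, zpow_add₀ ht0, zpow_add₀ ht0]
    simp_rw [h1]
    rw [Finset.prod_mul_distrib, h2, ← Finset.mul_sum]
    simp only [he₂]
    have h3 : ∀ i, r i ^ ((cellCount h.1 (π.symm i) : ℤ) +
        K * imbalance π s fun i => cellCount h.1 (π.symm i)) = r i ^ cellCount h.1 (π.symm i) *
        r i ^ (K * imbalance π s fun i => cellCount h.1 (π.symm i)) := fun i => by
      rw [zpow_add₀ (hr i).ne', zpow_natCast]
    simp_rw [h3]
    rw [Finset.prod_mul_distrib, Finset.prod_zpow, ← Equiv.prod_comp π (fun i => r i ^ _)]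
    simp [imbalance]
  obtain ⟨H, hH, hsupp⟩ := exists_countSeries_eq_mul
    (fun h : {h : ℕ × ℕ →₀ ℕ // IsHeight 0 h} => cellExponent π h.1) e₂
    (X := ∏ k ∈ Finset.range K, doubleFactor π s k) (by
      rw [map_prod]; exact Finset.prod_eq_one fun k _ => constantCoeff_doubleFactor π s k)
    (ε := 1 / 4) (by norm_num)
    (fun r _ h1 => by
      rw [← hsum1]
      exact heightSum_ne_top fun i j => h1 _)
    (fun r h0 h1 => by
      rw [← hsum1, cellSum_zero_eq (r := r ∘ π) (fun c => h0 _) hs K, map_prod,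
        Finset.prod_congr rfl fun k _ => evalENNReal_doubleFactor hπ h0 hs k, cellSum_eq_tsum]
      simp_rw [hval2 r h0])
  refine ⟨H, hH, fun e he hpos => ?_⟩
  obtain ⟨h, hh⟩ := hsupp e he
  -- The shift adds the same number to all four exponents, and each class has two of them, so the
  -- imbalance is unchanged.
  have himb : imbalance π s (fun i => (e i : ℤ)) =
      imbalance π s fun i => cellCount h.1 (π.symm i) := by
    simp only [← hh, he₂]
    generalize (K * imbalance π s fun i => (cellCount h.1 (π.symm i) : ℤ)) = x
    simp only [imbalance, Fin.sum_univ_four, Equiv.symm_apply_apply]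
    interval_cases s <;> simp [cellParity] <;> ring
  have hK : ∀ i, K ≤ e i := by
    intro i
    have h1 := hh i
    simp only [he₂] at h1
    rw [← himb] at h1
    have h2 : (K : ℤ) * 1 ≤ K * imbalance π s (fun i => (e i : ℤ)) :=
      mul_le_mul_of_nonneg_left (by omega) (by positivity)
    omega
  rw [Finsupp.degree_eq_sum, Fin.sum_univ_four]
  have := hK 0; have := hK 1; have := hK 2; have := hK 3
  omega

theorem prod_doubleFactor_zero (π : Equiv.Perm (Fin 4)) (K : ℕ) :
    ∏ k ∈ Finset.range K, doubleFactor π 0 k =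
      (∏ k ∈ Finset.range K,
        formalFactor k (({1} : Finset (Fin 4)).map π.toEmbedding) *
        formalFactor k (({2} : Finset (Fin 4)).map π.toEmbedding) *
        formalFactor k (({0, 1, 2} : Finset (Fin 4)).map π.toEmbedding) *
        formalFactor k (({3, 1, 2} : Finset (Fin 4)).map π.toEmbedding)) *
      ∏ k ∈ Finset.range (2 * K), formalFactor k (({1, 2} : Finset (Fin 4)).map π.toEmbedding) := by
  induction K with
  | zero => simp
  | succ K ih =>
    rw [Finset.prod_range_succ, ih, Finset.prod_range_succ, show 2 * (K + 1) = 2 * K + 1 + 1 by ring,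
      Finset.prod_range_succ _ (2 * K + 1), Finset.prod_range_succ _ (2 * K), doubleFactor,
      if_pos rfl]
    ring

theorem prod_doubleFactor_one (π : Equiv.Perm (Fin 4)) (K : ℕ) :
    ∏ k ∈ Finset.range K, doubleFactor π 1 k =
      (∏ k ∈ Finset.range K,
        formalFactor k (({0} : Finset (Fin 4)).map π.toEmbedding) *
        formalFactor k (({3} : Finset (Fin 4)).map π.toEmbedding) *
        formalFactor k (({1, 0, 3} : Finset (Fin 4)).map π.toEmbedding) *
        formalFactor k (({2, 0, 3} : Finset (Fin 4)).map π.toEmbedding)) *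
      ∏ k ∈ Finset.range (2 * K), formalFactor k (({0, 3} : Finset (Fin 4)).map π.toEmbedding) := by
  induction K with
  | zero => simp
  | succ K ih =>
    rw [Finset.prod_range_succ, ih, Finset.prod_range_succ, show 2 * (K + 1) = 2 * K + 1 + 1 by ring,
      Finset.prod_range_succ _ (2 * K + 1), Finset.prod_range_succ _ (2 * K), doubleFactor,
      if_neg one_ne_zero]
    ring

/-! ### MacMahon's product for the number of boxes -/

/-- The distance of a position from the main diagonal. -/
def diagDist (i j : ℕ) : ℕ := (i - j) + (j - i)

/-- The exponent of the weight before the flip at level `n`. -/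
def scalarExponent (n i j : ℕ) : ℤ :=
  if (i + j + 1) % 2 = n % 2 ∧ diagDist i j + 1 ≤ n then n
  else if (i + j + 1) % 2 ≠ n % 2 ∧ diagDist i j + 2 ≤ n then 1 - n else 1

/-- The weight before the flip at level `n`. -/
def scalarWeight (q : ℝ≥0) (n i j : ℕ) : ℝ≥0 := q ^ scalarExponent n i j

theorem scalarExponent_add_one_add_one (n i j : ℕ) :
    scalarExponent n (i + 1) (j + 1) = scalarExponent n i j := by
  have h1 : diagDist (i + 1) (j + 1) = diagDist i j := by unfold diagDist; omega
  have h2 : (i + 1 + (j + 1) + 1) % 2 = (i + j + 1) % 2 := by omega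
  rw [scalarExponent, scalarExponent, h1, h2]

theorem scalarExponent_add (n i j k : ℕ) :
    scalarExponent n (i + k) (j + k) = scalarExponent n i j := by
  induction k with
  | zero => rfl
  | succ k ih => rw [← ih, ← add_assoc, ← add_assoc, scalarExponent_add_one_add_one]

/-- For weights constant along diagonals a flip inverts the flipped weights and multiplies the
others by those of the flipped neighbours. On exponents this is an identity in the distances to the
main diagonal. -/
theorem scalarExponent_flip {n : ℕ} (hn : 1 ≤ n) (i j : ℕ) :
    scalarExponent (n + 1) i j =
      if (i + j + 1) % 2 = n % 2 ∧ diagDist i j + 1 ≤ n then -scalarExponent n i j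
      else scalarExponent n i j +
        (if (i + 1 + j + 1) % 2 = n % 2 ∧ diagDist (i + 1) j + 1 ≤ n then
          scalarExponent n (i + 1) j else 0) +
        (if (i + (j + 1) + 1) % 2 = n % 2 ∧ diagDist i (j + 1) + 1 ≤ n then
          scalarExponent n i (j + 1) else 0) := by
  obtain ⟨d, d₁, d₂, hd, hd₁, hd₂, hpar, hcase⟩ : ∃ d d₁ d₂, diagDist i j = d ∧
      diagDist (i + 1) j = d₁ ∧ diagDist i (j + 1) = d₂ ∧ d % 2 = (i + j) % 2 ∧
      (d = 0 ∧ d₁ = 1 ∧ d₂ = 1 ∨ d₁ = d + 1 ∧ d₂ + 1 = d ∨ d₂ = d + 1 ∧ d₁ + 1 = d) :=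
    ⟨_, _, _, rfl, rfl, rfl, by unfold diagDist; omega, by unfold diagDist; omega⟩
  simp only [scalarExponent, hd, hd₁, hd₂]
  clear hd hd₁ hd₂
  by_cases hp : (i + j + 1) % 2 = n % 2
  · have h1 : (i + j + 1) % 2 ≠ (n + 1) % 2 := by omega
    have h2 : (i + 1 + j + 1) % 2 ≠ n % 2 := by omega
    have h3 : (i + (j + 1) + 1) % 2 ≠ n % 2 := by omega
    simp only [hp, h2, h3, ne_eq, true_and, false_and, if_false, not_true, not_false_eq_true,
      add_zero]
    split_ifs <;> omega
  · have h1 : (i + j + 1) % 2 = (n + 1) % 2 := by omega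
    have h2 : (i + 1 + j + 1) % 2 = n % 2 := by omega
    have h3 : (i + (j + 1) + 1) % 2 = n % 2 := by omega
    simp only [h1, h2, h3, ne_eq, true_and, false_and, if_false, not_true]
    clear h1 h2 h3
    split_ifs <;> omega

/-- With weights constant along diagonals, `flipWeight` is the weight itself and a corner
contributes `(1 + x) / (1 - x ^ 2) = 1 / (1 - x)` with `x = q ^ n`. Flipping only the strip of
diagonals that meet level `n` leaves the weight `q` outside it. -/
theorem heightSum_scalar_step {q : ℝ≥0} (hq : 0 < q) (hq1 : q < 1) {n : ℕ} (hn : 1 ≤ n) :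
    heightSum n (scalarWeight q n) = (1 - (q : ℝ≥0∞) ^ n)⁻¹ ^ n *
      heightSum (n + 1) (scalarWeight q (n + 1)) := by
  have hone : ∀ i j, scalarWeight q n (i + 1) (j + 1) = scalarWeight q n i j := fun i j => by
    rw [scalarWeight, scalarExponent_add_one_add_one]; rfl
  have hpos : ∀ i j, 0 < scalarWeight q n i j := fun i j => zpow_pos hq _
  rw [heightSum_flip (M := fun p => (p.1 + p.2 + 1) % 2 = n % 2 ∧ diagDist p.1 p.2 + 1 ≤ n)
    (fun i j => hpos i j) (fun i j => by rw [hone, hone])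
    (fun i j => by
      have h1 : diagDist (i + 1) (j + 1) = diagDist i j := by unfold diagDist; omega
      have h2 : (i + 1 + (j + 1) + 1) % 2 = (i + j + 1) % 2 := by omega
      simp only [h1, h2]) (fun p h => h.1)
    (fun p h => by simp only [level] at h; exact ⟨by rw [h], by unfold diagDist; omega⟩)]
  congr 1
  · have hc : ∀ i ∈ Finset.range n, cornerFactor (scalarWeight q n) i (n - 1 - i) =
        (1 - (q : ℝ≥0∞) ^ n)⁻¹ := by
      intro i hi
      have hi := Finset.mem_range.mp hi
      have h1 : scalarExponent n i (n - 1 - i) = n :=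
        if_pos ⟨by congr 1; omega, by unfold diagDist; omega⟩
      have h2 : scalarWeight q n i (n - 1 - i) = q ^ n := by
        rw [scalarWeight, h1, zpow_natCast]
      rw [cornerFactor, hone, h2]
      have hlt : q ^ n < 1 := pow_lt_one₀ zero_le hq1 (by omega)
      rw [← ENNReal.coe_pow]
      generalize q ^ n = x at hlt
      have h3 : 0 < 1 - x := tsub_pos_of_lt hlt
      have h4 : 0 < 1 - x * x := tsub_pos_of_lt (mul_lt_one_of_nonneg_of_lt_one_left zero_le hlt hlt.le)
      rw [← ENNReal.coe_one, ← ENNReal.coe_sub, ← ENNReal.coe_sub, ← ENNReal.coe_add,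
        ← ENNReal.coe_inv h3.ne', ← ENNReal.coe_inv h4.ne', ← ENNReal.coe_mul, ENNReal.coe_inj]
      have h5 : 1 - x * x = (1 + x) * (1 - x) := by
        rw [mul_tsub, mul_one, add_mul, one_mul]
        exact (add_tsub_add_eq_tsub_right 1 x (x * x)).symm.trans (by rw [add_comm x (x * x)])
      rw [h5, mul_inv, ← mul_assoc, mul_inv_cancel₀ (by positivity), one_mul]
    rw [Finset.prod_congr rfl hc, Finset.prod_const, Finset.card_range]
  · congr 1
    funext i j
    have hflip : ∀ i j, flipWeight (scalarWeight q n) i j = scalarWeight q n i j := fun i j => by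
      rw [flipWeight, hone]
      exact mul_div_cancel_right₀ _ (add_pos one_pos (hpos i j)).ne'
    simp only [flipWeights, hflip, hone]
    rw [scalarWeight.eq_def q (n + 1), scalarExponent_flip hn]
    split_ifs <;> simp only [scalarWeight, zpow_neg, zpow_add₀ hq.ne', zpow_zero]

theorem heightSum_const_eq {q : ℝ≥0} (hq : 0 < q) (hq1 : q < 1) (K : ℕ) :
    heightSum 0 (fun _ _ => q) = (∏ n ∈ Finset.range K, (1 - (q : ℝ≥0∞) ^ (n + 1))⁻¹ ^ (n + 1)) *
      heightSum (K + 1) (scalarWeight q (K + 1)) := by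
  induction K with
  | zero =>
    have h1 : scalarWeight q (0 + 1) = fun _ _ => q := by
      funext i j
      have : scalarExponent (0 + 1) i j = 1 := by
        unfold scalarExponent; split_ifs <;> simp_all
      rw [scalarWeight, this, zpow_one]
    rw [Finset.prod_range_zero, one_mul, h1]
    unfold heightSum
    exact tsum_congr fun h => by rw [zero_add, isHeight_one]
  | succ K ih =>
    rw [ih, heightSum_scalar_step hq hq1 (by omega), Finset.prod_range_succ, mul_assoc]

/-- Moving from a nonzero position towards the axes does not decrease the height, and such moves
reach the strip and then the right parity inside the region. -/
theorem IsHeight.exists_peak {K : ℕ} {h : ℕ × ℕ →₀ ℕ} (hh : IsHeight (K + 1) h) (h0 : h ≠ 0) :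
    ∃ i j, (i + j + 1) % 2 = (K + 1) % 2 ∧ diagDist i j ≤ K ∧ h (i, j) ≠ 0 := by
  obtain ⟨⟨i, j⟩, hp⟩ := Finsupp.ne_iff.mp h0
  simp only [Finsupp.coe_zero, Pi.zero_apply] at hp
  have hlev : ∀ i j, h (i, j) ≠ 0 → K + 1 ≤ i + j + 1 := fun i j hne => by
    by_contra hlt
    exact hne (hh.zero _ (by simpa [level] using hlt))
  have hr : ∀ k i j, K + 1 ≤ i + j + 1 → h (i + k, j) ≤ h (i, j) := by
    intro k
    induction k with
    | zero => intro i j _; rfl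
    | succ k ih => exact fun i j hij => (hh.right (i + k) j (by omega)).trans (ih i j hij)
  have hu : ∀ k i j, K + 1 ≤ i + j + 1 → h (i, j + k) ≤ h (i, j) := by
    intro k
    induction k with
    | zero => intro i j _; rfl
    | succ k ih => exact fun i j hij => (hh.up i (j + k) (by omega)).trans (ih i j hij)
  have hl := hlev i j hp
  rcases le_total (j + K) i with hi | hi
  · refine ⟨j + K, j, by omega, by unfold diagDist; omega, ?_⟩
    have := hr (i - (j + K)) (j + K) j (by omega)
    rw [Nat.add_sub_cancel' hi] at this
    omega
  rcases le_total (i + K) j with hj | hj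
  · refine ⟨i, i + K, by omega, by unfold diagDist; omega, ?_⟩
    have := hu (j - (i + K)) i (i + K) (by omega)
    rw [Nat.add_sub_cancel' hj] at this
    omega
  by_cases hpar : (i + j + 1) % 2 = (K + 1) % 2
  · exact ⟨i, j, hpar, by unfold diagDist; omega, hp⟩
  · obtain ⟨i, rfl⟩ : ∃ i', i = i' + 1 := ⟨i - 1, by omega⟩
    refine ⟨i, j, by omega, by unfold diagDist; omega, ?_⟩
    have := hh.right i j (by omega)
    omega

/-- Negative exponents `-K` occur only on `B`, exponents `K + 1` on `A`. An injection of `B` into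
`A` that does not decrease heights and misses one nonzero position of `A` leaves at least `K + 1`.
-/
theorem IsHeight.le_sum_scalarExponent {K : ℕ} {h : ℕ × ℕ →₀ ℕ} (hh : IsHeight (K + 1) h)
    (h0 : h ≠ 0) : (K + 1 : ℤ) ≤ ∑ p ∈ h.support, scalarExponent (K + 1) p.1 p.2 * h p := by
  classical
  obtain ⟨i₀, j₀, hpar, hdist, hne⟩ := hh.exists_peak h0
  set A := h.support.filter fun p => (p.1 + p.2 + 1) % 2 = (K + 1) % 2 ∧ diagDist p.1 p.2 + 1 ≤ K + 1
    with hA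
  set B := h.support.filter fun p => (p.1 + p.2 + 1) % 2 ≠ (K + 1) % 2 ∧ diagDist p.1 p.2 + 2 ≤ K + 1
    with hB
  have hmemA : (i₀, j₀) ∈ A := by simp [hA, hpar, hdist, hne]
  -- Each position of `B` moves one step towards an axis, away from the diagonal of `(i₀, j₀)`.
  -- Parity keeps `B` off that diagonal, so the two sides stay apart, `φ` is injective, and `(i₀,
  -- j₀)` is not hit.
  set φ : ℕ × ℕ → ℕ × ℕ := fun v => if v.1 + j₀ < v.2 + i₀ then (v.1 - 1, v.2) else (v.1, v.2 - 1)
    with hφ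
  have hBpos : ∀ v ∈ B, 1 ≤ v.1 ∧ 1 ≤ v.2 ∧ K + 2 ≤ v.1 + v.2 + 1 ∧ v.1 + j₀ ≠ v.2 + i₀ ∧
      (v.1 + v.2 + 1) % 2 ≠ (K + 1) % 2 ∧ diagDist v.1 v.2 + 2 ≤ K + 1 ∧ h v ≠ 0 := by
    intro v hv
    simp only [hB, Finset.mem_filter, Finsupp.mem_support_iff] at hv
    obtain ⟨hv0, hv1, hv2⟩ := hv
    have hl : K + 1 ≤ v.1 + v.2 + 1 := by
      by_contra hlt
      exact hv0 (hh.zero _ (by simpa [level] using hlt))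
    have hv2' := hv2
    unfold diagDist at hv2
    exact ⟨by omega, by omega, by omega, by omega, hv1, hv2', hv0⟩
  have hle : ∀ v ∈ B, h v ≤ h (φ v) := by
    intro v hv
    obtain ⟨h1, h2, h3, -⟩ := hBpos v hv
    obtain ⟨i, j⟩ := v
    simp only [hφ]
    split_ifs
    · have := hh.right (i - 1) j (by simp at *; omega)
      rwa [Nat.sub_add_cancel h1] at this
    · have := hh.up i (j - 1) (by simp at *; omega)
      rwa [Nat.sub_add_cancel h2] at this
  have hinj : Set.InjOn φ B := by
    rintro ⟨i, j⟩ hv ⟨i', j'⟩ hw hvw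
    obtain ⟨h1, h2, -, h4, -⟩ := hBpos _ hv
    obtain ⟨h1', h2', -, h4', -⟩ := hBpos _ hw
    simp only [hφ] at hvw
    simp only at h1 h2 h4 h1' h2' h4'
    split_ifs at hvw <;> simp only [Prod.mk.injEq] at hvw ⊢ <;> omega
  have hsub : B.image φ ⊆ A.erase (i₀, j₀) := by
    intro w hw
    obtain ⟨v, hv, rfl⟩ := Finset.mem_image.mp hw
    obtain ⟨h1, h2, h3, h4, h5, h6, h7⟩ := hBpos v hv
    have h8 := hle v hv
    rw [Finset.mem_erase, hA, Finset.mem_filter, Finsupp.mem_support_iff]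
    unfold diagDist at h6 ⊢
    refine ⟨?_, by omega, ?_⟩
    · intro heq
      simp only [hφ] at heq
      split_ifs at heq <;> simp only [Prod.mk.injEq] at heq <;> omega
    · simp only [hφ]
      split_ifs <;> simp only <;> omega
  have hBA : ∑ v ∈ B, h v ≤ ∑ v ∈ A.erase (i₀, j₀), h v :=
    calc ∑ v ∈ B, h v ≤ ∑ v ∈ B, h (φ v) := Finset.sum_le_sum hle
      _ = ∑ w ∈ B.image φ, h w := (Finset.sum_image hinj).symm
      _ ≤ _ := Finset.sum_le_sum_of_subset hsub
  have hterm : ∀ p ∈ h.support, (if p ∈ A then (K + 1 : ℤ) * h p else 0) -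
      (if p ∈ B then (K : ℤ) * h p else 0) ≤ scalarExponent (K + 1) p.1 p.2 * h p := by
    intro p hp
    have hA' : p ∈ A ↔ (p.1 + p.2 + 1) % 2 = (K + 1) % 2 ∧ diagDist p.1 p.2 + 1 ≤ K + 1 := by
      rw [hA, Finset.mem_filter, and_iff_right hp]
    have hB' : p ∈ B ↔ (p.1 + p.2 + 1) % 2 ≠ (K + 1) % 2 ∧ diagDist p.1 p.2 + 2 ≤ K + 1 := by
      rw [hB, Finset.mem_filter, and_iff_right hp]
    simp only [scalarExponent, hA', hB']
    by_cases ha : (p.1 + p.2 + 1) % 2 = (K + 1) % 2 ∧ diagDist p.1 p.2 + 1 ≤ K + 1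
    · rw [if_pos ha, if_neg (fun hb => hb.1 ha.1), if_pos ha]
      push_cast
      omega
    · rw [if_neg ha, if_neg ha]
      split_ifs <;> push_cast
      · ring_nf; omega
      · omega
  refine le_trans ?_ (Finset.sum_le_sum hterm)
  rw [Finset.sum_sub_distrib, Finset.sum_ite_mem, Finset.sum_ite_mem,
    Finset.inter_eq_right.mpr (Finset.filter_subset _ _),
    Finset.inter_eq_right.mpr (Finset.filter_subset _ _), ← Finset.mul_sum, ← Finset.mul_sum,
    ← Finset.add_sum_erase _ _ hmemA]
  have h1 : (∑ v ∈ B, (h v : ℤ)) ≤ ∑ v ∈ A.erase (i₀, j₀), (h v : ℤ) := by exact_mod_cast hBA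
  have h2 : (0 : ℤ) ≤ ∑ v ∈ A.erase (i₀, j₀), (h v : ℤ) := by positivity
  have h3 : (1 : ℤ) ≤ h (i₀, j₀) := by omega
  have h4 : (K : ℤ) * ∑ v ∈ B, (h v : ℤ) ≤ K * ∑ v ∈ A.erase (i₀, j₀), (h v : ℤ) :=
    mul_le_mul_of_nonneg_left h1 (by positivity)
  have h5 : (K + 1 : ℤ) * 1 ≤ (K + 1) * h (i₀, j₀) := mul_le_mul_of_nonneg_left h3 (by positivity)
  linarith

/-- The generating function of height functions by the number of boxes. -/
def boxSeries : MvPowerSeries Unit ℕ :=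
  countSeries fun h : {h : ℕ × ℕ →₀ ℕ // IsHeight 0 h} => Finsupp.single () h.1.degree

open Classical in
theorem heightSum_eq_tsum_pow (n : ℕ) {ω : ℕ → ℕ → ℝ≥0} {q : ℝ≥0} (hq : q ≠ 0) {x : ℕ → ℕ → ℤ}
    (hω : ∀ i j, ω i j = q ^ x i j) (hx : ∀ i j k, x (i + k) (j + k) = x i j) : heightSum n ω =
    ∑' h : {h : ℕ × ℕ →₀ ℕ // IsHeight n h},
      ((q ^ ∑ p ∈ h.1.support, x p.1 p.2 * h.1 p : ℝ≥0) : ℝ≥0∞) := by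
  have hsum : ∀ (s : Finset (ℕ × ℕ)) (f : ℕ × ℕ → ℤ), q ^ ∑ p ∈ s, f p = ∏ p ∈ s, q ^ f p := by
    intro s f
    induction s using Finset.induction_on with
    | empty => simp
    | insert a s ha ih => rw [Finset.sum_insert ha, Finset.prod_insert ha, zpow_add₀ hq, ih]
  rw [heightSum, ← tsum_subtype_eq_of_support_subset (s := {h | IsHeight n h})]
  · refine tsum_congr fun h => ?_
    rw [if_pos (show IsHeight n h.1 from h.2), hsum]
    congr 1
    refine Finset.prod_congr rfl fun p _ => ?_
    simp only [columnWeight, hω, hx, Finset.prod_const, Finset.card_range, zpow_mul, zpow_natCast]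
  · intro h hh
    simp only [Function.mem_support, ne_eq, ite_eq_right_iff, Classical.not_imp] at hh
    exact hh.1

/-- A truncated MacMahon formula: by `IsHeight.le_sum_scalarExponent` a nonempty configuration in
the remainder has exponent at least `K + 1`. -/
theorem exists_boxSeries_eq_mul (K : ℕ) : ∃ H, boxSeries =
    (∏ n ∈ Finset.range K, geometricSeries (Finsupp.single () (n + 1)) ^ (n + 1)) * H ∧
      ∀ n, MvPowerSeries.coeff n H ≠ 0 → n = 0 ∨ K + 1 ≤ n () := by
  have hsum1 : ∀ r : Unit → ℝ≥0, 0 < r () → heightSum 0 (fun _ _ => r ()) =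
      ∑' h : {h : ℕ × ℕ →₀ ℕ // IsHeight 0 h},
        (monomialValue r (Finsupp.single () h.1.degree) : ℝ≥0∞) := by
    intro r hr
    rw [heightSum_eq_tsum_pow 0 hr.ne' (x := fun _ _ => 1) (by simp) (by simp)]
    refine tsum_congr fun h => ?_
    congr 1
    simp only [monomialValue, Finset.univ_unique, Finset.prod_singleton, PUnit.default_eq_unit,
      Finsupp.single_eq_same, one_mul, Finsupp.degree_apply]
    rw [← Nat.cast_sum, zpow_natCast]
  obtain ⟨H, hH, hsupp⟩ := exists_countSeries_eq_mul
    (fun h : {h : ℕ × ℕ →₀ ℕ // IsHeight 0 h} => Finsupp.single () h.1.degree)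
    (fun (h : {h : ℕ × ℕ →₀ ℕ // IsHeight (K + 1) h}) (_ : Unit) =>
      ∑ p ∈ h.1.support, scalarExponent (K + 1) p.1 p.2 * h.1 p)
    (X := ∏ n ∈ Finset.range K, geometricSeries (Finsupp.single () (n + 1)) ^ (n + 1)) (by
      rw [map_prod]
      exact Finset.prod_eq_one fun k _ => by rw [map_pow, constantCoeff_geometricSeries, one_pow])
    (ε := 1 / 4) (by norm_num)
    (fun r h0 h1 => by
      rw [← hsum1 r (h0 ())]
      exact heightSum_ne_top fun i j => h1 _)
    (fun r h0 h1 => by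
      rw [← hsum1 r (h0 ()), heightSum_const_eq (h0 ())
        ((h1 ()).trans_lt (by rw [div_lt_one₀] <;> norm_num)) K, map_prod,
        heightSum_eq_tsum_pow (K + 1) (ω := scalarWeight (r ()) (K + 1)) (h0 ()).ne'
          (x := scalarExponent (K + 1)) (fun _ _ => rfl)
          (scalarExponent_add _)]
      congr 1
      · refine Finset.prod_congr rfl fun n _ => ?_
        rw [map_pow, evalENNReal_geometricSeries r (by simp)]
        simp [monomialValue]
      · exact tsum_congr fun h => by simp)
  refine ⟨H, hH, fun n hn => ?_⟩
  obtain ⟨h, hh⟩ := hsupp n hn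
  have hh := hh ()
  by_cases h0 : h.1 = 0
  · left
    ext
    simp only [h0, Finsupp.support_zero, Finset.sum_empty] at hh
    simpa using hh.symm
  · right
    have := h.2.le_sum_scalarExponent h0
    omega

section

/-! ### Congruence of power series up to a given degree -/

section Congr

variable {ι : Type*} {R : Type*} [CommRing R]

/-- Two power series agree up to total degree `d`. -/
def CongrUpTo (d : ℕ) (f g : MvPowerSeries ι R) : Prop :=
  ∀ e : ι →₀ ℕ, e.degree ≤ d → MvPowerSeries.coeff e f = MvPowerSeries.coeff e g

theorem CongrUpTo.refl (d : ℕ) (f : MvPowerSeries ι R) : CongrUpTo d f f := fun _ _ => rfl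

theorem CongrUpTo.symm {d : ℕ} {f g : MvPowerSeries ι R} (h : CongrUpTo d f g) :
    CongrUpTo d g f := fun e he => (h e he).symm

theorem CongrUpTo.trans {d : ℕ} {f g k : MvPowerSeries ι R} (h : CongrUpTo d f g)
    (h' : CongrUpTo d g k) : CongrUpTo d f k := fun e he => (h e he).trans (h' e he)

theorem CongrUpTo.mul {d : ℕ} {f g f' g' : MvPowerSeries ι R} (h : CongrUpTo d f g)
    (h' : CongrUpTo d f' g') : CongrUpTo d (f * f') (g * g') := by
  classical
  intro e he
  rw [MvPowerSeries.coeff_mul, MvPowerSeries.coeff_mul]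
  refine Finset.sum_congr rfl fun p hp => ?_
  have := congrArg Finsupp.degree (Finset.HasAntidiagonal.mem_antidiagonal.mp hp)
  rw [map_add] at this
  rw [h _ (by omega), h' _ (by omega)]

theorem CongrUpTo.pow {d : ℕ} {f g : MvPowerSeries ι R} (h : CongrUpTo d f g) (n : ℕ) :
    CongrUpTo d (f ^ n) (g ^ n) := by
  induction n with
  | zero => simpa using CongrUpTo.refl d 1
  | succ n ih => rw [pow_succ, pow_succ]; exact ih.mul h

theorem CongrUpTo.prod_one {α : Type*} {d : ℕ} {s : Finset α} {f : α → MvPowerSeries ι R}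
    (h : ∀ a ∈ s, CongrUpTo d (f a) 1) : CongrUpTo d (∏ a ∈ s, f a) 1 := by
  classical
  induction s using Finset.induction_on with
  | empty => simpa using CongrUpTo.refl d 1
  | insert a s ha ih =>
    rw [Finset.prod_insert ha, ← one_mul 1]
    exact (h a (Finset.mem_insert_self a s)).mul (ih fun b hb => h b (Finset.mem_insert_of_mem hb))

theorem CongrUpTo.of_mul_left {d : ℕ} {f g k : MvPowerSeries ι R} (hk : IsUnit k)
    (h : CongrUpTo d (k * f) (k * g)) : CongrUpTo d f g := by
  obtain ⟨u, hu⟩ := hk.exists_left_inv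
  have := (CongrUpTo.refl d u).mul h
  rwa [← mul_assoc, ← mul_assoc, hu, one_mul, one_mul] at this

theorem CongrUpTo.of_monomial_dvd {d : ℕ} {f : MvPowerSeries ι R} {e : ι →₀ ℕ} (he : d < e.degree)
    (h : MvPowerSeries.monomial e 1 ∣ f - 1) : CongrUpTo d f 1 := by
  classical
  obtain ⟨g, hg⟩ := h
  intro n hn
  rw [← sub_eq_zero, ← map_sub, hg, MvPowerSeries.coeff_monomial_mul, if_neg]
  intro hle
  obtain ⟨k, rfl⟩ := exists_add_of_le hle
  rw [map_add] at hn
  omega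

end Congr

/-! ### Truncations of the plethystic exponential -/

open scoped MvPowerSeries.WithPiTopology in
-- A factor with exponent outside `S` is `1` when its degree is at most `d`, and otherwise differs
-- from `1` by a multiple of a monomial of degree above `d`.
theorem congrUpTo_twistedPExp {ι : Type*} (F : MvPowerSeries ι ℤ) (d : ℕ)
    (S : Finset (ι →₀ ℕ)) (hS0 : 0 ∉ S)
    (hS : ∀ e, e ≠ 0 → e ∉ S → e.degree ≤ d → MvPowerSeries.coeff e F = 0) :
    CongrUpTo d (twistedPExp F) (∏ e ∈ S, twistedFactor F e) := by
  classical
  intro e he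
  set S' : Finset {n : ι →₀ ℕ // n ≠ 0} := S.subtype fun n => n ≠ 0
  have hS' : ∏ n ∈ S', twistedFactor F n = ∏ e ∈ S, twistedFactor F e :=
    Finset.prod_subtype_of_mem _ fun n hn h0 => hS0 (h0 ▸ hn)
  have hprod := (multipliable_twistedFactor F).hasProd
  have h1 : Filter.Tendsto (fun s : Finset {n : ι →₀ ℕ // n ≠ 0} =>
      MvPowerSeries.coeff e (∏ n ∈ s, twistedFactor F n)) Filter.atTop
      (nhds (MvPowerSeries.coeff e (twistedPExp F))) :=
    ((MvPowerSeries.WithPiTopology.continuous_coeff ℤ e).tendsto _).comp hprod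
  refine tendsto_nhds_unique h1 (tendsto_const_nhds.congr' ?_)
  filter_upwards [Filter.eventually_ge_atTop S'] with s hs
  rw [← hS', ← Finset.prod_sdiff hs]
  have h2 : CongrUpTo d (∏ n ∈ s \ S', twistedFactor F n) 1 := by
    refine CongrUpTo.prod_one fun n hn => ?_
    by_cases hd : n.1.degree ≤ d
    · have hn' : n.1 ∉ S := fun h => (Finset.mem_sdiff.mp hn).2 (Finset.mem_subtype.mpr h)
      have : twistedFactor F n.1 = 1 := by simp [twistedFactor, hS n.1 n.2 hn' hd]
      rw [this]
      exact CongrUpTo.refl d 1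
    · exact CongrUpTo.of_monomial_dvd (not_le.mp hd) (monomial_dvd_twistedFactor_sub_one F n.1 n.2)
  have h3 := (h2.mul (CongrUpTo.refl d (∏ n ∈ S', twistedFactor F n))) e he
  rw [one_mul] at h3
  exact h3.symm

/-! ### The argument of the plethystic exponential -/

open Classical in
/-- The power series with coefficients `± e₀` at the exponents `e` whose entries differ by at most
one, and `4 e₀` at the constant exponents. -/
def plethysticArgument : MvPowerSeries (Fin 4) ℤ := fun e =>
  if ∀ i j, e i ≤ e j + 1 then (if ∀ i j, e i = e j then 4 else 1) * (-1) ^ e.degree * e 0 else 0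

theorem degree_nearConstant (m : ℕ) (T : Finset (Fin 4)) :
    (nearConstant m T).degree = 4 * m + T.card := by
  simp [Finsupp.degree_eq_sum, nearConstant_apply, Finset.sum_add_distrib]

theorem coeff_plethysticArgument_nearConstant (m : ℕ) {T : Finset (Fin 4)}
    (hT : T ≠ Finset.univ) : MvPowerSeries.coeff (nearConstant m T) plethysticArgument =
      (if T = ∅ then 4 else 1) * (-1) ^ T.card * nearConstant m T 0 := by
  classical
  change (if _ then _ else _) = _
  rw [if_pos]
  · congr 2
    · refine if_congr ?_ rfl rfl
      constructor
      · intro h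
        by_contra hne
        obtain ⟨i, hi⟩ := Finset.nonempty_iff_ne_empty.mpr hne
        refine hT (Finset.eq_univ_of_forall fun j => ?_)
        by_contra hj
        have := h i j
        simp [nearConstant_apply, hi, hj] at this
      · rintro rfl i j
        simp [nearConstant_apply]
    · rw [degree_nearConstant, pow_add, pow_mul]
      norm_num
  · intro i j
    simp only [nearConstant_apply]
    split_ifs <;> omega

/-- Take for `m` the least entry and for `T` the places where it is exceeded; `T` is proper because
the minimum is attained. -/
theorem exists_eq_nearConstant {e : Fin 4 →₀ ℕ}
    (h : MvPowerSeries.coeff e plethysticArgument ≠ 0) :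
    ∃ m T, T ≠ Finset.univ ∧ e = nearConstant m T := by
  classical
  have h1 : ∀ i j, e i ≤ e j + 1 := by
    by_contra hne
    exact h (if_neg hne)
  obtain ⟨i₀, -, hmin⟩ := Finset.exists_min_image Finset.univ e ⟨0, Finset.mem_univ 0⟩
  refine ⟨e i₀, Finset.univ.filter fun i => e i ≠ e i₀, ?_, ?_⟩
  · intro heq
    have := Finset.mem_univ i₀
    rw [← heq] at this
    simp at this
  · ext i
    have := hmin i (Finset.mem_univ i)
    have := h1 i i₀
    simp only [nearConstant_apply, Finset.mem_filter, Finset.mem_univ, true_and]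
    split_ifs <;> omega

theorem nearConstant_inj {ι : Type*} [Fintype ι] {m m' : ℕ} {T T' : Finset ι}
    (hT : T ≠ Finset.univ) (hT' : T' ≠ Finset.univ) (h : nearConstant m T = nearConstant m' T') :
    m = m' ∧ T = T' := by
  classical
  have h1 : ∀ i, (m + if i ∈ T then 1 else 0) = m' + if i ∈ T' then 1 else 0 := fun i => by
    rw [← nearConstant_apply, ← nearConstant_apply, h]
  obtain ⟨i, hi⟩ : ∃ i, i ∉ T := by
    by_contra hne; push Not at hne; exact hT (Finset.eq_univ_of_forall hne)
  obtain ⟨j, hj⟩ : ∃ i, i ∉ T' := by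
    by_contra hne; push Not at hne; exact hT' (Finset.eq_univ_of_forall hne)
  have hi' := h1 i
  have hj' := h1 j
  rw [if_neg hi] at hi'
  rw [if_neg hj] at hj'
  have hm : m = m' := by omega
  refine ⟨hm, ?_⟩
  ext k
  have := h1 k
  by_cases hk : k ∈ T <;> by_cases hk' : k ∈ T' <;> simp [hk, hk'] at this ⊢ <;> omega

/-- Power series with natural coefficients as power series with integer coefficients. -/
abbrev toIntSeries {ι : Type*} : MvPowerSeries ι ℕ →+* MvPowerSeries ι ℤ :=
  MvPowerSeries.map (Nat.castRingHom ℤ)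

theorem toIntSeries_monomial {ι : Type*} (e : ι →₀ ℕ) :
    toIntSeries (MvPowerSeries.monomial e 1) = MvPowerSeries.monomial e 1 := by
  rw [toIntSeries, MvPowerSeries.map_monomial, map_one]

theorem one_sub_mul_toIntSeries_geometricSeries {ι : Type*} {e : ι →₀ ℕ} (he : e ≠ 0) :
    (1 - MvPowerSeries.monomial e 1) * toIntSeries (geometricSeries e) = 1 := by
  have := congrArg toIntSeries (geometricSeries_eq he)
  rw [map_add, map_mul, toIntSeries_monomial, map_one] at this
  linear_combination this

theorem one_sub_monomial_mul_invOfUnit {ι : Type*} {e : ι →₀ ℕ} (he : e ≠ 0) :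
    (1 - MvPowerSeries.monomial e (1 : ℤ)) *
      MvPowerSeries.invOfUnit (1 - MvPowerSeries.monomial e 1) 1 = 1 := by
  classical
  refine MvPowerSeries.mul_invOfUnit _ 1 ?_
  rw [map_sub, ← MvPowerSeries.coeff_zero_eq_constantCoeff_apply (MvPowerSeries.monomial e 1),
    MvPowerSeries.coeff_monomial]
  simp [he.symm]

theorem toIntSeries_geometricSeries {ι : Type*} {e : ι →₀ ℕ} (he : e ≠ 0) :
    toIntSeries (geometricSeries e) =
      MvPowerSeries.invOfUnit (1 - MvPowerSeries.monomial e 1) 1 := by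
  have h1 := one_sub_mul_toIntSeries_geometricSeries he
  have h2 := one_sub_monomial_mul_invOfUnit he
  calc toIntSeries (geometricSeries e) = toIntSeries (geometricSeries e) *
        ((1 - MvPowerSeries.monomial e (1 : ℤ)) *
          MvPowerSeries.invOfUnit (1 - MvPowerSeries.monomial e 1) 1) := by rw [h2, mul_one]
    _ = ((1 - MvPowerSeries.monomial e 1) * toIntSeries (geometricSeries e)) *
          MvPowerSeries.invOfUnit (1 - MvPowerSeries.monomial e 1) 1 := by ring
    _ = _ := by rw [h1, one_mul]

theorem nearConstant_ne_zero {ι : Type*} [Finite ι] (m : ℕ) {T : Finset ι} (hT : T.Nonempty) :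
    nearConstant m T ≠ 0 := fun h => by
  classical
  obtain ⟨c, hc⟩ := hT
  have := DFunLike.congr_fun h c
  simp [nearConstant_apply, hc] at this

theorem toIntSeries_formalFactor (m : ℕ) {T : Finset (Fin 4)} (hT : T.Nonempty)
    (hT' : T ≠ Finset.univ) : toIntSeries (formalFactor m T) =
      twistedFactor plethysticArgument (nearConstant m T) := by
  rw [formalFactor, map_pow, twistedFactor, coeff_plethysticArgument_nearConstant m hT',
    if_neg hT.ne_empty, one_mul]
  by_cases h : Even T.card
  · rw [if_pos h, h.neg_one_pow, one_mul, if_pos (by positivity), Int.toNat_natCast,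
      toIntSeries_geometricSeries (nearConstant_ne_zero m hT)]
  · rw [if_neg h, (Nat.not_even_iff_odd.mp h).neg_one_pow, map_add, map_one, toIntSeries_monomial]
    generalize nearConstant m T 0 = n
    rcases n with _ | n
    · simp
    · rw [if_neg (by push_cast; omega)]
      congr 1
      simp only [neg_mul, one_mul, neg_neg]
      rfl

/-! ### Power series without coefficients of positive weight -/

section Weight

variable {ι : Type*} (θ : (ι →₀ ℕ) → ℤ) (d : ℕ)

/-- The coefficients of degree at most `d` and of positive weight vanish. -/
def NoPositive (f : MvPowerSeries ι ℤ) : Prop :=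
  ∀ e : ι →₀ ℕ, e.degree ≤ d → 0 < θ e → MvPowerSeries.coeff e f = 0

variable {θ d}

theorem NoPositive.mul (hθ : ∀ a b, θ (a + b) = θ a + θ b) {f g : MvPowerSeries ι ℤ}
    (hf : NoPositive θ d f) (hg : NoPositive θ d g) : NoPositive θ d (f * g) := by
  classical
  intro e he hpos
  rw [MvPowerSeries.coeff_mul]
  refine Finset.sum_eq_zero fun p hp => ?_
  have hp := Finset.HasAntidiagonal.mem_antidiagonal.mp hp
  rw [← hp, hθ] at hpos
  rw [← hp, map_add] at he
  rcases lt_or_ge 0 (θ p.1) with h | h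
  · rw [hf _ (by omega) h, zero_mul]
  · rw [hg _ (by omega) (by omega), mul_zero]

/-- Induction on the degree: in the coefficient of `f * g` at an exponent of positive weight, every
term but the leading one has a factor of positive weight, which vanishes by induction or by the
hypothesis on `g`. -/
theorem NoPositive.of_mul (hθ : ∀ a b, θ (a + b) = θ a + θ b) {f g : MvPowerSeries ι ℤ}
    (hfg : NoPositive θ d (f * g)) (hg : NoPositive θ d g)
    (hg1 : MvPowerSeries.constantCoeff g = 1) : NoPositive θ d f := by
  classical
  have key : ∀ N, ∀ e : ι →₀ ℕ, e.degree = N → e.degree ≤ d → 0 < θ e →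
      MvPowerSeries.coeff e f = 0 := by
    intro N
    induction N using Nat.strong_induction_on with
    | _ N ih =>
      intro e heN he hpos
      have h1 := hfg e he hpos
      rw [MvPowerSeries.coeff_mul, Finset.sum_eq_single (e, 0)] at h1
      · simpa [hg1] using h1
      · intro p hp hne
        have hp := Finset.HasAntidiagonal.mem_antidiagonal.mp hp
        have hp2 : p.2 ≠ 0 := fun h0 => hne (Prod.ext (by simpa [h0] using hp) h0)
        have hdeg := congrArg Finsupp.degree hp
        rw [map_add] at hdeg
        have hdeg2 : p.2.degree ≠ 0 := fun h => hp2 ((Finsupp.degree_eq_zero_iff _).mp h)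
        rw [← hp, hθ] at hpos
        rcases lt_or_ge 0 (θ p.1) with h | h
        · rw [ih p.1.degree (by omega) _ rfl (by omega) h, zero_mul]
        · rw [hg _ (by omega) (by omega), mul_zero]
      · intro h
        exact absurd (Finset.HasAntidiagonal.mem_antidiagonal.mpr (add_zero e)) h
  exact fun e he hpos => key _ e rfl he hpos

theorem NoPositive.one (h0 : θ 0 = 0) : NoPositive θ d 1 := by
  classical
  intro e _ hpos
  rw [MvPowerSeries.coeff_one, if_neg]
  rintro rfl
  omega

theorem NoPositive.pow (hθ : ∀ a b, θ (a + b) = θ a + θ b) (h0 : θ 0 = 0) {f : MvPowerSeries ι ℤ}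
    (hf : NoPositive θ d f) (n : ℕ) : NoPositive θ d (f ^ n) := by
  induction n with
  | zero => simpa using NoPositive.one h0
  | succ n ih => rw [pow_succ]; exact ih.mul hθ hf

theorem constantCoeff_twistedFactor (F : MvPowerSeries ι ℤ) {e : ι →₀ ℕ} (he : e ≠ 0) :
    MvPowerSeries.constantCoeff (twistedFactor F e) = 1 := by
  classical
  obtain ⟨g, hg⟩ := monomial_dvd_twistedFactor_sub_one F e he
  have h1 : MvPowerSeries.constantCoeff (MvPowerSeries.monomial e (1 : ℤ)) = 0 := by
    rw [← MvPowerSeries.coeff_zero_eq_constantCoeff_apply, MvPowerSeries.coeff_monomial,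
      if_neg he.symm]
  have := congrArg MvPowerSeries.constantCoeff hg
  rwa [map_sub, map_mul, h1, zero_mul, map_one, sub_eq_zero] at this

theorem NoPositive.monomial {e : ι →₀ ℕ} (he : θ e ≤ 0) (c : ℤ) :
    NoPositive θ d (MvPowerSeries.monomial e c) := by
  classical
  intro n _ hpos
  rw [MvPowerSeries.coeff_monomial, if_neg]
  rintro rfl
  omega

theorem NoPositive.twistedFactor (hθ : ∀ a b, θ (a + b) = θ a + θ b) (h0 : θ 0 = 0)
    (F : MvPowerSeries ι ℤ) {e : ι →₀ ℕ} (he0 : e ≠ 0) (he : θ e ≤ 0) :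
    NoPositive θ d (twistedFactor F e) := by
  unfold _root_.twistedFactor
  have h1 : NoPositive θ d (1 : MvPowerSeries ι ℤ) := NoPositive.one h0
  have hm : NoPositive θ d (MvPowerSeries.monomial e (1 : ℤ)) := NoPositive.monomial he 1
  split_ifs
  · refine NoPositive.pow hθ h0 ?_ _
    have h2 := one_sub_monomial_mul_invOfUnit he0
    refine NoPositive.of_mul hθ (g := 1 - MvPowerSeries.monomial e 1) ?_ ?_ ?_
    · rw [mul_comm, h2]; exact h1
    · intro n hn hpos
      rw [map_sub, h1 n hn hpos, hm n hn hpos, sub_zero]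
    · classical
      rw [map_sub, map_one, ← MvPowerSeries.coeff_zero_eq_constantCoeff_apply,
        MvPowerSeries.coeff_monomial, if_neg he0.symm, sub_zero]
  · refine NoPositive.pow hθ h0 ?_ _
    intro n hn hpos
    rw [map_add, h1 n hn hpos, hm n hn hpos, add_zero]

end Weight

end

/-! ### The quotient of the generating function by the plethystic exponential -/

/-- The parity types, up to the pairs, that contribute to the double flips. -/
def flipTypes (s : ℕ) : Finset (Finset (Fin 4)) :=
  if s = 0 then {{1}, {2}, {0, 1, 2}, {3, 1, 2}} else {{0}, {3}, {1, 0, 3}, {2, 0, 3}}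

/-- The pair of parity types whose level has the parity of `s`. -/
def flipPair (s : ℕ) : Finset (Fin 4) := if s = 0 then {1, 2} else {0, 3}

/-- The index set of the product of the first `K` double flips. -/
def flipIndex (s K : ℕ) : Finset (ℕ × Finset (Fin 4)) :=
  Finset.range K ×ˢ flipTypes s ∪ Finset.range (2 * K) ×ˢ {flipPair s}

theorem prod_doubleFactor (π : Equiv.Perm (Fin 4)) {s : ℕ} (hs : s < 2) (K : ℕ) :
    ∏ k ∈ Finset.range K, doubleFactor π s k =
      ∏ x ∈ flipIndex s K, formalFactor x.1 (x.2.map π.toEmbedding) := by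
  have hdisj : Disjoint (Finset.range K ×ˢ flipTypes s) (Finset.range (2 * K) ×ˢ {flipPair s}) := by
    rw [Finset.disjoint_product]
    right
    interval_cases s <;> decide
  rw [flipIndex, Finset.prod_union hdisj, Finset.prod_product, Finset.prod_product]
  simp only [Finset.prod_singleton]
  interval_cases s
  · rw [prod_doubleFactor_zero]
    congr 1
    refine Finset.prod_congr rfl fun k _ => ?_
    rw [flipTypes, if_pos rfl, Finset.prod_insert (by decide), Finset.prod_insert (by decide),
      Finset.prod_insert (by decide), Finset.prod_singleton, ← mul_assoc, ← mul_assoc]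
  · rw [prod_doubleFactor_one]
    congr 1
    refine Finset.prod_congr rfl fun k _ => ?_
    rw [flipTypes, if_neg one_ne_zero, Finset.prod_insert (by decide),
      Finset.prod_insert (by decide), Finset.prod_insert (by decide), Finset.prod_singleton,
      ← mul_assoc, ← mul_assoc]

theorem mem_flipIndex {s : ℕ} (hs : s < 2) {K : ℕ} {x : ℕ × Finset (Fin 4)}
    (hx : x ∈ flipIndex s K) : x.2.Nonempty ∧ x.2 ≠ Finset.univ := by
  have h : x.2 ∈ flipTypes s ∨ x.2 = flipPair s := by
    rcases Finset.mem_union.mp hx with h | h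
    · exact Or.inl (Finset.mem_product.mp h).2
    · exact Or.inr (Finset.mem_singleton.mp (Finset.mem_product.mp h).2)
  generalize x.2 = T at h
  interval_cases s <;> revert T <;> decide

theorem imbalance_nearConstant_map (π : Equiv.Perm (Fin 4)) {s : ℕ} (hs : s < 2) (m : ℕ)
    (T : Finset (Fin 4)) :
    imbalance π s (fun i => (nearConstant m (T.map π.toEmbedding) i : ℤ)) =
      ∑ c, if cellParity c = s then (if c ∈ T then 1 else 0) else -(if c ∈ T then 1 else 0) := by
  have h : ∀ c, π c ∈ T.map π.toEmbedding ↔ c ∈ T := fun c => by simp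
  simp only [imbalance, nearConstant_apply, h, Fin.sum_univ_four]
  interval_cases s <;> simp [cellParity] <;> ring

/-- This shows that the double flips miss no factor of positive imbalance. -/
theorem mem_flipTypes_of_pos {s : ℕ} (hs : s < 2) {T : Finset (Fin 4)}
    (h : (0 : ℤ) < ∑ c, if cellParity c = s then (if c ∈ T then 1 else 0)
      else -(if c ∈ T then 1 else 0)) : T ∈ flipTypes s ∨ T = flipPair s := by
  interval_cases s <;> revert T <;> decide

theorem imbalance_add (π : Equiv.Perm (Fin 4)) (s : ℕ) (a b : Fin 4 →₀ ℕ) :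
    imbalance π s (fun i => ((a + b) i : ℤ)) =
      imbalance π s (fun i => a i) + imbalance π s fun i => b i := by
  simp only [imbalance, Finsupp.add_apply, Nat.cast_add, Fin.sum_univ_four]
  split_ifs <;> ring

theorem isUnit_of_constantCoeff_eq_one {ι : Type*} {f : MvPowerSeries ι ℤ}
    (h : MvPowerSeries.constantCoeff f = 1) : IsUnit f :=
  MvPowerSeries.isUnit_iff_constantCoeff.mpr (by simp [h])

/-- Split the plethystic exponential, up to degree `d`, into the factors `X` of the double flips and
the rest `Q`. Cancelling `X` gives `Y * Q ≡ H`, where `H` has no positive imbalance in low degree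
and `Q` has none because its exponents have none. Dividing by `Q` preserves this. -/
theorem noPositive_quotient {π : Equiv.Perm (Fin 4)} (hπ : π 0 = 0) {s : ℕ} (hs : s < 2)
    {Y : MvPowerSeries (Fin 4) ℤ}
    (hY : Y * twistedPExp plethysticArgument = toIntSeries (heightSeries π)) (d : ℕ) :
    NoPositive (fun e => imbalance π s fun i => (e i : ℤ)) d Y := by
  classical
  -- Large enough that the double flips contain all factors of positive imbalance of degree at most
  -- `d`, and that `4 * K > d`.
  set K := d + 1
  obtain ⟨H, hH, hHpos⟩ := exists_heightSeries_eq_mul hπ hs K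
  set φ : ℕ × Finset (Fin 4) → Fin 4 →₀ ℕ := fun x => nearConstant x.1 (x.2.map π.toEmbedding)
    with hφ
  have hmapuniv : ∀ T : Finset (Fin 4), T ≠ Finset.univ → T.map π.toEmbedding ≠ Finset.univ := by
    intro T hT h
    apply hT
    rw [← Finset.card_eq_iff_eq_univ] at h ⊢
    rwa [Finset.card_map] at h
  set S₁ := (flipIndex s K).image φ with hS₁
  set S₂ := (Finsupp.finite_of_degree_le (σ := Fin 4) d).toFinset.filter fun e =>
    e ≠ 0 ∧ MvPowerSeries.coeff e plethysticArgument ≠ 0 ∧ e ∉ S₁ with hS₂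
  have hdisj : Disjoint S₁ S₂ := by
    rw [Finset.disjoint_left]
    intro e h1 h2
    exact (Finset.mem_filter.mp h2).2.2.2 h1
  have hS₁0 : ∀ e ∈ S₁, e ≠ 0 := by
    intro e he
    obtain ⟨x, hx, rfl⟩ := Finset.mem_image.mp he
    exact nearConstant_ne_zero _ (Finset.map_nonempty.mpr (mem_flipIndex hs hx).1)
  have hS₂0 : ∀ e ∈ S₂, e ≠ 0 := fun e he => (Finset.mem_filter.mp he).2.1
  have hP := congrUpTo_twistedPExp plethysticArgument d (S₁ ∪ S₂)
    (fun h => by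
      rcases Finset.mem_union.mp h with h | h
      · exact hS₁0 _ h rfl
      · exact hS₂0 _ h rfl)
    (fun e he0 heS hed => by
      by_contra hne
      rw [Finset.mem_union, not_or] at heS
      exact heS.2 (Finset.mem_filter.mpr ⟨by simpa using hed, he0, hne, heS.1⟩))
  have hX : toIntSeries (∏ k ∈ Finset.range K, doubleFactor π s k) =
      ∏ e ∈ S₁, twistedFactor plethysticArgument e := by
    rw [prod_doubleFactor π hs, map_prod, hS₁, Finset.prod_image]
    · refine Finset.prod_congr rfl fun x hx => ?_
      obtain ⟨h1, h2⟩ := mem_flipIndex hs hx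
      exact toIntSeries_formalFactor _ (Finset.map_nonempty.mpr h1) (hmapuniv _ h2)
    · intro x hx y hy hxy
      obtain ⟨h1, h2⟩ := nearConstant_inj (hmapuniv _ (mem_flipIndex hs hx).2)
        (hmapuniv _ (mem_flipIndex hs hy).2) hxy
      exact Prod.ext h1 (Finset.map_injective _ h2)
  set X := toIntSeries (∏ k ∈ Finset.range K, doubleFactor π s k) with hXdef
  set Q := ∏ e ∈ S₂, twistedFactor plethysticArgument e with hQdef
  rw [Finset.prod_union hdisj, ← hX] at hP
  have hXu : IsUnit X := by
    refine isUnit_of_constantCoeff_eq_one ?_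
    rw [hX, map_prod]
    exact Finset.prod_eq_one fun e he => constantCoeff_twistedFactor _ (hS₁0 e he)
  have hcongr : CongrUpTo d (Y * Q) (toIntSeries H) := by
    refine CongrUpTo.of_mul_left hXu ?_
    have h1 := (CongrUpTo.refl d Y).mul hP
    rw [hY, hH, map_mul] at h1
    have h2 : X * (Y * Q) = Y * (X * Q) := by ring
    rw [h2]
    exact h1.symm
  have hadd := imbalance_add π s
  have h0 : imbalance π s (fun i => ((0 : Fin 4 →₀ ℕ) i : ℤ)) = 0 := by simp [imbalance]
  refine NoPositive.of_mul hadd (g := Q) ?_ ?_ ?_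
  · intro e he hpos
    rw [hcongr e he]
    by_contra hne
    have h1 : MvPowerSeries.coeff e H ≠ 0 := by
      intro h
      apply hne
      rw [MvPowerSeries.coeff_map, h, map_zero]
    have := hHpos e h1 hpos
    omega
  · have : ∀ S ⊆ S₂, NoPositive (fun e => imbalance π s fun i => (e i : ℤ)) d
        (∏ e ∈ S, twistedFactor plethysticArgument e) := by
      intro S
      induction S using Finset.induction_on with
      | empty => intro _; simpa using NoPositive.one h0
      | insert e S he ih =>
        intro hsub
        rw [Finset.prod_insert he]
        refine NoPositive.mul hadd ?_ (ih fun x hx => hsub (Finset.mem_insert_of_mem hx))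
        have hmem := hsub (Finset.mem_insert_self e S)
        refine NoPositive.twistedFactor hadd h0 _ (hS₂0 e hmem) ?_
        obtain ⟨hdeg, -, hne, hnot⟩ := Finset.mem_filter.mp hmem
        by_contra hpos
        push Not at hpos
        apply hnot
        obtain ⟨m, T, hT, rfl⟩ := exists_eq_nearConstant hne
        obtain ⟨T, rfl⟩ : ∃ T', T = T'.map π.toEmbedding :=
          ⟨T.map π.symm.toEmbedding, by
            ext x
            simp only [Finset.mem_map_equiv, Equiv.symm_symm, Equiv.apply_symm_apply]⟩
        have hdeg' : (nearConstant m (T.map π.toEmbedding)).degree ≤ d := by simpa using hdeg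
        rw [degree_nearConstant] at hdeg'
        refine Finset.mem_image.mpr ⟨(m, T), ?_, rfl⟩
        rw [imbalance_nearConstant_map π hs] at hpos
        rw [flipIndex, Finset.mem_union, Finset.mem_product, Finset.mem_product, Finset.mem_range,
          Finset.mem_range, Finset.mem_singleton]
        rcases mem_flipTypes_of_pos hs hpos with h | h
        · exact Or.inl ⟨by simp only; omega, h⟩
        · exact Or.inr ⟨by simp only; omega, h⟩
    exact this S₂ subset_rfl
  · rw [hQdef, map_prod]
    exact Finset.prod_eq_one fun e he => constantCoeff_twistedFactor _ (hS₂0 e he)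

/-- The imbalances for `s = 0` and `s = 1` are opposite and both nonpositive, hence zero: `e 0 + e
c` is half of the total. As this holds for the three nonzero `c`, all entries agree. -/
theorem eq_of_coeff_quotient_ne_zero {Y Z : MvPowerSeries (Fin 4) ℤ}
    (hY : Y * twistedPExp plethysticArgument = Z)
    (hZ : ∀ c : Fin 4, c ≠ 0 → ∃ π : Equiv.Perm (Fin 4), π 0 = 0 ∧ π 3 = c ∧
      Z = toIntSeries (heightSeries π))
    {e : Fin 4 →₀ ℕ} (he : MvPowerSeries.coeff e Y ≠ 0) (i j : Fin 4) : e i = e j := by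
  have key : ∀ c : Fin 4, c ≠ 0 → (∑ i, (e i : ℤ)) = 2 * (e 0 + e c) := by
    intro c hc
    obtain ⟨π, hπ, hπc, hZπ⟩ := hZ c hc
    rw [hZπ] at hY
    have h0 := noPositive_quotient hπ zero_lt_two hY e.degree e le_rfl
    have h1 := noPositive_quotient hπ one_lt_two hY e.degree e le_rfl
    have h0 : imbalance π 0 (fun i => (e i : ℤ)) ≤ 0 := by
      by_contra h; exact he (h0 (by simpa using h))
    have h1 : imbalance π 1 (fun i => (e i : ℤ)) ≤ 0 := by
      by_contra h; exact he (h1 (by simpa using h))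
    rw [← Equiv.sum_comp π]
    simp only [imbalance, Fin.sum_univ_four, hπ, hπc] at h0 h1 ⊢
    simp [cellParity] at h0 h1
    omega
  have h1 := key 1 (by decide)
  have h2 := key 2 (by decide)
  have h3 := key 3 (by decide)
  rw [Fin.sum_univ_four] at h1 h2 h3
  have : ∀ i, e i = e 0 := by
    intro i
    fin_cases i
    · rfl
    · change e 1 = e 0; omega
    · change e 2 = e 0; omega
    · change e 3 = e 0; omega
  rw [this i, this j]

/-! ### Specialisation to a single variable -/

/-- The specialisation of all variables to a single one. -/
abbrev specialize : MvPowerSeries (Fin 4) ℤ →ₐ[ℤ] MvPowerSeries Unit ℤ :=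
  MvPowerSeries.rename fun _ => ()

theorem CongrUpTo.specialize {d : ℕ} {f g : MvPowerSeries (Fin 4) ℤ} (h : CongrUpTo d f g) :
    CongrUpTo d (specialize f) (specialize g) := by
  intro x hx
  rw [MvPowerSeries.coeff_rename, MvPowerSeries.coeff_rename]
  refine Finset.sum_congr rfl fun e he => h e ?_
  have he : e.mapDomain (fun _ => ()) = x := by simpa using he
  rwa [← he, Finsupp.degree_mapDomain] at hx

theorem rename_countSeries {C σ τ : Type*} (f : σ → τ)
    [Filter.TendstoCofinite f] (e : C → σ →₀ ℕ)
    (hfin : ∀ n, Finite {c // e c = n}) : MvPowerSeries.rename f (countSeries e) =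
      countSeries fun c => (e c).mapDomain f := by
  classical
  ext x
  rw [MvPowerSeries.coeff_rename, coeff_countSeries]
  set S := (Filter.TendstoCofinite.finite_preimage_singleton (Finsupp.mapDomain f) x).toFinset
  have hS : ∀ n : σ →₀ ℕ, n ∈ S ↔ n.mapDomain f = x := fun n => by simp [S]
  have E : {c // (e c).mapDomain f = x} ≃ Σ n : S, {c // e c = n.1} :=
    { toFun := fun c => ⟨⟨e c.1, (hS _).mpr c.2⟩, ⟨c.1, rfl⟩⟩
      invFun := fun p => ⟨p.2.1, by rw [p.2.2]; exact (hS _).mp p.1.2⟩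
      left_inv := fun c => rfl
      right_inv := by
        have key : ∀ (c : C) (n : σ →₀ ℕ) (h : e c = n) (hn : n ∈ S) (hn' : e c ∈ S),
            (⟨⟨e c, hn'⟩, ⟨c, rfl⟩⟩ : Σ n : S, {c // e c = n.1}) = ⟨⟨n, hn⟩, ⟨c, h⟩⟩ := by
          rintro c _ rfl _ _; rfl
        exact fun p => key _ _ p.2.2 p.1.2 _ }
  rw [Nat.card_congr E, Nat.card_sigma, ← Finset.sum_coe_sort S]
  rfl

theorem sum_cellCount (h : ℕ × ℕ →₀ ℕ) : ∑ c, cellCount h c = h.degree := by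
  simp only [cellCount]
  rw [Finset.sum_comm, Finsupp.degree_apply]
  refine Finset.sum_congr rfl fun p _ => ?_
  rw [← Finset.card_eq_sum_card_fiberwise (fun _ _ => Finset.mem_univ _), Finset.card_range]

theorem finite_cellExponent_eq (π : Equiv.Perm (Fin 4)) (n : Fin 4 →₀ ℕ) :
    Finite {h : {h : ℕ × ℕ →₀ ℕ // IsHeight 0 h} // cellExponent π h.1 = n} := by
  have hval : ∀ h : ℕ × ℕ →₀ ℕ, monomialValue (fun _ => (1 / 4 : ℝ≥0)) (cellExponent π h) =
      ∏ c : Fin 4, (1 / 4 : ℝ≥0) ^ cellCount h c := by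
    intro h
    rw [monomialValue, ← Equiv.prod_comp π fun i => (1 / 4 : ℝ≥0) ^ _]
    simp [cellExponent]
  refine (evalENNReal_countSeries (r := fun _ => 1 / 4) _ (fun _ => by norm_num) ?_).2 n
  simp_rw [hval]
  rw [← cellSum_eq_tsum 0 fun _ => 1 / 4]
  exact heightSum_ne_top fun _ _ => le_rfl

theorem specialize_heightSeries (π : Equiv.Perm (Fin 4)) :
    specialize (toIntSeries (heightSeries π)) = toIntSeries boxSeries := by
  rw [specialize, toIntSeries, MvPowerSeries.rename_map]
  congr 1
  rw [heightSeries, rename_countSeries _ _ (finite_cellExponent_eq π), boxSeries]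
  congr 1
  funext h
  ext
  have h1 : (Finsupp.mapDomain (fun _ => ()) (cellExponent π h.1)).degree = h.1.degree := by
    rw [Finsupp.degree_mapDomain, ← sum_cellCount, Finsupp.degree_eq_sum, ← Equiv.sum_comp π]
    simp [cellExponent]
  rw [Finsupp.degree_eq_sum] at h1
  simpa using h1

/-- The powers of the single variable. -/
def qPow (N : ℕ) : MvPowerSeries Unit ℤ := MvPowerSeries.monomial (Finsupp.single () N) 1

/-- The series `1 / (1 - q ^ N)`. -/
def qGeom (N : ℕ) : MvPowerSeries Unit ℤ := toIntSeries (geometricSeries (Finsupp.single () N))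

theorem one_sub_qPow_mul_qGeom {N : ℕ} (hN : N ≠ 0) : (1 - qPow N) * qGeom N = 1 :=
  one_sub_mul_toIntSeries_geometricSeries (by simpa using hN)

theorem one_add_qPow {N : ℕ} (hN : N ≠ 0) : 1 + qPow N = (1 - qPow (2 * N)) * qGeom N := by
  have h1 : qPow (2 * N) = qPow N * qPow N := by
    rw [qPow, qPow, MvPowerSeries.monomial_mul_monomial, ← Finsupp.single_add, two_mul, one_mul]
  have h2 := one_sub_qPow_mul_qGeom hN
  rw [h1]
  linear_combination (-1 - qPow N) * h2

theorem congrUpTo_one_sub_qPow {d N : ℕ} (h : d < N) : CongrUpTo d (1 - qPow N) 1 :=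
  CongrUpTo.of_monomial_dvd (e := Finsupp.single () N) (by simpa using h)
    ⟨-1, by rw [qPow]; ring⟩

theorem specialize_monomial (e : Fin 4 →₀ ℕ) :
    specialize (MvPowerSeries.monomial e 1) = qPow e.degree := by
  rw [specialize, MvPowerSeries.rename_monomial, qPow]
  congr 2
  ext
  have h1 : (Finsupp.mapDomain (fun _ => ()) e).degree = e.degree :=
    Finsupp.degree_mapDomain (fun _ => ()) e
  rw [Finsupp.degree_eq_sum] at h1
  simpa using h1

theorem specialize_invOfUnit {e : Fin 4 →₀ ℕ} (he : e ≠ 0) :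
    specialize (MvPowerSeries.invOfUnit (1 - MvPowerSeries.monomial e 1) 1) = qGeom e.degree := by
  have h1 := congrArg specialize (one_sub_monomial_mul_invOfUnit he)
  rw [map_mul, map_sub, map_one, specialize_monomial] at h1
  have h2 := one_sub_qPow_mul_qGeom (N := e.degree) (by simpa [Finsupp.degree_eq_zero_iff] using he)
  calc _ = specialize (MvPowerSeries.invOfUnit (1 - MvPowerSeries.monomial e 1) 1) *
        ((1 - qPow e.degree) * qGeom e.degree) := by rw [h2, mul_one]
    _ = ((1 - qPow e.degree) * specialize (MvPowerSeries.invOfUnit (1 - MvPowerSeries.monomial e 1) 1)) *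
        qGeom e.degree := by ring
    _ = _ := by rw [h1, one_mul]

theorem specialize_twistedFactor_of_even {m : ℕ} {T : Finset (Fin 4)} (hT : T ≠ Finset.univ)
    (h0 : nearConstant m T ≠ 0) (h : Even T.card) {c n : ℕ} (hc : (if T = ∅ then 4 else 1) = c)
    (hn : (if 0 ∈ T then 1 else 0) = n) :
    specialize (twistedFactor plethysticArgument (nearConstant m T)) =
      qGeom (4 * m + T.card) ^ (c * (m + n)) := by
  rw [twistedFactor, coeff_plethysticArgument_nearConstant m hT, h.neg_one_pow, mul_one,
    if_pos (by positivity), map_pow, specialize_invOfUnit h0, degree_nearConstant,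
    nearConstant_apply, hn]
  congr 1
  rw [← hc]
  split_ifs <;> simp <;> omega

theorem specialize_twistedFactor_of_odd {m : ℕ} {T : Finset (Fin 4)} (hT : T ≠ Finset.univ)
    (h : ¬ Even T.card) {n : ℕ} (hn : (if 0 ∈ T then 1 else 0) = n) :
    specialize (twistedFactor plethysticArgument (nearConstant m T)) =
      (1 + qPow (4 * m + T.card)) ^ (m + n) := by
  have hne : T.Nonempty := by
    rw [Finset.nonempty_iff_ne_empty]; rintro rfl; exact h (by simp)
  rw [← toIntSeries_formalFactor m hne hT, formalFactor, if_neg h, map_pow, map_pow, map_add,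
    map_add, toIntSeries_monomial, map_one, map_one, specialize_monomial, degree_nearConstant,
    nearConstant_apply, hn]

/-- An index set for the exponents of the plethystic exponential. -/
def exponentIndex (m : ℕ) (T : Finset (Fin 4)) : Fin 4 →₀ ℕ :=
  nearConstant (if T = ∅ then m + 1 else m) T

theorem exponentIndex_ne_zero (m : ℕ) (T : Finset (Fin 4)) : exponentIndex m T ≠ 0 := by
  unfold exponentIndex
  split_ifs with h
  · intro h0
    have := DFunLike.congr_fun h0 0
    simp [nearConstant_apply] at this
  · exact nearConstant_ne_zero _ (Finset.nonempty_iff_ne_empty.mpr h)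

/-- Among the subsets of size `1`, `2`, `3` there are `1`, `3`, `3` containing `0`, which adds to
the multiplicities `4 m`, `6 m`, `4 m`. The empty set enters with exponent `m + 1` and coefficient
`4`. -/
theorem prod_specialize_twistedFactor (m : ℕ) :
    ∏ T ∈ Finset.univ.erase Finset.univ,
      specialize (twistedFactor plethysticArgument (exponentIndex m T)) =
      (1 + qPow (4 * m + 1)) ^ (4 * m + 1) * (1 + qPow (4 * m + 3)) ^ (4 * m + 3) *
        qGeom (4 * m + 2) ^ (6 * m + 3) * qGeom (4 * m + 4) ^ (4 * m + 4) := by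
  have hsets : (Finset.univ.erase Finset.univ : Finset (Finset (Fin 4))) =
      {∅, {0}, {1}, {2}, {3}, {0, 1}, {0, 2}, {0, 3}, {1, 2}, {1, 3}, {2, 3}, {0, 1, 2}, {0, 1, 3},
        {0, 2, 3}, {1, 2, 3}} := by decide
  have he : ∀ T : Finset (Fin 4), T ≠ ∅ → exponentIndex m T = nearConstant m T := fun T hT => by
    rw [exponentIndex, if_neg hT]
  have h0 : specialize (twistedFactor plethysticArgument (exponentIndex m ∅)) =
      qGeom (4 * m + 4) ^ (4 * m + 4) := by
    have := exponentIndex_ne_zero m ∅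
    rw [exponentIndex, if_pos rfl] at this ⊢
    rw [specialize_twistedFactor_of_even (by decide) this (by decide) (c := 4) (by decide)
      (n := 0) (by decide)]
    rfl
  have h1 : ∀ (T : Finset (Fin 4)) (n : ℕ), (if 0 ∈ T then 1 else 0) = n → T.card = 1 →
      specialize (twistedFactor plethysticArgument (exponentIndex m T)) =
        (1 + qPow (4 * m + 1)) ^ (m + n) := by
    intro T n hn hT
    have hne : T ≠ ∅ := by rintro rfl; simp at hT
    have hnu : T ≠ Finset.univ := by rintro rfl; simp at hT
    rw [he T hne, specialize_twistedFactor_of_odd hnu (by rw [hT]; decide) hn, hT]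
  have h2 : ∀ (T : Finset (Fin 4)) (n : ℕ), (if 0 ∈ T then 1 else 0) = n → T.card = 2 →
      specialize (twistedFactor plethysticArgument (exponentIndex m T)) =
        qGeom (4 * m + 2) ^ (m + n) := by
    intro T n hn hT
    have hne : T ≠ ∅ := by rintro rfl; simp at hT
    have hnu : T ≠ Finset.univ := by rintro rfl; simp at hT
    rw [he T hne, specialize_twistedFactor_of_even hnu (he T hne ▸ exponentIndex_ne_zero m T)
      (by rw [hT]; decide) (if_neg hne) hn, hT, one_mul]
  have h3 : ∀ (T : Finset (Fin 4)) (n : ℕ), (if 0 ∈ T then 1 else 0) = n → T.card = 3 →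
      specialize (twistedFactor plethysticArgument (exponentIndex m T)) =
        (1 + qPow (4 * m + 3)) ^ (m + n) := by
    intro T n hn hT
    have hne : T ≠ ∅ := by rintro rfl; simp at hT
    have hnu : T ≠ Finset.univ := by rintro rfl; simp at hT
    rw [he T hne, specialize_twistedFactor_of_odd hnu (by rw [hT]; decide) hn, hT]
  rw [hsets, Finset.prod_insert (by decide), Finset.prod_insert (by decide),
    Finset.prod_insert (by decide), Finset.prod_insert (by decide), Finset.prod_insert (by decide),
    Finset.prod_insert (by decide), Finset.prod_insert (by decide), Finset.prod_insert (by decide),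
    Finset.prod_insert (by decide), Finset.prod_insert (by decide), Finset.prod_insert (by decide),
    Finset.prod_insert (by decide), Finset.prod_insert (by decide), Finset.prod_insert (by decide),
    Finset.prod_singleton, h0, h1 {0} 1 (by decide) (by decide), h1 {1} 0 (by decide) (by decide),
    h1 {2} 0 (by decide) (by decide), h1 {3} 0 (by decide) (by decide),
    h2 {0, 1} 1 (by decide) (by decide), h2 {0, 2} 1 (by decide) (by decide),
    h2 {0, 3} 1 (by decide) (by decide), h2 {1, 2} 0 (by decide) (by decide),
    h2 {1, 3} 0 (by decide) (by decide), h2 {2, 3} 0 (by decide) (by decide),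
    h3 {0, 1, 2} 1 (by decide) (by decide), h3 {0, 1, 3} 1 (by decide) (by decide),
    h3 {0, 2, 3} 1 (by decide) (by decide), h3 {1, 2, 3} 0 (by decide) (by decide)]
  generalize 1 + qPow (4 * m + 1) = x
  generalize 1 + qPow (4 * m + 3) = y
  generalize qGeom (4 * m + 2) = z
  generalize qGeom (4 * m + 4) = w
  ring

/-- Write `1 + q ^ N` as `(1 - q ^ (2 * N)) / (1 - q ^ N)` for odd `N`. The numerators reduce the
multiplicity `6 m + 3` at `4 m + 2` to the `4 m + 2` of MacMahon's product. In the truncation,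
numerators reach twice as far as the denominators, whence the ranges `K` and `2 * K`. -/
theorem prod_prod_specialize_twistedFactor (K : ℕ) :
    (∏ m ∈ Finset.range K, ∏ T ∈ Finset.univ.erase Finset.univ,
      specialize (twistedFactor plethysticArgument (exponentIndex m T))) *
      ∏ m ∈ Finset.range K, (1 - qPow (4 * m + 2)) ^ (2 * m + 1) =
    (∏ n ∈ Finset.range (4 * K), qGeom (n + 1) ^ (n + 1)) *
      ∏ m ∈ Finset.range (2 * K), (1 - qPow (4 * m + 2)) ^ (2 * m + 1) := by
  induction K with
  | zero => simp
  | succ K ih =>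
    rw [Finset.prod_range_succ, Finset.prod_range_succ, prod_specialize_twistedFactor,
      one_add_qPow (by omega), one_add_qPow (by omega), mul_mul_mul_comm, ih,
      show 4 * (K + 1) = 4 * K + 1 + 1 + 1 + 1 by ring, show 2 * (K + 1) = 2 * K + 1 + 1 by ring,
      Finset.prod_range_succ _ (4 * K + 1 + 1 + 1), Finset.prod_range_succ _ (4 * K + 1 + 1),
      Finset.prod_range_succ _ (4 * K + 1), Finset.prod_range_succ _ (4 * K),
      Finset.prod_range_succ _ (2 * K + 1), Finset.prod_range_succ _ (2 * K),
      show 4 * (2 * K) + 2 = 2 * (4 * K + 1) by ring,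
      show 4 * (2 * K + 1) + 2 = 2 * (4 * K + 3) by ring,
      show 2 * (2 * K) + 1 = 4 * K + 1 by ring, show 2 * (2 * K + 1) + 1 = 4 * K + 3 by ring]
    have h1 : qGeom (4 * K + 2) ^ (6 * K + 3) * (1 - qPow (4 * K + 2)) ^ (2 * K + 1) =
        qGeom (4 * K + 2) ^ (4 * K + 2) := by
      rw [show 6 * K + 3 = 4 * K + 2 + (2 * K + 1) by ring, pow_add, mul_assoc, ← mul_pow,
        mul_comm (qGeom _) (1 - _), one_sub_qPow_mul_qGeom (by omega), one_pow, mul_one]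
    rw [mul_pow, mul_pow]
    linear_combination ((∏ n ∈ Finset.range (4 * K), qGeom (n + 1) ^ (n + 1)) *
      (∏ m ∈ Finset.range (2 * K), (1 - qPow (4 * m + 2)) ^ (2 * m + 1)) *
      (1 - qPow (2 * (4 * K + 1))) ^ (4 * K + 1) * qGeom (4 * K + 1) ^ (4 * K + 1) *
      (1 - qPow (2 * (4 * K + 3))) ^ (4 * K + 3) * qGeom (4 * K + 3) ^ (4 * K + 3) *
      qGeom (4 * K + 4) ^ (4 * K + 4)) * h1

theorem constantCoeff_qGeom (N : ℕ) : MvPowerSeries.constantCoeff (qGeom N) = 1 := by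
  rw [qGeom, toIntSeries, MvPowerSeries.constantCoeff_map, constantCoeff_geometricSeries, map_one]

theorem isUnit_one_sub_qPow {N : ℕ} (hN : N ≠ 0) : IsUnit (1 - qPow N) :=
  IsUnit.of_mul_eq_one _ (one_sub_qPow_mul_qGeom hN)

theorem congrUpTo_specialize_twistedPExp {d K : ℕ} (hK : d < 4 * K) :
    CongrUpTo d (specialize (twistedPExp plethysticArgument))
      (∏ n ∈ Finset.range (4 * K), qGeom (n + 1) ^ (n + 1)) := by
  classical
  set I := Finset.range K ×ˢ (Finset.univ.erase Finset.univ : Finset (Finset (Fin 4))) with hI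
  have hP := congrUpTo_twistedPExp plethysticArgument d (I.image fun x => exponentIndex x.1 x.2)
    (fun h => by
      obtain ⟨x, -, hx⟩ := Finset.mem_image.mp h
      exact exponentIndex_ne_zero _ _ hx)
    (fun e he0 heS hed => by
      by_contra hne
      obtain ⟨m, T, hT, rfl⟩ := exists_eq_nearConstant hne
      rw [degree_nearConstant] at hed
      apply heS
      have hTmem : T ∈ (Finset.univ.erase Finset.univ : Finset (Finset (Fin 4))) :=
        Finset.mem_erase.mpr ⟨hT, Finset.mem_univ T⟩
      by_cases h0 : T = ∅
      · have hm : m ≠ 0 := by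
          rintro rfl
          apply he0
          ext i
          simp [nearConstant_apply, h0]
        refine Finset.mem_image.mpr ⟨(m - 1, T), Finset.mem_product.mpr
          ⟨Finset.mem_range.mpr (by simp only; omega), hTmem⟩, ?_⟩
        rw [exponentIndex, if_pos h0]
        congr 1
        omega
      · refine Finset.mem_image.mpr ⟨(m, T), Finset.mem_product.mpr
          ⟨Finset.mem_range.mpr (by simp only; omega), hTmem⟩, ?_⟩
        rw [exponentIndex, if_neg h0])
  rw [Finset.prod_image (by
    rintro ⟨m, T⟩ hx ⟨m', T'⟩ hy hxy
    have h1 := (Finset.mem_erase.mp (Finset.mem_product.mp hx).2).1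
    have h2 := (Finset.mem_erase.mp (Finset.mem_product.mp hy).2).1
    obtain ⟨h3, h4⟩ := nearConstant_inj h1 h2 hxy
    simp only at h4
    subst h4
    simp only at h3
    refine Prod.ext ?_ rfl
    simp only
    split_ifs at h3 <;> omega)] at hP
  refine hP.specialize.trans ?_
  rw [map_prod, hI, Finset.prod_product]
  set B := fun K => ∏ m ∈ Finset.range K, (1 - qPow (4 * m + 2)) ^ (2 * m + 1) with hB
  have hBu : IsUnit (B K) := by
    rw [hB]
    simp only [IsUnit.prod_iff]
    exact fun m _ => (isUnit_one_sub_qPow (by omega)).pow _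
  refine CongrUpTo.of_mul_left hBu ?_
  rw [mul_comm, prod_prod_specialize_twistedFactor, mul_comm]
  refine CongrUpTo.mul ?_ (CongrUpTo.refl _ _)
  -- The surplus numerators involve only powers of degree above `d`.
  have h1 : B (2 * K) = B K * ∏ m ∈ Finset.range K, (1 - qPow (4 * (K + m) + 2)) ^ (2 * (K + m) + 1) := by
    simp only [hB]
    rw [two_mul, Finset.prod_range_add]
  change CongrUpTo d (B (2 * K)) (B K)
  rw [h1]
  nth_rw 2 [← mul_one (B K)]
  refine (CongrUpTo.refl d _).mul (CongrUpTo.prod_one fun m _ => ?_)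
  simpa using (congrUpTo_one_sub_qPow (show d < 4 * (K + m) + 2 by omega)).pow (2 * (K + m) + 1)

theorem coeff_zero_boxSeries : MvPowerSeries.coeff 0 boxSeries = 1 := by
  rw [boxSeries, coeff_countSeries, Nat.card_eq_one_iff_unique]
  have hzero : IsHeight 0 (0 : ℕ × ℕ →₀ ℕ) := ⟨fun _ _ => rfl, fun _ _ _ => le_rfl, fun _ _ _ => le_rfl⟩
  refine ⟨⟨?_⟩, ⟨⟨⟨0, hzero⟩, by simp⟩⟩⟩
  have key : ∀ x : {c : {h : ℕ × ℕ →₀ ℕ // IsHeight 0 h} // Finsupp.single () c.1.degree = 0},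
      x.1.1 = 0 := fun x => by
    have := x.2
    rw [Finsupp.single_eq_zero] at this
    exact (Finsupp.degree_eq_zero_iff _).mp this
  intro x y
  exact Subtype.ext (Subtype.ext ((key x).trans (key y).symm))

theorem congrUpTo_boxSeries {d K : ℕ} (hK : d < K) :
    CongrUpTo d (toIntSeries boxSeries) (∏ n ∈ Finset.range K, qGeom (n + 1) ^ (n + 1)) := by
  classical
  obtain ⟨H, hH, hsupp⟩ := exists_boxSeries_eq_mul K
  have h0 : MvPowerSeries.coeff 0 H = 1 := by
    have := coeff_zero_boxSeries
    rw [hH, MvPowerSeries.coeff_zero_eq_constantCoeff_apply, map_mul, map_prod,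
      Finset.prod_eq_one fun k _ => by rw [map_pow, constantCoeff_geometricSeries, one_pow],
      one_mul] at this
    exact this
  have hH1 : CongrUpTo d (toIntSeries H) 1 := by
    intro e he
    rw [MvPowerSeries.coeff_map, MvPowerSeries.coeff_one]
    split_ifs with h
    · rw [h, h0, map_one]
    · have : MvPowerSeries.coeff e H = 0 := by
        by_contra hne
        rcases hsupp e hne with h' | h'
        · exact h h'
        · rw [Finsupp.degree_eq_sum] at he
          simp only [Finset.univ_unique, PUnit.default_eq_unit, Finset.sum_singleton] at he
          exact absurd (h'.trans he) (by omega)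
      rw [this, map_zero]
  rw [hH, map_mul, map_prod]
  have h2 := (CongrUpTo.refl d (∏ n ∈ Finset.range K, qGeom (n + 1) ^ (n + 1))).mul hH1
  rw [mul_one] at h2
  simpa only [map_pow, ← qGeom.eq_def] using h2

/-- The quotient `Y` is supported on constant exponents, which have distinct degrees, so setting all
variables equal loses nothing. Both generating functions specialise to MacMahon's product, hence `Y
= 1`. -/
theorem eq_twistedPExp_of_eq_heightSeries {Z : MvPowerSeries (Fin 4) ℤ}
    (hZ : ∀ c : Fin 4, c ≠ 0 → ∃ π : Equiv.Perm (Fin 4), π 0 = 0 ∧ π 3 = c ∧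
      Z = toIntSeries (heightSeries π)) : Z = twistedPExp plethysticArgument := by
  classical
  have hPu : IsUnit (twistedPExp plethysticArgument) := by
    refine isUnit_of_constantCoeff_eq_one ?_
    have h := congrUpTo_twistedPExp plethysticArgument 0 ∅ (Finset.notMem_empty _)
      (fun e he0 _ hed => absurd ((Finsupp.degree_eq_zero_iff e).mp (Nat.le_zero.mp hed)) he0) 0
      (by simp)
    simpa using h
  obtain ⟨u, hu⟩ := hPu.exists_left_inv
  set Y := Z * u with hYdef
  have hY : Y * twistedPExp plethysticArgument = Z := by rw [hYdef, mul_assoc, hu, mul_one]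
  have hconst := fun e he => eq_of_coeff_quotient_ne_zero hY hZ (e := e) he
  have hspec : specialize Y = 1 := by
    refine MvPowerSeries.ext fun x => ?_
    obtain ⟨π, -, -, hπ⟩ := hZ 1 (by decide)
    set d := x.degree
    set M := ∏ n ∈ Finset.range (4 * (d + 1)), qGeom (n + 1) ^ (n + 1)
    have h1 : CongrUpTo d (specialize (twistedPExp plethysticArgument)) M :=
      congrUpTo_specialize_twistedPExp (by omega)
    have h2 : CongrUpTo d (specialize Z) M := by
      rw [hπ, specialize_heightSeries]
      exact congrUpTo_boxSeries (by omega)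
    have hM : IsUnit M := isUnit_of_constantCoeff_eq_one (by
      rw [map_prod]
      exact Finset.prod_eq_one fun n _ => by rw [map_pow, constantCoeff_qGeom, one_pow])
    have h3 : CongrUpTo d (specialize Y) 1 := by
      refine CongrUpTo.of_mul_left hM ?_
      rw [mul_one, mul_comm]
      refine ((CongrUpTo.refl d (specialize Y)).mul h1.symm).trans ?_
      rw [← map_mul, hY]
      exact h2
    exact h3 x le_rfl
  have hcoeff : ∀ n : ℕ, MvPowerSeries.coeff (nearConstant n ∅) Y = if n = 0 then 1 else 0 := by
    intro n
    have h1 := congrArg (MvPowerSeries.coeff (Finsupp.single () (4 * n))) hspec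
    have hmap : ∀ e : Fin 4 →₀ ℕ, e.mapDomain (fun _ => ()) = Finsupp.single () (4 * n) ↔
        e.degree = 4 * n := by
      intro e
      have h2 := Finsupp.degree_mapDomain (fun _ => ()) e
      constructor
      · intro h; rw [← h2, h, Finsupp.degree_single]
      · intro h
        rw [h, Finsupp.degree_eq_sum] at h2
        ext
        simpa using h2
    rw [MvPowerSeries.coeff_rename, Finset.sum_eq_single (nearConstant n ∅),
      MvPowerSeries.coeff_one] at h1
    · rw [h1]
      refine if_congr ?_ rfl rfl
      rw [Finsupp.single_eq_zero]
      omega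
    · intro e he hne
      by_contra h
      apply hne
      have hdeg : e.degree = 4 * n := (hmap e).mp (by simpa using he)
      have hc := hconst e h
      rw [Finsupp.degree_eq_sum, Finset.sum_congr rfl fun i _ => hc i 0] at hdeg
      simp at hdeg
      ext i
      simp [nearConstant_apply, hc i 0, hdeg]
    · intro h
      exfalso
      apply h
      simpa using (hmap (nearConstant n ∅)).mpr (by simp [degree_nearConstant])
  have hY1 : Y = 1 := by
    ext e
    by_cases h : MvPowerSeries.coeff e Y = 0
    · rw [h, MvPowerSeries.coeff_one, if_neg]
      rintro rfl
      have h1 := hcoeff 0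
      have h2 : nearConstant 0 (∅ : Finset (Fin 4)) = 0 := by ext i; simp [nearConstant_apply]
      rw [h2, h] at h1
      simp at h1
    · have hc := hconst e h
      have h2 : e = nearConstant (e 0) ∅ := by ext i; simp [nearConstant_apply, hc i 0]
      rw [MvPowerSeries.coeff_one]
      rw [h2, hcoeff] at h
      have h3 : e 0 = 0 := by by_contra h3; simp [h3] at h
      have h4 : e = 0 := by ext i; rw [hc i 0, h3]; rfl
      rw [if_pos h4, h2, hcoeff, if_pos h3]
  rw [← hY, hY1, one_mul]

/-! ### The characters of `μ₂ × μ₂` -/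

theorem prod_axis (l : Fin 3) : ∏ m : Fin 3, (if m = l then (1 : ℂ) else -1) = 1 := by
  fin_cases l <;> simp [Fin.prod_univ_three]

/-- The diagonal matrix whose only eigenvalue `1` is at the coordinate `l`. -/
def axisMatrix (l : Fin 3) : Matrix.SpecialLinearGroup (Fin 3) ℂ :=
  ⟨Matrix.diagonal fun m => if m = l then 1 else -1, by rw [Matrix.det_diagonal, prod_axis]⟩

theorem axisMatrix_mul_self (l : Fin 3) : axisMatrix l * axisMatrix l = 1 := by
  apply Subtype.ext
  change Matrix.diagonal _ * Matrix.diagonal _ = (1 : Matrix (Fin 3) (Fin 3) ℂ)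
  rw [Matrix.diagonal_mul_diagonal, ← Matrix.diagonal_one]
  congr 1
  funext m
  split_ifs <;> simp

/-- The element of `μ₂ × μ₂` whose only eigenvalue `1` is at the coordinate `l`. -/
def axisElement (l : Fin 3) : mu2mu2 :=
  ⟨axisMatrix l, Matrix.isDiag_diagonal _, by rw [sq, axisMatrix_mul_self]⟩

theorem coordCharacter_axisElement (l m : Fin 3) :
    ((coordCharacter m (axisElement l) : ℂˣ) : ℂ) = if m = l then 1 else -1 := by
  change Matrix.diagonal _ m m = _
  rw [Matrix.diagonal_apply_eq]

theorem coordCharacter_injective : Function.Injective coordCharacter := by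
  intro l m h
  have h1 := congrArg (fun χ : mu2mu2 →* ℂˣ => ((χ (axisElement l) : ℂˣ) : ℂ)) h
  simp only [coordCharacter_axisElement, if_pos] at h1
  by_contra hne
  rw [if_neg (Ne.symm hne)] at h1
  norm_num at h1

theorem coordCharacter_ne_one (l : Fin 3) : coordCharacter l ≠ 1 := by
  intro h
  have h1 := congrArg (fun χ : mu2mu2 →* ℂˣ => ((χ (axisElement (l + 1)) : ℂˣ) : ℂ)) h
  simp only [coordCharacter_axisElement, MonoidHom.one_apply, Units.val_one] at h1
  rw [if_neg (by fin_cases l <;> decide)] at h1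
  norm_num at h1

theorem coordCharacter_sq (l : Fin 3) : coordCharacter l ^ 2 = 1 := by
  ext g
  have h : g ^ 2 = 1 := Subtype.ext g.2.2
  rw [MonoidHom.pow_apply, ← map_pow, h, map_one, MonoidHom.one_apply]

theorem prod_coordCharacter : ∏ l, coordCharacter l = 1 := by
  ext g
  have h := g.1.2
  rw [← g.2.1.diagonal_diag, Matrix.det_diagonal] at h
  rw [MonoidHom.finsetProd_apply, MonoidHom.one_apply, Units.coe_prod]
  exact h

/-! ### Plane partitions and height functions -/

/-- The box with coordinates `i, j, k` along the axes `τ 0, τ 1, τ 2`. -/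
def boxAt (τ : Equiv.Perm (Fin 3)) (i j k : ℕ) : Fin 3 → ℕ := fun l => ![i, j, k] (τ.symm l)

theorem boxAt_eta (τ : Equiv.Perm (Fin 3)) (b : Fin 3 → ℕ) :
    boxAt τ (b (τ 0)) (b (τ 1)) (b (τ 2)) = b := by
  funext l
  obtain ⟨m, rfl⟩ := τ.surjective l
  fin_cases m <;> simp [boxAt]

theorem boxAt_le {τ : Equiv.Perm (Fin 3)} {i j k i' j' k' : ℕ} (hi : i ≤ i') (hj : j ≤ j')
    (hk : k ≤ k') : boxAt τ i j k ≤ boxAt τ i' j' k' := by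
  intro l
  simp only [boxAt]
  generalize τ.symm l = m
  fin_cases m
  exacts [hi, hj, hk]

theorem boxAt_zero (τ : Equiv.Perm (Fin 3)) (i j k : ℕ) : boxAt τ i j k (τ 0) = i := by simp [boxAt]

theorem boxAt_one (τ : Equiv.Perm (Fin 3)) (i j k : ℕ) : boxAt τ i j k (τ 1) = j := by simp [boxAt]

theorem boxAt_two (τ : Equiv.Perm (Fin 3)) (i j k : ℕ) : boxAt τ i j k (τ 2) = k := by simp [boxAt]

/-- The boxes under a height function. -/
def boxesUnder (τ : Equiv.Perm (Fin 3)) (h : ℕ × ℕ →₀ ℕ) : Finset (Fin 3 → ℕ) :=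
  (h.support.sigma fun p => Finset.range (h p)).map
    ⟨fun x => boxAt τ x.1.1 x.1.2 x.2, by
      rintro ⟨⟨i, j⟩, k⟩ ⟨⟨i', j'⟩, k'⟩ hx
      have h0 := congrFun hx (τ 0)
      have h1 := congrFun hx (τ 1)
      have h2 := congrFun hx (τ 2)
      simp only [boxAt_zero, boxAt_one, boxAt_two] at h0 h1 h2
      subst h0 h1 h2
      rfl⟩

theorem mem_boxesUnder (τ : Equiv.Perm (Fin 3)) (h : ℕ × ℕ →₀ ℕ) (b : Fin 3 → ℕ) :
    b ∈ boxesUnder τ h ↔ b (τ 2) < h (b (τ 0), b (τ 1)) := by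
  simp only [boxesUnder, Finset.mem_map, Finset.mem_sigma, Finset.mem_range, Sigma.exists,
    Prod.exists]
  constructor
  · rintro ⟨i, j, k, ⟨-, hk⟩, hb⟩
    have hb : boxAt τ i j k = b := hb
    rwa [← hb, boxAt_zero, boxAt_one, boxAt_two]
  · intro hb
    exact ⟨_, _, _, ⟨Finsupp.mem_support_iff.mpr (by omega), hb⟩, boxAt_eta τ b⟩

theorem boxAt_mem_boxesUnder (τ : Equiv.Perm (Fin 3)) (h : ℕ × ℕ →₀ ℕ) (i j k : ℕ) :
    boxAt τ i j k ∈ boxesUnder τ h ↔ k < h (i, j) := by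
  rw [mem_boxesUnder, boxAt_zero, boxAt_one, boxAt_two]

theorem isLowerSet_boxesUnder_iff (τ : Equiv.Perm (Fin 3)) (h : ℕ × ℕ →₀ ℕ) :
    IsLowerSet (boxesUnder τ h : Set (Fin 3 → ℕ)) ↔ IsHeight 0 h := by
  constructor
  · intro hlow
    have key : ∀ i j i' j', i ≤ i' → j ≤ j' → h (i', j') ≤ h (i, j) := by
      intro i j i' j' hi hj
      by_contra hlt
      push Not at hlt
      have h1 := (boxAt_mem_boxesUnder τ h i' j' (h (i, j))).mpr hlt
      have h2 := hlow (boxAt_le hi hj le_rfl) h1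
      have h3 := (boxAt_mem_boxesUnder τ h i j (h (i, j))).mp h2
      exact lt_irrefl _ h3
    exact ⟨fun p hp => absurd hp (Nat.not_lt_zero _), fun i j _ => key _ _ _ _ (by omega) le_rfl,
      fun i j _ => key _ _ _ _ le_rfl (by omega)⟩
  · intro hh b b' hle hb
    rw [Finset.mem_coe, mem_boxesUnder] at hb ⊢
    have := hh.antitone zero_le_one
      (show (b' (τ 0), b' (τ 1)) ≤ (b (τ 0), b (τ 1)) from ⟨hle _, hle _⟩)
    exact (hle (τ 2)).trans_lt (hb.trans_le this)

theorem boxesUnder_injective (τ : Equiv.Perm (Fin 3)) : Function.Injective (boxesUnder τ) := by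
  intro h h' heq
  ext ⟨i, j⟩
  have key : ∀ k, k < h (i, j) ↔ k < h' (i, j) := fun k => by
    rw [← boxAt_mem_boxesUnder τ, ← boxAt_mem_boxesUnder τ, heq]
  have h1 := key (h (i, j))
  have h2 := key (h' (i, j))
  omega

theorem exists_boxesUnder_eq (τ : Equiv.Perm (Fin 3)) {α : Finset (Fin 3 → ℕ)}
    (hα : IsLowerSet (α : Set (Fin 3 → ℕ))) : ∃ h, boxesUnder τ h = α := by
  classical
  have hinj : ∀ p : ℕ × ℕ, Function.Injective (boxAt τ p.1 p.2) := fun p k k' hk => by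
    have := congrFun hk (τ 2)
    rwa [boxAt_two, boxAt_two] at this
  set column : ℕ × ℕ → Finset ℕ := fun p => α.preimage (boxAt τ p.1 p.2) (hinj p).injOn
  have hcol : ∀ p k, k ∈ column p ↔ boxAt τ p.1 p.2 k ∈ α := fun p k => Finset.mem_preimage
  have hrange : ∀ p, column p = Finset.range (column p).card := fun p =>
    Finset.eq_range_card_of_isLowerSet fun k k' hk hmem => by
      rw [Finset.mem_coe, hcol] at hmem ⊢
      exact hα (boxAt_le le_rfl le_rfl hk) hmem
  refine ⟨Finsupp.onFinset (α.image fun b => (b (τ 0), b (τ 1))) (fun p => (column p).card) ?_, ?_⟩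
  · intro p hp
    obtain ⟨k, hk⟩ := Finset.card_ne_zero.mp hp
    rw [hcol] at hk
    exact Finset.mem_image.mpr ⟨_, hk, by rw [boxAt_zero, boxAt_one]⟩
  · ext b
    rw [mem_boxesUnder, Finsupp.onFinset_apply, ← Finset.mem_range, ← hrange, hcol, boxAt_eta]

/-- Plane partitions correspond to height functions. -/
def planePartitionEquiv (τ : Equiv.Perm (Fin 3)) :
    {h : ℕ × ℕ →₀ ℕ // IsHeight 0 h} ≃ PlanePartition :=
  Equiv.ofBijective (fun h => ⟨boxesUnder τ h.1, (isLowerSet_boxesUnder_iff τ h.1).mpr h.2⟩)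
    ⟨fun h h' heq => Subtype.ext (boxesUnder_injective τ (congrArg Subtype.val heq)), fun α => by
      obtain ⟨h, hh⟩ := exists_boxesUnder_eq τ α.2
      refine ⟨⟨h, (isLowerSet_boxesUnder_iff τ h).mp ?_⟩, Subtype.ext hh⟩
      rw [hh]
      exact α.2⟩

/-- The characters of the parity types. -/
def cellCharacter (τ : Equiv.Perm (Fin 3)) : Fin 4 → (mu2mu2 →* ℂˣ) :=
  ![1, coordCharacter (τ 0), coordCharacter (τ 1), coordCharacter (τ 2)]

theorem cellCharacter_injective (τ : Equiv.Perm (Fin 3)) :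
    Function.Injective (cellCharacter τ) := by
  have h1 : ∀ i j : Fin 3, i ≠ j → coordCharacter (τ i) ≠ coordCharacter (τ j) := fun i j hij h =>
    hij (τ.injective (coordCharacter_injective h))
  have h2 := fun i : Fin 3 => coordCharacter_ne_one (τ i)
  intro a b hab
  fin_cases a <;> fin_cases b <;> first
    | rfl
    | exact absurd hab (h2 _)
    | exact absurd hab.symm (h2 _)
    | exact absurd hab (h1 _ _ (by decide))

/-- Since `c = a * b`, the product is `a ^ (i + k) * b ^ (j + k)`, and only parities matter. -/
theorem pow_mul_pow_mul_pow_eq_cell {M : Type*} [CommMonoid M] {a b c : M} (ha : a ^ 2 = 1)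
    (hb : b ^ 2 = 1) (hc : c ^ 2 = 1) (habc : a * b * c = 1) (i j k : ℕ) :
    a ^ i * b ^ j * c ^ k = ![1, a, b, c] (cell (i + k) (j + k)) := by
  have hab : a * b = c := by
    calc a * b = a * b * c ^ 2 := by rw [hc, mul_one]
      _ = a * b * c * c := by rw [sq, mul_assoc, mul_assoc, mul_assoc]
      _ = c := by rw [habc, one_mul]
  have hbc : b * c = a := by
    rw [← hab, mul_comm a b, ← mul_assoc, ← sq, hb, one_mul]
  have hac : a * c = b := by
    rw [← hab, ← mul_assoc, ← sq, ha, one_mul]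
  have hcc : c * c = 1 := by rw [← sq, hc]
  have hcell : cell (i + k) (j + k) = ⟨(i % 2 + k % 2) % 2 + 2 * ((j % 2 + k % 2) % 2), by omega⟩ := by
    simp only [cell, Fin.ext_iff]
    omega
  rw [hcell, pow_eq_pow_mod i ha, pow_eq_pow_mod j hb, pow_eq_pow_mod k hc]
  rcases Nat.mod_two_eq_zero_or_one i with hi | hi <;>
    rcases Nat.mod_two_eq_zero_or_one j with hj | hj <;>
    rcases Nat.mod_two_eq_zero_or_one k with hk | hk <;>
    simp only [hi, hj, hk, pow_zero, pow_one, one_mul, mul_one, hab, hbc, hac, hcc] <;> rfl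

theorem boxCharacter_boxAt (τ : Equiv.Perm (Fin 3)) (i j k : ℕ) :
    boxCharacter (boxAt τ i j k) = cellCharacter τ (cell (i + k) (j + k)) := by
  rw [boxCharacter, ← Equiv.prod_comp τ, Fin.prod_univ_three, boxAt_zero, boxAt_one, boxAt_two]
  refine pow_mul_pow_mul_pow_eq_cell (coordCharacter_sq _) (coordCharacter_sq _)
    (coordCharacter_sq _) ?_ i j k
  rw [← Fin.prod_univ_three fun l => coordCharacter (τ l), Equiv.prod_comp τ, prod_coordCharacter]

/-- The trivial character and the three coordinate characters are distinct, and `ρ` shows that there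
are only four characters. Thus `c` is the colour of some axis, and this axis can be taken as the
vertical one. -/
theorem exists_colouredPartitionFunction_eq (ρ : Fin 4 ≃ (mu2mu2 →* ℂˣ)) (hρ : ρ 0 = 1)
    {c : Fin 4} (hc : c ≠ 0) : ∃ π : Equiv.Perm (Fin 4), π 0 = 0 ∧ π 3 = c ∧
      colouredPartitionFunction ρ = toIntSeries (heightSeries π) := by
  classical
  have hbij : ∀ τ : Equiv.Perm (Fin 3), Function.Bijective fun a => ρ.symm (cellCharacter τ a) :=
    fun τ => Finite.injective_iff_bijective.mp (ρ.symm.injective.comp (cellCharacter_injective τ))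
  have hzero : ∀ τ, ρ.symm (cellCharacter τ 0) = 0 := fun τ => by
    rw [Equiv.symm_apply_eq, hρ]; rfl
  obtain ⟨l, hl⟩ : ∃ l : Fin 3, ρ.symm (coordCharacter l) = c := by
    obtain ⟨a, ha⟩ := (hbij 1).2 c
    simp only at ha
    fin_cases a
    · exact absurd (ha.symm.trans (hzero 1)) hc
    · exact ⟨0, ha⟩
    · exact ⟨1, ha⟩
    · exact ⟨2, ha⟩
  set τ : Equiv.Perm (Fin 3) := Equiv.swap 2 l
  set π : Equiv.Perm (Fin 4) := Equiv.ofBijective _ (hbij τ) with hπ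
  have hπa : ∀ a, π a = ρ.symm (cellCharacter τ a) := fun a => rfl
  refine ⟨π, hzero τ, ?_, ?_⟩
  · rw [hπa, ← hl]
    change ρ.symm (coordCharacter (τ 2)) = _
    rw [Equiv.swap_apply_left]
  · have hweight : ∀ h, colourWeight ρ (planePartitionEquiv τ h) = cellExponent π h.1 := by
      intro h
      ext c
      simp only [colourWeight, cellExponent, Finsupp.equivFunOnFinite_symm_apply_apply, cellCount]
      change ((boxesUnder τ h.1).filter _).card = _
      rw [boxesUnder, Finset.card_filter, Finset.sum_map, Finset.sum_sigma]
      refine Finset.sum_congr rfl fun p _ => ?_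
      rw [Finset.card_filter]
      refine Finset.sum_congr rfl fun k _ => if_congr ?_ rfl rfl
      change boxCharacter (boxAt τ p.1 p.2 k) = ρ c ↔ _
      rw [boxCharacter_boxAt, Equiv.eq_symm_apply, hπa, Equiv.symm_apply_eq]
    ext n
    rw [MvPowerSeries.coeff_map, heightSeries, coeff_countSeries]
    change (Set.ncard {α : PlanePartition | colourWeight ρ α = n} : ℤ) = ((_ : ℕ) : ℤ)
    rw [← Nat.card_coe_set_eq]
    congr 1
    refine (Nat.card_congr ((planePartitionEquiv τ).subtypeEquiv fun h => ?_)).symm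
    rw [Set.mem_ofPred_eq, hweight]

theorem colouredPartitionFunction_eq_twistedPExp (ρ : Fin 4 ≃ (mu2mu2 →* ℂˣ)) (hρ : ρ 0 = 1) :
    colouredPartitionFunction ρ = twistedPExp plethysticArgument :=
  eq_twistedPExp_of_eq_heightSeries fun _ hc => exists_colouredPartitionFunction_eq ρ hρ hc

/-! ### The argument as a rational function -/

theorem monomial_nearConstant (m : ℕ) (T : Finset (Fin 4)) :
    MvPowerSeries.monomial (nearConstant m T) (1 : ℤ) =
      (∏ i, MvPowerSeries.X i) ^ m * ∏ i ∈ T, MvPowerSeries.X i := by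
  have h : nearConstant m T = m • ∑ i, Finsupp.single i 1 + ∑ i ∈ T, Finsupp.single i 1 := by
    ext i
    simp [nearConstant_apply, Finsupp.single_apply]
  have hX : ∀ S : Finset (Fin 4), MvPowerSeries.monomial (∑ i ∈ S, Finsupp.single i 1) (1 : ℤ) =
      ∏ i ∈ S, MvPowerSeries.X i := by
    intro S
    induction S using Finset.induction_on with
    | empty => simp
    | insert a S ha ih =>
      rw [Finset.sum_insert ha, Finset.prod_insert ha, ← ih, MvPowerSeries.X_def,
        MvPowerSeries.monomial_mul_monomial, one_mul]
  rw [h, ← hX, ← hX, MvPowerSeries.monomial_pow, MvPowerSeries.monomial_mul_monomial, one_pow,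
    one_mul]

/-- The sign of a subset, multiplied by four for the empty set. -/
def signCoeff (T : Finset (Fin 4)) : ℤ := (if T = ∅ then 4 else 1) * (-1) ^ T.card

open Classical in
theorem coeff_nearConstant_mul (k : ℕ) (f : MvPowerSeries (Fin 4) ℤ) (e : Fin 4 →₀ ℕ) :
    MvPowerSeries.coeff e (MvPowerSeries.monomial (nearConstant k ∅) 1 * f) =
      if nearConstant k ∅ ≤ e then MvPowerSeries.coeff (e - nearConstant k ∅) f else 0 := by
  rw [MvPowerSeries.coeff_monomial_mul, one_mul]

/-- For fixed `T` the coefficients are arithmetic in `m`, namely `signCoeff T` times `m` or `m + 1`.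
The factor `(1 - t) ^ 2` takes second differences, so only the first nonzero term survives: at `m =
0` if `0 ∈ T`, at `m = 1` otherwise. -/
theorem sq_mul_plethysticArgument :
    (1 - ∏ i, MvPowerSeries.X i) ^ 2 * plethysticArgument =
      ∑ T ∈ Finset.univ.erase Finset.univ,
        MvPowerSeries.monomial (nearConstant (if 0 ∈ T then 0 else 1) T) (signCoeff T) := by
  classical
  have h1 : ∀ k, MvPowerSeries.monomial (nearConstant k (∅ : Finset (Fin 4))) (1 : ℤ) =
      (∏ i, MvPowerSeries.X i) ^ k := fun k => by
    rw [monomial_nearConstant, Finset.prod_empty, mul_one]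
  have h2 : (1 - ∏ i, MvPowerSeries.X i) ^ 2 * plethysticArgument = plethysticArgument -
      2 * (MvPowerSeries.monomial (nearConstant 1 ∅) 1 * plethysticArgument) +
      MvPowerSeries.monomial (nearConstant 2 ∅) 1 * plethysticArgument := by
    rw [h1, h1]; ring
  rw [h2]
  ext e
  rw [map_add, map_sub, two_mul, map_add, coeff_nearConstant_mul, coeff_nearConstant_mul, map_sum]
  simp only [MvPowerSeries.coeff_monomial]
  have hcoeff : ∀ m (T : Finset (Fin 4)), T ≠ Finset.univ →
      MvPowerSeries.coeff (nearConstant m T) plethysticArgument =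
        signCoeff T * (m + if 0 ∈ T then 1 else 0) := by
    intro m T hT
    rw [coeff_plethysticArgument_nearConstant m hT, signCoeff, nearConstant_apply]
    push_cast
    rfl
  have hadd : ∀ m k (T : Finset (Fin 4)),
      nearConstant (m + k) T = nearConstant m T + nearConstant k ∅ := by
    intro m k T
    ext i
    simp only [nearConstant_apply, Finsupp.add_apply, Finset.notMem_empty, if_false]
    omega
  by_cases he : ∃ m T, T ≠ Finset.univ ∧ e = nearConstant m T
  · obtain ⟨m, T, hT, rfl⟩ := he
    have hle : ∀ k, nearConstant k ∅ ≤ nearConstant m T ↔ k ≤ m := by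
      intro k
      obtain ⟨i, hi⟩ : ∃ i, i ∉ T := by
        by_contra hne; push Not at hne; exact hT (Finset.eq_univ_of_forall hne)
      constructor
      · intro h
        have := h i
        simpa [nearConstant_apply, hi] using this
      · intro h j
        simp only [nearConstant_apply, Finset.notMem_empty, if_false]
        omega
    have hsub : ∀ k, k ≤ m → nearConstant m T - nearConstant k ∅ = nearConstant (m - k) T := by
      intro k hk
      conv_lhs => rw [← Nat.sub_add_cancel hk, hadd, add_tsub_cancel_right]
    rw [Finset.sum_eq_single T]
    · simp only [hle]
      have heq : nearConstant m T = nearConstant (if 0 ∈ T then 0 else 1) T ↔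
          m = if 0 ∈ T then 0 else 1 :=
        ⟨fun h => (nearConstant_inj hT hT h).1, fun h => by rw [← h]⟩
      rw [if_congr heq rfl rfl, hcoeff m T hT]
      rcases m with _ | _ | m
      · by_cases h0 : (0 : Fin 4) ∈ T <;> simp [h0]
      · rw [hsub 1 (by omega), hcoeff _ T hT]
        by_cases h0 : (0 : Fin 4) ∈ T <;> simp [h0]
        ring
      · rw [hsub 1 (by omega), hsub 2 (by omega), hcoeff _ T hT, hcoeff _ T hT,
          if_pos (show 1 ≤ m + 1 + 1 by omega), if_pos (show 2 ≤ m + 1 + 1 by omega),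
          if_neg (show ¬ (m + 1 + 1 = if 0 ∈ T then 0 else 1) by
            by_cases h0 : (0 : Fin 4) ∈ T <;> simp [h0])]
        simp only [show m + 1 + 1 - 1 = m + 1 by omega, show m + 1 + 1 - 2 = m by omega]
        push_cast
        ring
    · intro T' hT' hne
      rw [if_neg]
      intro h
      exact hne (nearConstant_inj hT (Finset.mem_erase.mp hT').1 h).2.symm
    · intro h
      exact absurd (Finset.mem_erase.mpr ⟨hT, Finset.mem_univ T⟩) h
  · have hz : ∀ k, nearConstant k ∅ ≤ e →
        MvPowerSeries.coeff (e - nearConstant k ∅) plethysticArgument = 0 := by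
      intro k hk
      by_contra hne
      obtain ⟨m, T, hT, hm⟩ := exists_eq_nearConstant hne
      exact he ⟨m + k, T, hT, by rw [hadd, ← hm, tsub_add_cancel_of_le hk]⟩
    have hz0 : MvPowerSeries.coeff e plethysticArgument = 0 := by
      by_contra hne
      exact he (exists_eq_nearConstant hne)
    rw [hz0, Finset.sum_eq_zero]
    · split_ifs with ha hb hb
      · rw [hz 1 ha, hz 2 hb]; rfl
      · rw [hz 1 ha]; rfl
      · rw [hz 2 hb]; rfl
      · rfl
    · intro T hT
      rw [if_neg]
      rintro rfl
      exact he ⟨_, T, (Finset.mem_erase.mp hT).1, rfl⟩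

/-- Expanding the product on the right, the terms divisible by `X 0` but not by `t` are those of the
proper subsets containing `0`, and the multiples of `t` of higher degree those of the nonempty
subsets avoiding `0`. Two copies of `t` come from the extreme terms; with the summand `2 t` they
make up the coefficient `4` of the empty set. -/
theorem sq_mul_plethysticArgument_eq :
    (1 - ∏ i, MvPowerSeries.X i) ^ 2 * plethysticArgument =
      2 * ∏ i, MvPowerSeries.X i + MvPowerSeries.X 0 * (MvPowerSeries.X 1 - 1) *
        (MvPowerSeries.X 2 - 1) * (MvPowerSeries.X 3 - 1) *
        (1 - MvPowerSeries.X 1 * MvPowerSeries.X 2 * MvPowerSeries.X 3) := by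
  have hterm : ∀ T ∈ (Finset.univ.erase Finset.univ : Finset (Finset (Fin 4))),
      MvPowerSeries.monomial (nearConstant (if 0 ∈ T then 0 else 1) T) (signCoeff T) =
      (signCoeff T : MvPowerSeries (Fin 4) ℤ) * ((∏ i, MvPowerSeries.X i) ^ (if 0 ∈ T then 0 else 1) *
        ∏ i ∈ T, MvPowerSeries.X i) := by
    intro T _
    rw [← monomial_nearConstant, ← zsmul_eq_mul, ← map_zsmul, smul_eq_mul, mul_one]
  have hsets : (Finset.univ.erase Finset.univ : Finset (Finset (Fin 4))) =
      {∅, {0}, {1}, {2}, {3}, {0, 1}, {0, 2}, {0, 3}, {1, 2}, {1, 3}, {2, 3}, {0, 1, 2}, {0, 1, 3},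
        {0, 2, 3}, {1, 2, 3}} := by decide
  rw [sq_mul_plethysticArgument, Finset.sum_congr rfl hterm, hsets]
  rw [Finset.sum_insert (by decide), Finset.sum_insert (by decide),
    Finset.sum_insert (by decide), Finset.sum_insert (by decide), Finset.sum_insert (by decide),
    Finset.sum_insert (by decide), Finset.sum_insert (by decide), Finset.sum_insert (by decide),
    Finset.sum_insert (by decide), Finset.sum_insert (by decide), Finset.sum_insert (by decide),
    Finset.sum_insert (by decide), Finset.sum_insert (by decide), Finset.sum_insert (by decide),
    Finset.sum_singleton, Fin.prod_univ_four]
  have p1 : ∀ a b : Fin 4, a ≠ b → ∏ i ∈ {a, b}, (MvPowerSeries.X i : MvPowerSeries (Fin 4) ℤ) =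
      MvPowerSeries.X a * MvPowerSeries.X b := fun a b h => Finset.prod_pair h
  have p2 : ∀ a b c : Fin 4, a ≠ b → a ≠ c → b ≠ c →
      ∏ i ∈ {a, b, c}, (MvPowerSeries.X i : MvPowerSeries (Fin 4) ℤ) =
      MvPowerSeries.X a * (MvPowerSeries.X b * MvPowerSeries.X c) := fun a b c h h' h'' => by
    rw [Finset.prod_insert (by simp [h, h']), Finset.prod_pair h'']
  have s0 : signCoeff ∅ = 4 := by decide
  have s1 : ∀ a, signCoeff {a} = -1 := by decide
  have s2 : ∀ a b, a ≠ b → signCoeff {a, b} = 1 := by decide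
  have s3 : ∀ a b c, a ≠ b → a ≠ c → b ≠ c → signCoeff {a, b, c} = -1 := by decide
  simp only [Finset.prod_empty, Finset.prod_singleton]
  rw [p1 0 1 (by decide), p1 0 2 (by decide), p1 0 3 (by decide), p1 1 2 (by decide),
    p1 1 3 (by decide), p1 2 3 (by decide), p2 0 1 2 (by decide) (by decide) (by decide),
    p2 0 1 3 (by decide) (by decide) (by decide), p2 0 2 3 (by decide) (by decide) (by decide),
    p2 1 2 3 (by decide) (by decide) (by decide), s0, s1, s1, s1, s1, s2 0 1 (by decide),
    s2 0 2 (by decide), s2 0 3 (by decide), s2 1 2 (by decide), s2 1 3 (by decide),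
    s2 2 3 (by decide), s3 0 1 2 (by decide) (by decide) (by decide),
    s3 0 1 3 (by decide) (by decide) (by decide), s3 0 2 3 (by decide) (by decide) (by decide),
    s3 1 2 3 (by decide) (by decide) (by decide)]
  simp only [show (0 : Fin 4) ∈ ({0} : Finset (Fin 4)) by decide,
    show (0 : Fin 4) ∉ (∅ : Finset (Fin 4)) by decide,
    show (0 : Fin 4) ∉ ({1} : Finset (Fin 4)) by decide,
    show (0 : Fin 4) ∉ ({2} : Finset (Fin 4)) by decide,
    show (0 : Fin 4) ∉ ({3} : Finset (Fin 4)) by decide,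
    show (0 : Fin 4) ∈ ({0, 1} : Finset (Fin 4)) by decide,
    show (0 : Fin 4) ∈ ({0, 2} : Finset (Fin 4)) by decide,
    show (0 : Fin 4) ∈ ({0, 3} : Finset (Fin 4)) by decide,
    show (0 : Fin 4) ∉ ({1, 2} : Finset (Fin 4)) by decide,
    show (0 : Fin 4) ∉ ({1, 3} : Finset (Fin 4)) by decide,
    show (0 : Fin 4) ∉ ({2, 3} : Finset (Fin 4)) by decide,
    show (0 : Fin 4) ∈ ({0, 1, 2} : Finset (Fin 4)) by decide,
    show (0 : Fin 4) ∈ ({0, 1, 3} : Finset (Fin 4)) by decide,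
    show (0 : Fin 4) ∈ ({0, 2, 3} : Finset (Fin 4)) by decide,
    show (0 : Fin 4) ∉ ({1, 2, 3} : Finset (Fin 4)) by decide, if_true, if_false, pow_zero, pow_one]
  push_cast
  ring

theorem signedCharacter_eq {K : Type*} [Field K] (u : Fin 3 → K) :
    fundamentalSignedCharacter u = (u 0 - (u 0)⁻¹) * (u 1 - (u 1)⁻¹) * (u 2 - (u 2)⁻¹) := by
  have h : ∀ x : K, (sl2Parity K * sl2Torus x).trace = x - x⁻¹ := fun x => by
    rw [sl2Parity, sl2Torus, Matrix.diagonal_mul_diagonal, Matrix.trace_diagonal, Fin.sum_univ_two]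
    simp [sub_eq_add_neg]
  rw [fundamentalSignedCharacter, ← Matrix.mul_kronecker_mul, ← Matrix.mul_kronecker_mul,
    Matrix.trace_kronecker, Matrix.trace_kronecker, h, h, h]

end

/-! ### The closed form in the field `K` -/

theorem mainTheorem9
    -- a labelling of the irreducible characters of `μ₂ × μ₂`, with `ρ₀` trivial
    (ρ : Fin 4 ≃ (mu2mu2 →* ℂˣ)) (hρ : ρ 0 = 1)
    -- a field containing the power series ring `ℤ[[t₀, t₁, t₂, t₃]]`
    {K : Type*} [Field K] [Algebra (MvPowerSeries (Fin 4) ℤ) K]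
    [FaithfulSMul (MvPowerSeries (Fin 4) ℤ) K]
    -- square roots `u j` of the variables `t₁, t₂, t₃`
    (u : Fin 3 → K)
    (hu : ∀ j, u j ^ 2 = algebraMap (MvPowerSeries (Fin 4) ℤ) K (MvPowerSeries.X j.succ))
    -- the product `t = t₀ t₁ t₂ t₃`
    (t : K) (ht : t = algebraMap (MvPowerSeries (Fin 4) ℤ) K (∏ i, MvPowerSeries.X i)) :
    -- the rational expression expands to a power series `F` with zero constant term, and
    -- the partition function is its twisted plethystic exponential
    (∃ F : MvPowerSeries (Fin 4) ℤ,
      MvPowerSeries.constantCoeff F = 0 ∧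
      algebraMap (MvPowerSeries (Fin 4) ℤ) K F =
        t / (1 - t) ^ 2 *
          (2 + (u 0 - (u 0)⁻¹) * (u 1 - (u 1)⁻¹) * (u 2 - (u 2)⁻¹) *
            ((u 0 * u 1 * u 2)⁻¹ - u 0 * u 1 * u 2)) ∧
      colouredPartitionFunction ρ = twistedPExp F ∧
      -- the form with a fourth variable such that `t₁ t₂ t₃ t₄ = 1`
      ∀ v : Fin 4 → K, (∀ j : Fin 3, v j.castSucc = u j) → ∏ j, v j = 1 →
        algebraMap (MvPowerSeries (Fin 4) ℤ) K F =
          t / (1 - t) ^ 2 * (2 + ∏ j, (v j - (v j)⁻¹))) ∧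
    -- the first three factors form the signed character of the fundamental representation
    -- of `sl₂³`
    (u 0 - (u 0)⁻¹) * (u 1 - (u 1)⁻¹) * (u 2 - (u 2)⁻¹) = fundamentalSignedCharacter u := by
  have hφ : Function.Injective (algebraMap (MvPowerSeries (Fin 4) ℤ) K) :=
    FaithfulSMul.algebraMap_injective _ K
  have hu0 : ∀ j, u j ≠ 0 := by
    intro j h0
    have h1 := hu j
    rw [h0, zero_pow two_ne_zero, eq_comm, map_eq_zero_iff _ hφ] at h1
    have h2 := congrArg (MvPowerSeries.coeff (Finsupp.single j.succ 1)) h1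
    simp [MvPowerSeries.coeff_X] at h2
  have ht1 : 1 - t ≠ 0 := by
    intro h0
    rw [ht, ← map_one (algebraMap (MvPowerSeries (Fin 4) ℤ) K), ← map_sub,
      map_eq_zero_iff _ hφ] at h0
    have h2 := congrArg MvPowerSeries.constantCoeff h0
    simp [map_prod] at h2
  -- Extracting `u j ^ 2` from `t` turns each factor `u j ^ 2 - 1` into `u j * (u j - (u j)⁻¹)`; the
  -- remaining product of the `u j` goes into the last factor.
  have htu : t = algebraMap (MvPowerSeries (Fin 4) ℤ) K (MvPowerSeries.X 0) *
      (u 0 ^ 2 * u 1 ^ 2 * u 2 ^ 2) := by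
    rw [ht, Fin.prod_univ_four, hu, hu, hu, ← map_mul, ← map_mul, ← map_mul]
    congr 1
    change _ = MvPowerSeries.X 0 * (MvPowerSeries.X 1 * MvPowerSeries.X 2 * MvPowerSeries.X 3)
    ring
  have hF : algebraMap (MvPowerSeries (Fin 4) ℤ) K plethysticArgument =
      t / (1 - t) ^ 2 * (2 + (u 0 - (u 0)⁻¹) * (u 1 - (u 1)⁻¹) * (u 2 - (u 2)⁻¹) *
        ((u 0 * u 1 * u 2)⁻¹ - u 0 * u 1 * u 2)) := by
    have h1 := congrArg (algebraMap (MvPowerSeries (Fin 4) ℤ) K) sq_mul_plethysticArgument_eq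
    simp only [map_mul, map_add, map_sub, map_pow, map_one, map_ofNat] at h1
    rw [← ht, show (1 : Fin 4) = (0 : Fin 3).succ from rfl,
      show (2 : Fin 4) = (1 : Fin 3).succ from rfl, show (3 : Fin 4) = (2 : Fin 3).succ from rfl,
      ← hu, ← hu, ← hu] at h1
    have h2 : algebraMap (MvPowerSeries (Fin 4) ℤ) K (MvPowerSeries.X 0) * (u 0 ^ 2 - 1) *
        (u 1 ^ 2 - 1) * (u 2 ^ 2 - 1) * (1 - u 0 ^ 2 * u 1 ^ 2 * u 2 ^ 2) =
        t * ((u 0 - (u 0)⁻¹) * (u 1 - (u 1)⁻¹) * (u 2 - (u 2)⁻¹) *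
          ((u 0 * u 1 * u 2)⁻¹ - u 0 * u 1 * u 2)) := by
      have := hu0 0
      have := hu0 1
      have := hu0 2
      rw [htu]
      field_simp
    rw [h2] at h1
    rw [div_mul_eq_mul_div, eq_div_iff (pow_ne_zero 2 ht1)]
    linear_combination h1
  refine ⟨⟨plethysticArgument, ?_, hF, colouredPartitionFunction_eq_twistedPExp ρ hρ, ?_⟩,
    (signedCharacter_eq u).symm⟩
  · rw [← MvPowerSeries.coeff_zero_eq_constantCoeff_apply]
    have h : (0 : Fin 4 →₀ ℕ) = nearConstant 0 ∅ := by
      ext i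
      simp [nearConstant_apply]
    rw [h, coeff_plethysticArgument_nearConstant 0 (by decide), nearConstant_apply]
    simp
  · intro v hv hv1
    have h0 : v 0 = u 0 := hv 0
    have h1 : v 1 = u 1 := hv 1
    have h2 : v 2 = u 2 := hv 2
    rw [Fin.prod_univ_four, h0, h1, h2] at hv1
    -- The product condition makes `v 3` the inverse of `u 0 * u 1 * u 2`, so its factor is the last
    -- bracket of the rational expression.
    rw [hF, Fin.prod_univ_four, h0, h1, h2, eq_inv_of_mul_eq_one_right hv1, inv_inv]
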